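/- **Setting.** Let $V=\bigoplus_k V^k$ be a $\mathbb Z$-graded real vector space, $I=[0,1]$, and let $\mathfrak g$ be the graded Lie algebra with $\mathfrak g^k=\prod_{n\ge 0}\mathrm{Hom}(V^{\otimes n},V[k+1-n])$ and the Gerstenhaber bracket $[f,g]=f\circ g-(-1)^{|f||g|}g\circ f$, where $$(f\circ g)(a_1,\dots,a_n)=\sum_{j+r\le n}(-1)^{|g|\maltese_j}f(a_1,\dots,a_j,g(a_{j+1},\dots,a_{j+r}),a_{j+r+1},\dots,a_n),\qquad \maltese_j=\sum_{i\le j}(|a_i|-1).$$ Let $\Omega^*(I\times I;\mathfrak g)$ (coordinates $s,t$ on the square) be the dg Lie algebra with the de Rham differential and the bracket $[\xi\otimes f,\theta\otimes g]=(-1)^{|\theta||f|}\,\xi\wedge\theta\otimes[f,g]$. Here a smooth function with values in a vector space $S$ is an element of $C^\infty\otimes S$, and a function with values in $\mathrm{Hom}(V^{\otimes n},V)$ is smooth if its value on each element of $V^{\otimes n}$ is; integrals and derivatives are taken accordingly. An uncurved $A_\infty$ structure on $V$ is $\mu=(\mu^n)_{n\ge1}\in\mathfrak g^1$ with $\mu\circ\mu=0$;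 an $A_\infty$ morphism $(V,\mu_{\mathcal A})\to(W,\mu_{\mathcal B})$ is a sequence $F^n:V^{\otimes n}\to W[1-n]$, $n\ge1$, with $$\sum_{s_1+\dots+s_r=n,\ s_i\ge 1}\mu_{\mathcal B}^r(F^{s_1},\dots,F^{s_r})=(F\circ\mu_{\mathcal A})^n\quad\text{for all }n\ge1 .$$ For an $A_\infty$ algebra $\mathcal B=(V,\mu)$, $\Omega^*(I;\mathcal B)=\Omega^*(I)\otimes\mathcal B$ carries the $A_\infty$ structure $$\mu^1(\omega\otimes b)=d\omega\otimes b+(-1)^{|\omega|}\omega\otimes\mu^1(b),\qquad \mu^n(\omega_1\otimes b_1,\dots,\omega_n\otimes b_n)=(-1)^{\diamond}\,\omega_1\cdots\omega_n\otimes\mu^n(b_1,\dots,b_n),\ n\ge2,$$ with the Koszul sign $\diamond=\sum_{j<k}|b_j||\omega_k|+\sum_k k|\omega_k|$. *Path construction.* Let $a_u$, $u\in[0,1]$, be a smooth family of operators of degree $0$ on a graded space ($a_u^n$ of degree $1-n$). For $p\le q$ and an integer $d\ge0$ put, for $n\ge 1$, $$F^n_{p\to q}=\sum_{i=0}^{n-1+d}(-1)^i\int_{p\le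 t_1\le\dots\le t_i\le q}T_{t_1,\dots,t_i}^n\,dt_1\cdots dt_i ,$$ where $T^n_{\emptyset}=\mathrm{id}$ for $n=1$ and $0$ otherwise, and $T_{t_1,\dots,t_i}=T_{t_2,\dots,t_i}\circ a_{t_1}$; thus $T^n_{t_1,\dots,t_i}$ is the sum over all rooted planar trees with $n$ leaves and $i$ levels with exactly one vertex per level, the vertex of the $j$-th level from the leaves being labelled by $a_{t_j}$ (vertices of valence two are allowed). **Theorem.** Let $\alpha=\alpha^0+\alpha^1+\alpha^2\in\Omega^*(I\times I;\mathfrak g)$ be of total degree $1$ with $d\alpha+\frac12[\alpha,\alpha]=0$. Let $\alpha^{m,n}$ be the component of $\alpha$ of form degree $m$ with $n$ inputs, and write $\alpha^1=a\,ds+c\,dt$, $\alpha^2=b\,ds\wedge dt$. Assume that $\alpha^{0,0}=\alpha^{1,0}=\alpha^{2,0}=0$ and $\alpha^{1,1}=0$, and that the restriction of the form $\alpha$ to each of the edges $s=0$ and $s=1$ is constant, i.e. there $\alpha^{0}$ does not depend on $t$ and $c=0$. Let $\mathcal A_{s=0},\mathcal A_{s=1}$ be $V$ with the $A_\infty$ structures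 $\alpha^0|_{s=0}$, $\alpha^0|_{s=1}$. For $t\in I$ let $F_t$ be the path construction $0\to1$ with $d=0$ for the family $s\mapsto a(s,t)$ on $V$. Let $\hat\alpha$ be the collapsed form on $I$ (coordinate $s$) with values in operators on $\Omega^*(I;V)$ (coordinate $t$): $\hat\alpha^{0,n}=\delta_{1,n}d+\alpha^{0,n}+dt\otimes c^n$ and $\hat\alpha^{1,n}=ds\otimes(a^n+dt\otimes b^n)$, extended to forms in $t$ by the Koszul rule. Let $\hat G$ be the path construction $0\to1$ with $d=1$ for the family $s\mapsto a+dt\otimes b$ on $\Omega^*(I;V)$. Then: 1. $\hat\alpha^{0}|_{s=0}$ and $\hat\alpha^0|_{s=1}$ are the $A_\infty$ structures of $\Omega^*(I;\mathcal A_{s=0})$ and $\Omega^*(I;\mathcal A_{s=1})$, and $\hat G$ is an $A_\infty$ morphism $\Omega^*(I;\mathcal A_{s=0})\to\Omega^*(I;\mathcal A_{s=1})$. 2. $\hat G$ gives a differential homotopy with respect to the family $F_t$: each $F_t$ is an $A_\infty$ morphism $\mathcal A_{s=0}\to\mathcal A_{s=1}$, and, with $\iota:\mathcal A_{s=0}\to\Omega^*(I;\mathcal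 A_{s=0})$ the inclusion of constants, $\phi^n=\hat G^n\circ\iota^{\otimes n}$, $n\ge1$, is an $A_\infty$ morphism $\mathcal A_{s=0}\to\Omega^*(I;\mathcal A_{s=1})$ of the form $\phi^n(a_1,\dots,a_n)(t)=F^n_t(a_1,\dots,a_n)+dt\otimes\Theta^n_t(a_1,\dots,a_n)$. -/

import Mathlib

open scoped ContDiff

noncomputable section

namespace AInf

/-! ### Graded spaces and operators

A sequence of maps `f^n : V^{⊗ n} → W`, one for each `n`, is encoded as one function on words
`[a₁, …, aₙ]`; only its values on words of homogeneous elements matter.  Linearity and degrees are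
imposed by the predicates below. -/

/-- A sequence of maps `f^n` with `n` arguments in `V`, `n ≥ 0`, and values in `W`. -/
abbrev Op (V W : Type*) := List V → W

/-- A `ℤ`-graded real vector space, given by its homogeneous parts inside an ambient space `W`.
`sg` is multiplication by `(-1)^(|v| - 1)` on homogeneous `v`, the sign of the shifted degree.
`test` is a separating family of functionals, with respect to which `W`-valued functions
are integrated. -/
structure GradedSpace (W : Type*) [AddCommGroup W] [Module ℝ W] where
  part : ℤ → Submodule ℝ W
  sg : W →ₗ[ℝ] W
  sg_apply : ∀ k v, v ∈ part k → sg v = ((k - 1).negOnePow : ℤ) • v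
  test : Set (Module.Dual ℝ W)
  test_separates : ∀ v, (∀ ℓ ∈ test, ℓ v = 0) → v = 0

/-- The graded space of a vector space `V = ⨁ₖ 𝒱 k`; all linear functionals are used as tests. -/
def gradedSpace {V : Type*} [AddCommGroup V] [Module ℝ V] (𝒱 : ℤ → Submodule ℝ V)
    [DirectSum.Decomposition 𝒱] : GradedSpace V where
  part := 𝒱
  sg := DirectSum.toModule ℝ ℤ V (fun k => ((k - 1).negOnePow : ℤ) • (𝒱 k).subtype) ∘ₗ
    (DirectSum.decomposeLinearEquiv 𝒱).toLinearMap
  sg_apply := by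
    intro k v hv
    lift v to 𝒱 k using hv
    simp only [LinearMap.comp_apply, LinearEquiv.coe_coe, DirectSum.decomposeLinearEquiv_apply,
      DirectSum.decompose_coe]
    rw [← DirectSum.lof_eq_of ℝ, DirectSum.toModule_lof]
    rfl
  test := Set.univ
  test_separates := fun v h =>
    (Module.forall_dual_apply_eq_zero_iff ℝ v).1 fun ℓ => h ℓ (Set.mem_univ ℓ)

section operators

variable {V W U : Type*} [AddCommGroup V] [Module ℝ V] [AddCommGroup W] [Module ℝ W]
  [AddCommGroup U] [Module ℝ U]

/-- A word of homogeneous elements. -/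
def IsHomog (A : GradedSpace V) (l : List V) : Prop := ∀ v ∈ l, ∃ k, v ∈ A.part k

/-- Each `f^n` has degree `k + 1 - n`, that is `f^n : V^{⊗ n} → W[k + 1 - n]`. -/
def HasDegree (A : GradedSpace V) (B : GradedSpace W) (k : ℤ) (f : Op V W) : Prop :=
  ∀ (ks : List ℤ) (l : List V), List.Forall₂ (fun i v => v ∈ A.part i) ks l →
    f l ∈ B.part (ks.sum + k + 1 - l.length)

/-- `f` belongs to `∏ₙ Hom(V^{⊗ n}, W[k + 1 - n])`: each `f^n` is linear in each homogeneous
argument, and has degree `k + 1 - n`. -/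
structure IsCochain (A : GradedSpace V) (B : GradedSpace W) (k : ℤ) (f : Op V W) : Prop where
  linear : ∀ (x z : List V) (i : ℤ) (a b : V) (c : ℝ), IsHomog A x → IsHomog A z →
    a ∈ A.part i → b ∈ A.part i →
    f (x ++ (c • a + b) :: z) = c • f (x ++ a :: z) + f (x ++ b :: z)
  degree : HasDegree A B k f

/-- The Gerstenhaber circle product with `g` of degree `k`, with its Koszul sign:
`(f ∘ g)(a₁, …, aₙ) = ∑ (-1)^(k ✠ⱼ) f(a₁, …, aⱼ, g(aⱼ₊₁, …, aⱼ₊ᵣ), aⱼ₊ᵣ₊₁, …, aₙ)` over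
`j, r ≥ 0` with `j + r ≤ n`, where `✠ⱼ = ∑_{i ≤ j} (|aᵢ| - 1)`. -/
def circ (A : GradedSpace V) (k : ℤ) (f : Op V W) (g : Op V V) : Op V W := fun l =>
  ∑ j ∈ Finset.range (l.length + 1), ∑ r ∈ Finset.range (l.length - j + 1),
    f ((l.take j).map (fun v => if Even k then v else A.sg v) ++
      g ((l.drop j).take r) :: l.drop (j + r))

/-- The Gerstenhaber bracket of `f` of degree `k` and `g` of degree `m`. -/
def gerst (A : GradedSpace V) (k m : ℤ) (f g : Op V V) : Op V V := fun l =>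
  circ A m f g l - ((k * m).negOnePow : ℤ) • circ A k g f l

/-- `μ` is an (uncurved) `A_∞` structure on the graded space `A`. -/
structure IsAInf (A : GradedSpace V) (μ : Op V V) : Prop where
  uncurved : μ [] = 0
  cochain : IsCochain A A 1 μ
  rel : ∀ l, IsHomog A l → circ A 1 μ μ l = 0

/-- `F` is an `A_∞` morphism from `(A, μA)` to `(B, μB)`:
`∑ μB^r(F^{s₁}(a₁, …), …, F^{s_r}(…, aₙ)) = ∑ (-1)^{✠ⱼ} F(a₁, …, aⱼ, μA(…), …, aₙ)`, the sum on the
left being over all `s₁ + ⋯ + s_r = n` with `sᵢ ≥ 1`. -/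
structure IsAInfMorphism (A : GradedSpace V) (μA : Op V V) (B : GradedSpace W) (μB : Op W W)
    (F : Op V W) : Prop where
  source : IsAInf A μA
  target : IsAInf B μB
  cochain : IsCochain A B 0 F
  rel : ∀ l, l ≠ [] → IsHomog A l →
    ∑ c : Composition l.length, μB ((l.splitWrtComposition c).map F) = circ A 1 F μA l

/-! ### Calculus with values in a vector space without topology -/

/-- The vector `w` with `ℓ w = Φ ℓ` for all `ℓ` in the separating family `Λ` (and `0` if there is
none). -/
def represented (Λ : Set (Module.Dual ℝ W)) (Φ : Module.Dual ℝ W → ℝ) : W := by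
  classical exact if h : ∃ w, ∀ ℓ ∈ Λ, ℓ w = Φ ℓ then h.choose else 0

theorem represented_eq {Λ : Set (Module.Dual ℝ W)} {Φ : Module.Dual ℝ W → ℝ}
    (hΛ : ∀ v : W, (∀ ℓ ∈ Λ, ℓ v = 0) → v = 0) {w : W} (hw : ∀ ℓ ∈ Λ, ℓ w = Φ ℓ) :
    represented Λ Φ = w := by
  have ex : ∃ w, ∀ ℓ ∈ Λ, ℓ w = Φ ℓ := ⟨w, hw⟩
  unfold represented
  rw [dif_pos ex]
  refine sub_eq_zero.1 (hΛ _ fun ℓ hℓ => ?_)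
  rw [map_sub, ex.choose_spec ℓ hℓ, hw ℓ hℓ, sub_self]

/-- `f` belongs to `C^∞(X) ⊗ S`, where `X` is a closed interval or square in `E`, and smooth
functions on `X` are the restrictions of smooth functions on `E`. -/
def IsSmooth {X E : Type*} [NormedAddCommGroup E] [NormedSpace ℝ E] (emb : X → E)
    (S : Submodule ℝ W) (f : X → W) : Prop :=
  ∃ (N : ℕ) (g : Fin N → E → ℝ) (w : Fin N → W), (∀ i, ContDiff ℝ ∞ (g i)) ∧ (∀ i, w i ∈ S) ∧
    ∀ x, f x = ∑ i, g i (emb x) • w i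

/-- The derivative of `f : [0,1] → W` (one-sided at the end points):
`∑ gᵢ • wᵢ ↦ ∑ gᵢ' • wᵢ`. -/
def vderiv (f : unitInterval → W) (t : unitInterval) : W :=
  represented Set.univ fun ℓ =>
    derivWithin (fun y : ℝ => ℓ (f (Set.projIcc 0 1 zero_le_one y))) (Set.Icc 0 1) (t : ℝ)

/-- The integral of `Φ [t₁, …, tᵢ]` over the simplex `p ≤ t₁ ≤ ⋯ ≤ tᵢ ≤ q`. -/
def simplexIntegral : ℕ → unitInterval → unitInterval → (List unitInterval → ℝ) → ℝ
  | 0, _, _, Φ => Φ []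
  | i + 1, p, q, Φ => ∫ t in Set.Icc p q, simplexIntegral i t q (fun ts => Φ (t :: ts))

/-! ### The path construction -/

/-- `trees A a [t₁, …, tᵢ]` at a word of length `n` is the sum of all rooted planar trees with `n`
leaves and `i` levels, with one vertex per level, the vertex of level `j`, counted from the leaves,
being labelled by `a_{tⱼ}` (trees with vertices of valence two are allowed).  The tree of height
zero is the identity. -/
def trees (A : GradedSpace W) (a : unitInterval → Op W W) : List unitInterval → Op W W
  | [] => fun l => match l with
    | [w] => w
    | _ => 0
  | t :: ts => circ A 0 (trees A a ts) (a t)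

/-- The maps `F^n_{p → q} = ∑_{i ≤ n - 1 + d} (-1)^i ∫_{p ≤ t₁ ≤ ⋯ ≤ tᵢ ≤ q} (i,n)-trees`, for
`p ≤ q` and `n ≥ 1`, attached to the one-form `a_t dt` on `[0,1]` with values in operators of
degree `0`; the term `i = 0` is the identity if `n = 1`, and zero otherwise. -/
def pathMap (A : GradedSpace W) (d : ℕ) (a : unitInterval → Op W W) (p q : unitInterval) :
    Op W W := fun l =>
  ∑ i ∈ Finset.range (l.length + d), (-1 : ℝ) ^ i •
    represented A.test (fun ℓ => simplexIntegral i p q (fun ts => ℓ (trees A a ts l)))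

/-! ### The differential graded Lie algebra of the square -/

/-- A form `α = c0 + cs ds + ct dt + cst ds ∧ dt` on the square (coordinates `s`, `t`) with values
in operators, given by its coefficients. -/
structure SqForm (V : Type*) where
  c0 : unitInterval → unitInterval → Op V V
  cs : unitInterval → unitInterval → Op V V
  ct : unitInterval → unitInterval → Op V V
  cst : unitInterval → unitInterval → Op V V

/-- A smooth function on the square with values in `∏ₙ Hom(V^{⊗ n}, V[k + 1 - n])`. -/
structure IsSmoothFamily (A : GradedSpace V) (k : ℤ)
    (f : unitInterval → unitInterval → Op V V) : Prop where
  multilinear : ∀ s t n, ∃ M : MultilinearMap ℝ (fun _ : Fin n => V) V,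
    ∀ v : Fin n → V, f s t (List.ofFn v) = M v
  degree : ∀ s t, HasDegree A A k (f s t)
  smooth : ∀ l, IsSmooth (fun x : unitInterval × unitInterval => ((x.1 : ℝ), (x.2 : ℝ))) ⊤
    (fun x => f x.1 x.2 l)

/-- `α` is an element of total degree `w` of `Ω^*(I × I; 𝔤)`, where
`𝔤^k = ∏ₙ Hom(V^{⊗ n}, V[k + 1 - n])`. -/
structure SqForm.IsForm (A : GradedSpace V) (w : ℤ) (α : SqForm V) : Prop where
  h0 : IsSmoothFamily A w α.c0
  hs : IsSmoothFamily A (w - 1) α.cs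
  ht : IsSmoothFamily A (w - 1) α.ct
  hst : IsSmoothFamily A (w - 2) α.cst

/-- The exterior derivative of a form on the square. -/
def SqForm.d (α : SqForm V) : SqForm V where
  c0 := fun _ _ _ => 0
  cs := fun s t l => vderiv (fun s' => α.c0 s' t l) s
  ct := fun s t l => vderiv (fun t' => α.c0 s t' l) t
  cst := fun s t l => vderiv (fun s' => α.ct s' t l) s - vderiv (fun t' => α.cs s t' l) t

/-- The bracket of forms of total degrees `w` and `w'`:
`[ξ ⊗ f, θ ⊗ g] = (-1)^(|θ| |f|) ξ ∧ θ ⊗ [f, g]`. -/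
def SqForm.bracket (A : GradedSpace V) (w w' : ℤ) (α β : SqForm V) : SqForm V where
  c0 := fun s t => gerst A w w' (α.c0 s t) (β.c0 s t)
  cs := fun s t l => gerst A (w - 1) w' (α.cs s t) (β.c0 s t) l +
    (w.negOnePow : ℤ) • gerst A w (w' - 1) (α.c0 s t) (β.cs s t) l
  ct := fun s t l => gerst A (w - 1) w' (α.ct s t) (β.c0 s t) l +
    (w.negOnePow : ℤ) • gerst A w (w' - 1) (α.c0 s t) (β.ct s t) l
  cst := fun s t l => gerst A (w - 2) w' (α.cst s t) (β.c0 s t) l +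
    gerst A w (w' - 2) (α.c0 s t) (β.cst s t) l +
    ((w - 1).negOnePow : ℤ) • (gerst A (w - 1) (w' - 1) (α.cs s t) (β.ct s t) l -
      gerst A (w - 1) (w' - 1) (α.ct s t) (β.cs s t) l)

/-- `α` is a solution of total degree one of the Maurer–Cartan equation `d α + ½ [α, α] = 0` in
`Ω^*(I × I; 𝔤)`. -/
structure SqForm.IsMC (A : GradedSpace V) (α : SqForm V) : Prop where
  isForm : α.IsForm A 1
  eq0 : ∀ s t l, α.d.c0 s t l + (1 / 2 : ℝ) • (SqForm.bracket A 1 1 α α).c0 s t l = 0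
  eqs : ∀ s t l, α.d.cs s t l + (1 / 2 : ℝ) • (SqForm.bracket A 1 1 α α).cs s t l = 0
  eqt : ∀ s t l, α.d.ct s t l + (1 / 2 : ℝ) • (SqForm.bracket A 1 1 α α).ct s t l = 0
  eqst : ∀ s t l, α.d.cst s t l + (1 / 2 : ℝ) • (SqForm.bracket A 1 1 α α).cst s t l = 0

/-- `α^{0,0} = α^{1,0} = α^{2,0} = 0`. -/
def SqForm.Uncurved (α : SqForm V) : Prop :=
  ∀ s t, α.c0 s t [] = 0 ∧ α.cs s t [] = 0 ∧ α.ct s t [] = 0 ∧ α.cst s t [] = 0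

/-- `α^{1,1} = 0`. -/
def SqForm.OneOneZero (α : SqForm V) : Prop :=
  ∀ s t v, α.cs s t [v] = 0 ∧ α.ct s t [v] = 0

/-- The family is constant on the edge `{s} × I`: the restriction of the form `α` to this edge is
the pullback of its value at a point, so that `α^{0,n}` does not depend on `t` there, and the
`dt`-coefficient of `α^{1,n}` vanishes. -/
def SqForm.ConstantOnEdge (α : SqForm V) (s : unitInterval) : Prop :=
  ∀ t l, α.c0 s t l = α.c0 s 0 l ∧ α.ct s t l = 0

/-! ### Forms on the interval with values in a graded space -/

/-- A pair `(f, g)` stands for the form `f + dt ⊗ g` on `[0,1]`; here `f` and `g` are not required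
to be smooth. -/
abbrev Pre (V : Type*) := (unitInterval → V) × (unitInterval → V)

/-- The graded space `Ω^*([0,1]; V)`: the part of degree `k` consists of the forms `f + dt ⊗ g` with
`f ∈ C^∞([0,1]) ⊗ V^k` and `g ∈ C^∞([0,1]) ⊗ V^{k-1}`.  The tests are evaluations at points
followed by tests on `V`, so integrals are taken pointwise. -/
def forms (A : GradedSpace V) : GradedSpace (Pre V) where
  part := fun k =>
    { carrier := {η | IsSmooth (fun x : unitInterval => (x : ℝ)) (A.part k) η.1 ∧
        IsSmooth (fun x : unitInterval => (x : ℝ)) (A.part (k - 1)) η.2}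
      add_mem' := by
        have key : ∀ (S : Submodule ℝ V) (f g : unitInterval → V),
            IsSmooth (fun x : unitInterval => (x : ℝ)) S f →
            IsSmooth (fun x : unitInterval => (x : ℝ)) S g →
            IsSmooth (fun x : unitInterval => (x : ℝ)) S (f + g) := by
          rintro S f g ⟨N, a, v, ha, hv, hf⟩ ⟨M, b, w, hb, hw, hg⟩
          refine ⟨N + M, Fin.append a b, Fin.append v w, ?_, ?_, ?_⟩
          · intro i
            refine Fin.addCases (fun i => ?_) (fun i => ?_) i
            · simpa using ha i
            · simpa using hb i
          · intro i
            refine Fin.addCases (fun i => ?_) (fun i => ?_) i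
            · simpa using hv i
            · simpa using hw i
          · intro x
            simp [Fin.sum_univ_add, hf, hg]
        intro x y h h'
        exact And.intro (key _ _ _ h.1 h'.1) (key _ _ _ h.2 h'.2)
      zero_mem' := by
        have key : ∀ S : Submodule ℝ V, IsSmooth (fun x : unitInterval => (x : ℝ)) S
            (0 : unitInterval → V) := fun S =>
          ⟨0, Fin.elim0, Fin.elim0, fun i => i.elim0, fun i => i.elim0, fun x => by simp⟩
        exact And.intro (key _) (key _)
      smul_mem' := by
        have key : ∀ (S : Submodule ℝ V) (c : ℝ) (f : unitInterval → V),
            IsSmooth (fun x : unitInterval => (x : ℝ)) S f →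
            IsSmooth (fun x : unitInterval => (x : ℝ)) S (c • f) := by
          rintro S c f ⟨N, a, v, ha, hv, hf⟩
          refine ⟨N, a, fun i => c • v i, ha, fun i => S.smul_mem c (hv i), fun x => ?_⟩
          simp [hf, Finset.smul_sum, smul_comm c]
        intro c x h
        exact And.intro (key _ _ _ h.1) (key _ _ _ h.2) }
  sg := LinearMap.prodMap (A.sg.compLeft unitInterval) (-(A.sg.compLeft unitInterval))
  sg_apply := by
    have key : ∀ (k : ℤ) (f : unitInterval → V),
        IsSmooth (fun x : unitInterval => (x : ℝ)) (A.part k) f →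
        ∀ x, A.sg (f x) = ((k - 1).negOnePow : ℤ) • f x := by
      rintro k f ⟨N, a, v, -, hv, hf⟩ x
      refine A.sg_apply k _ ?_
      rw [hf]
      exact Submodule.sum_mem _ fun i _ => Submodule.smul_mem _ _ (hv i)
    rintro k ⟨f, g⟩ ⟨hf, hg⟩
    refine Prod.ext (funext fun x => ?_) (funext fun x => ?_)
    · simpa using key k f hf x
    · have := key (k - 1) g hg x
      simp only [Int.negOnePow_sub _ 1] at this ⊢
      simp [this]
  test := {ψ | ∃ ℓ ∈ A.test, ∃ t : unitInterval,
    ψ = ℓ ∘ₗ LinearMap.proj t ∘ₗ LinearMap.fst ℝ (unitInterval → V) (unitInterval → V) ∨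
    ψ = ℓ ∘ₗ LinearMap.proj t ∘ₗ LinearMap.snd ℝ (unitInterval → V) (unitInterval → V)}
  test_separates := by
    rintro ⟨f, g⟩ h
    refine Prod.ext (funext fun t => ?_) (funext fun t => ?_)
    · exact A.test_separates _ fun ℓ hℓ => h _ ⟨ℓ, hℓ, t, Or.inl rfl⟩
    · exact A.test_separates _ fun ℓ hℓ => h _ ⟨ℓ, hℓ, t, Or.inr rfl⟩

/-- The form-linear extension of the operator-valued form `P + dt ⊗ Q` on `[0,1]`, of total degree
`k`, to an operator on forms `ηᵢ = fᵢ + dt ⊗ gᵢ`.  By the Koszul rule, `dt` in the `i`-th argument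
has to pass the operator `P` of degree `k` and the arguments before it:
`P(f₁, …, fₙ) + dt ⊗ (Q(f₁, …, fₙ) + ∑ᵢ (-1)^(k + ✠ᵢ₋₁) P(f₁, …, gᵢ, …, fₙ))`. -/
def extend (A : GradedSpace V) (k : ℤ) (P Q : unitInterval → Op V V) : Op (Pre V) (Pre V) :=
  fun L =>
    (fun t => P t (L.map fun η => η.1 t),
     fun t => Q t (L.map fun η => η.1 t) +
      (k.negOnePow : ℤ) • ∑ i : Fin L.length,
        P t ((L.take i).map (fun η => A.sg (η.1 t)) ++
          (L.get i).2 t :: (L.drop (i + 1)).map (fun η => η.1 t)))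

/-- The de Rham differential `f + dt ⊗ g ↦ dt ⊗ f'`, as an operator with one argument. -/
def deRham : Op (Pre V) (Pre V) := fun L => match L with
  | [η] => (0, vderiv η.1)
  | _ => 0

/-- The `A_∞` structure of `Ω^*([0,1]; 𝓑) = Ω^*([0,1]) ⊗ 𝓑`: the de Rham differential plus the
form-linear extension of `μ`. -/
def formsStructure (A : GradedSpace V) (μ : Op V V) : Op (Pre V) (Pre V) :=
  fun L => deRham L + extend A 1 (fun _ => μ) (fun _ _ => 0) L

/-- The inclusion of `V` into `Ω^*([0,1]; V)` as constant functions. -/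
def const (v : V) : Pre V := (fun _ => v, fun _ => 0)

/-! ### Collapsing the square to the interval with coordinate `s` -/

/-- The component `α̂^{0,n}` at `s`, namely `δ_{1,n} d + α^{0,n} + dt ⊗ ι_{∂t} α^{1,n}`. -/
def SqForm.collapse0 (A : GradedSpace V) (α : SqForm V) (s : unitInterval) : Op (Pre V) (Pre V) :=
  fun L => deRham L + extend A 1 (α.c0 s) (α.ct s) L

/-- The coefficient of `ds` in `α̂^{1,n}` at `s`: the operator `a + dt ⊗ b`, where
`a = ι_{∂s} α^{1,n}` and `α^{2,n} = b ds ∧ dt`. -/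
def SqForm.collapse1 (A : GradedSpace V) (α : SqForm V) (s : unitInterval) : Op (Pre V) (Pre V) :=
  extend A 0 (α.cs s) (α.cst s)

/-- The morphism `F_t`: the path construction with `d = 0` along the path `s ↦ (s, t)`. -/
def SqForm.F (A : GradedSpace V) (α : SqForm V) (t : unitInterval) : Op V V :=
  pathMap A 0 (fun s => α.cs s t) 0 1

/-- The maps `Ĝ`: the path construction with `d = 1` for the collapsed form. -/
def SqForm.Ghat (A : GradedSpace V) (α : SqForm V) : Op (Pre V) (Pre V) :=
  pathMap (forms A) 1 (α.collapse1 A) 0 1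

/-- `Θ` is a differential homotopy with respect to the family `F` of `A_∞` morphisms from `(A, μA)`
to `(B, μB)`: there is an `A_∞` morphism `φ` from `A` to `Ω^*([0,1]; B)` with
`φ^n(a₁, …, aₙ)(t) = F_t^n(a₁, …, aₙ) + dt ⊗ Θ_t^n(a₁, …, aₙ)` for all `n ≥ 1`. -/
def IsDifferentialHomotopy (A : GradedSpace V) (μA : Op V V) (B : GradedSpace W) (μB : Op W W)
    (F Θ : unitInterval → Op V W) : Prop :=
  (∀ t, IsAInfMorphism A μA B μB (F t)) ∧
  ∃ φ : Op V (Pre W), IsAInfMorphism A μA (forms B) (formsStructure B μB) φ ∧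
    ∀ l, l ≠ [] → IsHomog A l → φ l = (fun t => F t l, fun t => Θ t l)

end operators

end AInf

end

/-!
Evaluated at a point `t`, a form `f + dt ⊗ g` becomes a pair in `V × V`, and `dt ∧` becomes the
square-zero map `(f, g) ↦ (0, f)`. The operators `α⁰ + dt ⊗ c` and `a + dt ⊗ b` become smooth
families `M_{s,t}` and `B_{s,t}` of operators on `V × V`, and `Ĝ` evaluates to `G_{0,t}`, where
`G_{s,t}` is the path construction from `s` to `1` for `B`. Since `a¹ = 0` and `dt² = 0`, deep
trees vanish, so the finite sum `G` satisfies `∂ₛ G = G ∘ B` with `G_{1,t} = id`. The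
Maurer–Cartan equation reads `∂ₛ M = M ∘ B - B ∘ M + dt ∂ₜ B` on `V × V`, so the defect
`M_{1,t}(G, …, G) + dt ∂ₜ G - G ∘ M_{s,t}` satisfies the same linear equation in `s` and vanishes
at `s = 1`; being nilpotent, this equation has only the zero solution. At `s = 0` the vanishing of
the defect is the morphism equation for `Ĝ`.
-/

open scoped unitInterval

noncomputable section

namespace AInf

/-! ### Integrals depending smoothly on a parameter -/

theorem hasFDerivAt_parametric_intervalIntegral {E F : Type*} [NormedAddCommGroup E]
    [NormedSpace ℝ E] [FiniteDimensional ℝ E] [NormedAddCommGroup F] [NormedSpace ℝ F]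
    {k : E × ℝ → F} (hk : ContDiff ℝ 1 k) (x : E) :
    HasFDerivAt (fun x => ∫ y in (0 : ℝ)..1, k (x, y))
      (∫ y in (0 : ℝ)..1, (fderiv ℝ k (x, y)).comp (ContinuousLinearMap.inl ℝ E ℝ)) x := by
  have hk0 : Continuous k := hk.continuous
  have hk1 : Continuous fun z : E × ℝ => (fderiv ℝ k z).comp (ContinuousLinearMap.inl ℝ E ℝ) :=
    (hk.continuous_fderiv (by simp)).clm_comp continuous_const
  have hslice (x : E) : Continuous fun y => k (x, y) := by fun_prop
  obtain ⟨C, hC⟩ := ((isCompact_closedBall x 1).prod (isCompact_Icc (a := (0 : ℝ)) (b := 1)))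
    |>.exists_bound_of_continuousOn hk1.continuousOn
  refine intervalIntegral.hasFDerivAt_integral_of_dominated_of_fderiv_le
    (F := fun x y => k (x, y)) (bound := fun _ => C)
    (F' := fun x y => (fderiv ℝ k (x, y)).comp (ContinuousLinearMap.inl ℝ E ℝ))
    (Metric.closedBall_mem_nhds x one_pos)
    (Filter.Eventually.of_forall fun x => (hslice x).aestronglyMeasurable)
    ((hslice x).intervalIntegrable _ _)
    (hk1.comp (by fun_prop : Continuous fun y : ℝ => (x, y))).aestronglyMeasurable
    (Filter.Eventually.of_forall fun y hy z hz => hC (z, y) ⟨hz, ?_⟩)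
    intervalIntegrable_const
    (Filter.Eventually.of_forall fun y _ z _ => ?_)
  · rw [Set.uIoc_of_le zero_le_one] at hy
    exact Set.Ioc_subset_Icc_self hy
  · exact (hk.differentiable (by simp) (z, y)).hasFDerivAt.comp z (hasFDerivAt_prodMk_left z y)

theorem contDiff_parametric_intervalIntegral.{u} {E : Type u} [NormedAddCommGroup E]
    [NormedSpace ℝ E] [FiniteDimensional ℝ E] (n : ℕ) :
    ∀ {F : Type u} [NormedAddCommGroup F] [NormedSpace ℝ F] {k : E × ℝ → F},
      ContDiff ℝ n k → ContDiff ℝ n (fun x => ∫ y in (0 : ℝ)..1, k (x, y)) := by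
  induction n with
  | zero =>
    intro F _ _ k hk
    exact contDiff_zero.2 <|
      intervalIntegral.continuous_parametric_intervalIntegral_of_continuous'
        (f := fun x y => k (x, y)) hk.continuous 0 1
  | succ n ih =>
    intro F _ _ k hk
    have hderiv := hasFDerivAt_parametric_intervalIntegral (hk.of_le (by simp) : ContDiff ℝ 1 k)
    push_cast at hk ⊢
    rw [contDiff_succ_iff_fderiv] at hk ⊢
    refine ⟨fun x => (hderiv x).differentiableAt, by simp, ?_⟩
    rw [funext fun x => (hderiv x).fderiv]
    exact ih (hk.2.2.clm_comp contDiff_const)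

theorem contDiff_primitive {g : ℝ × ℝ → ℝ} (hg : ContDiff ℝ ∞ g) (c : ℝ) :
    ContDiff ℝ ∞ (fun x : ℝ × ℝ => ∫ y in c..x.1, g (y, x.2)) := by
  have rescale : (fun x : ℝ × ℝ => ∫ y in c..x.1, g (y, x.2)) =
      fun x => (x.1 - c) * ∫ y in (0 : ℝ)..1, g (c + (x.1 - c) * y, x.2) := by
    funext x
    simpa using (intervalIntegral.smul_integral_comp_add_mul (a := 0) (b := 1)
      (fun y => g (y, x.2)) (x.1 - c) c).symm
  rw [rescale]
  refine ContDiff.mul (by fun_prop) (contDiff_infty.2 fun n => ?_)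
  exact contDiff_parametric_intervalIntegral n
    (k := fun z : (ℝ × ℝ) × ℝ => g (c + (z.1.1 - c) * z.2, z.1.2))
    ((hg.of_le (by exact_mod_cast le_top)).comp (by fun_prop))

/-! ### Smooth functions on the square and operators acting on their coefficients -/

section square

variable {U W : Type*} [AddCommGroup U] [Module ℝ U] [AddCommGroup W] [Module ℝ W]

theorem separates_univ (v : U) (h : ∀ ℓ ∈ (Set.univ : Set (Module.Dual ℝ U)), ℓ v = 0) : v = 0 :=
  (Module.forall_dual_apply_eq_zero_iff ℝ v).1 fun ℓ => h ℓ (Set.mem_univ ℓ)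

/-- Smooth functions on the square with values in `U`, that is, elements of `C^∞(I × I) ⊗ U`. -/
def SmoothOnSquare (f : I → I → U) : Prop :=
  IsSmooth (fun x : I × I => ((x.1 : ℝ), (x.2 : ℝ))) ⊤ fun x => f x.1 x.2

/-- The operator `D ⊗ id` on `C^∞(I × I) ⊗ U`, where `D` acts on `C^∞(I × I)`. -/
def coeffwise (D : (I → I → ℝ) → I → I → ℝ) (f : I → I → U) : I → I → U := fun s t =>
  represented Set.univ fun ℓ => D (fun s t => ℓ (f s t)) s t

/-- `D` restricts to a linear operator on `C^∞(I × I)`; its values on other functions are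
irrelevant. -/
structure IsSmoothOperator (D : (I → I → ℝ) → I → I → ℝ) : Prop where
  smooth : ∀ {h}, SmoothOnSquare h → SmoothOnSquare (D h)
  map_add : ∀ {h₁ h₂}, SmoothOnSquare h₁ → SmoothOnSquare h₂ → ∀ s t,
    D (fun s t => h₁ s t + h₂ s t) s t = D h₁ s t + D h₂ s t
  map_mul_const : ∀ {h}, SmoothOnSquare h → ∀ c s t, D (fun s t => h s t * c) s t = D h s t * c

/-- `D` restricts to a derivation of the algebra `C^∞(I × I)`. -/
structure IsSmoothDerivation (D : (I → I → ℝ) → I → I → ℝ) : Prop extends IsSmoothOperator D where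
  leibniz : ∀ {h₁ h₂}, SmoothOnSquare h₁ → SmoothOnSquare h₂ → ∀ s t,
    D (fun s t => h₁ s t * h₂ s t) s t = D h₁ s t * h₂ s t + h₁ s t * D h₂ s t

theorem smoothOnSquare_real_iff {h : I → I → ℝ} :
    SmoothOnSquare h ↔ ∃ G : ℝ × ℝ → ℝ, ContDiff ℝ ∞ G ∧ h = fun (s t : I) => G (s, t) := by
  constructor
  · rintro ⟨N, g, w, hg, -, hh⟩
    exact ⟨fun x => ∑ i, g i x * w i, ContDiff.sum fun i _ => (hg i).mul contDiff_const,
      funext₂ fun s t => hh (s, t)⟩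
  · rintro ⟨G, hG, rfl⟩
    exact ⟨1, fun _ => G, fun _ => 1, fun _ => hG, fun _ => trivial, fun x => by simp⟩

namespace SmoothOnSquare

theorem of_sum {ι : Type*} [Fintype ι] {g : ι → I → I → ℝ} (hg : ∀ i, SmoothOnSquare (g i))
    (w : ι → U) : SmoothOnSquare fun s t => ∑ i, g i s t • w i := by
  choose G hG hgG using fun i => smoothOnSquare_real_iff.1 (hg i)
  let e := (Fintype.equivFin ι).symm
  refine ⟨Fintype.card ι, G ∘ e, w ∘ e, fun i => hG _, fun _ => trivial, fun x => ?_⟩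
  simpa [hgG] using (e.sum_comp fun i => G i (x.1, x.2) • w i).symm

theorem exists_sum {f : I → I → U} (hf : SmoothOnSquare f) :
    ∃ (N : ℕ) (g : Fin N → I → I → ℝ) (w : Fin N → U), (∀ i, SmoothOnSquare (g i)) ∧
      f = fun s t => ∑ i, g i s t • w i := by
  obtain ⟨N, g, w, hg, -, hf⟩ := hf
  exact ⟨N, fun i s t => g i (s, t), w, fun i => smoothOnSquare_real_iff.2 ⟨g i, hg i, rfl⟩,
    funext₂ fun s t => hf (s, t)⟩

theorem const (u : U) : SmoothOnSquare fun _ _ => u := by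
  simpa using of_sum (ι := Unit) (g := fun _ _ _ => 1)
    (fun _ => smoothOnSquare_real_iff.2 ⟨fun _ => 1, contDiff_const, rfl⟩) fun _ => u

variable {f f₁ f₂ : I → I → U}

theorem map (hf : SmoothOnSquare f) (T : U →ₗ[ℝ] W) : SmoothOnSquare fun s t => T (f s t) := by
  obtain ⟨N, g, w, hg, rfl⟩ := hf.exists_sum
  simpa using of_sum hg fun i => T (w i)

theorem prodMk {f : I → I → U} {g : I → I → W} (hf : SmoothOnSquare f) (hg : SmoothOnSquare g) :
    SmoothOnSquare fun s t => (f s t, g s t) := by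
  obtain ⟨N, a, u, ha, rfl⟩ := hf.exists_sum
  obtain ⟨M, b, w, hb, rfl⟩ := hg.exists_sum
  convert of_sum (g := Sum.elim a b) (Sum.forall.2 ⟨ha, hb⟩)
    (Sum.elim (fun i => (u i, 0)) fun i => (0, w i)) using 3
  simp [Prod.ext_iff, Prod.fst_sum, Prod.snd_sum]

theorem add (h₁ : SmoothOnSquare f₁) (h₂ : SmoothOnSquare f₂) :
    SmoothOnSquare fun s t => f₁ s t + f₂ s t :=
  (h₁.prodMk h₂).map (LinearMap.fst ℝ U U + LinearMap.snd ℝ U U)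

theorem smul (hf : SmoothOnSquare f) (c : ℝ) : SmoothOnSquare fun s t => c • f s t :=
  hf.map (c • LinearMap.id)

theorem sub (h₁ : SmoothOnSquare f₁) (h₂ : SmoothOnSquare f₂) :
    SmoothOnSquare fun s t => f₁ s t - f₂ s t :=
  (h₁.prodMk h₂).map (LinearMap.fst ℝ U U - LinearMap.snd ℝ U U)

theorem sum {ι : Type*} {A : Finset ι} {f : ι → I → I → U}
    (h : ∀ i ∈ A, SmoothOnSquare (f i)) : SmoothOnSquare fun s t => ∑ i ∈ A, f i s t := by
  classical
  induction A using Finset.induction_on with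
  | empty => simpa using const (0 : U)
  | insert i A hi ih =>
    simp only [Finset.sum_insert hi]
    exact (h i (by simp)).add (ih fun j hj => h j (by simp [hj]))

theorem mul {g h : I → I → ℝ} (hg : SmoothOnSquare g) (hh : SmoothOnSquare h) :
    SmoothOnSquare fun s t => g s t * h s t := by
  obtain ⟨G, hG, rfl⟩ := smoothOnSquare_real_iff.1 hg
  obtain ⟨H, hH, rfl⟩ := smoothOnSquare_real_iff.1 hh
  exact smoothOnSquare_real_iff.2 ⟨fun x => G x * H x, hG.mul hH, rfl⟩

theorem restrict (hf : SmoothOnSquare f) (s₀ : I) : SmoothOnSquare fun _ t => f s₀ t := by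
  obtain ⟨N, g, w, hg, rfl⟩ := hf.exists_sum
  refine of_sum (fun i => ?_) w
  obtain ⟨G, hG, hgG⟩ := smoothOnSquare_real_iff.1 (hg i)
  exact smoothOnSquare_real_iff.2
    ⟨fun x => G (s₀, x.2), hG.comp (contDiff_const.prodMk contDiff_snd), by rw [hgG]⟩

theorem fun_smul {h : I → I → ℝ} (hh : SmoothOnSquare h) (hf : SmoothOnSquare f) :
    SmoothOnSquare fun s t => h s t • f s t := by
  obtain ⟨N, g, w, hg, rfl⟩ := hf.exists_sum
  simpa only [Finset.smul_sum, smul_smul] using of_sum (fun i => hh.mul (hg i)) w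

end SmoothOnSquare

namespace IsSmoothOperator

variable {D : (I → I → ℝ) → I → I → ℝ} {f f₁ f₂ : I → I → U}

theorem map_sum_mul_const {ι : Type*} (hD : IsSmoothOperator D) {A : Finset ι}
    {g : ι → I → I → ℝ} (hg : ∀ i, SmoothOnSquare (g i)) (c : ι → ℝ) (s t : I) :
    D (fun s t => ∑ i ∈ A, g i s t * c i) s t = ∑ i ∈ A, D (g i) s t * c i := by
  classical
  induction A using Finset.induction_on with
  | empty => simpa using hD.map_mul_const (SmoothOnSquare.const 0) 0 s t
  | insert i A hi ih =>
    have hsmul (j : ι) : SmoothOnSquare fun s t => g j s t * c j :=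
      (hg j).mul (SmoothOnSquare.const (c j))
    simp only [Finset.sum_insert hi]
    rw [hD.map_add (hsmul i) (SmoothOnSquare.sum fun j _ => hsmul j), hD.map_mul_const (hg i), ih]

theorem coeffwise_sum_smul {ι : Type*} [Fintype ι] (hD : IsSmoothOperator D) {g : ι → I → I → ℝ}
    (hg : ∀ i, SmoothOnSquare (g i)) (w : ι → U) :
    coeffwise D (fun s t => ∑ i, g i s t • w i) = fun s t => ∑ i, D (g i) s t • w i := by
  funext s t
  refine represented_eq separates_univ fun ℓ _ => ?_
  simpa using (hD.map_sum_mul_const hg (fun i => ℓ (w i)) s t).symm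

theorem smooth_coeffwise (hD : IsSmoothOperator D) (hf : SmoothOnSquare f) :
    SmoothOnSquare (coeffwise D f) := by
  obtain ⟨N, g, w, hg, rfl⟩ := hf.exists_sum
  rw [hD.coeffwise_sum_smul hg]
  exact SmoothOnSquare.of_sum (fun i => hD.smooth (hg i)) w

theorem coeffwise_map (hD : IsSmoothOperator D) (hf : SmoothOnSquare f) (T : U →ₗ[ℝ] W)
    (s t : I) : coeffwise D (fun s t => T (f s t)) s t = T (coeffwise D f s t) := by
  obtain ⟨N, g, w, hg, rfl⟩ := hf.exists_sum
  simp [hD.coeffwise_sum_smul hg]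

theorem coeffwise_real (hD : IsSmoothOperator D) {h : I → I → ℝ} (hh : SmoothOnSquare h) :
    coeffwise D h = D h := by
  simpa using hD.coeffwise_sum_smul (ι := Unit) (fun _ => hh) fun _ => (1 : ℝ)

theorem apply_coeffwise (hD : IsSmoothOperator D) (hf : SmoothOnSquare f) (ℓ : Module.Dual ℝ U)
    (s t : I) : ℓ (coeffwise D f s t) = D (fun s t => ℓ (f s t)) s t := by
  rw [← hD.coeffwise_map hf ℓ, hD.coeffwise_real (hf.map ℓ)]

theorem coeffwise_prodMk (hD : IsSmoothOperator D) {f : I → I → U} {g : I → I → W}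
    (hf : SmoothOnSquare f) (hg : SmoothOnSquare g) (s t : I) :
    coeffwise D (fun s t => (f s t, g s t)) s t = (coeffwise D f s t, coeffwise D g s t) :=
  Prod.ext (hD.coeffwise_map (hf.prodMk hg) (LinearMap.fst ℝ U W) s t).symm
    (hD.coeffwise_map (hf.prodMk hg) (LinearMap.snd ℝ U W) s t).symm

theorem coeffwise_add (hD : IsSmoothOperator D) (h₁ : SmoothOnSquare f₁) (h₂ : SmoothOnSquare f₂)
    (s t : I) : coeffwise D (fun s t => f₁ s t + f₂ s t) s t =
      coeffwise D f₁ s t + coeffwise D f₂ s t := by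
  simpa [hD.coeffwise_prodMk h₁ h₂] using
    hD.coeffwise_map (h₁.prodMk h₂) (LinearMap.fst ℝ U U + LinearMap.snd ℝ U U) s t

theorem coeffwise_sub (hD : IsSmoothOperator D) (h₁ : SmoothOnSquare f₁) (h₂ : SmoothOnSquare f₂)
    (s t : I) : coeffwise D (fun s t => f₁ s t - f₂ s t) s t =
      coeffwise D f₁ s t - coeffwise D f₂ s t := by
  simpa [hD.coeffwise_prodMk h₁ h₂] using
    hD.coeffwise_map (h₁.prodMk h₂) (LinearMap.fst ℝ U U - LinearMap.snd ℝ U U) s t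

theorem coeffwise_smul (hD : IsSmoothOperator D) (hf : SmoothOnSquare f) (c : ℝ) (s t : I) :
    coeffwise D (fun s t => c • f s t) s t = c • coeffwise D f s t :=
  hD.coeffwise_map hf (c • LinearMap.id) s t

theorem coeffwise_zero (hD : IsSmoothOperator D) (s t : I) :
    coeffwise D (fun _ _ => (0 : U)) s t = 0 := by
  simpa using hD.coeffwise_smul (SmoothOnSquare.const (0 : U)) 0 s t

theorem coeffwise_sum {ι : Type*} (hD : IsSmoothOperator D) {A : Finset ι} {f : ι → I → I → U}
    (h : ∀ i ∈ A, SmoothOnSquare (f i)) (s t : I) :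
    coeffwise D (fun s t => ∑ i ∈ A, f i s t) s t = ∑ i ∈ A, coeffwise D (f i) s t := by
  classical
  induction A using Finset.induction_on with
  | empty => simp only [Finset.sum_empty, hD.coeffwise_zero]
  | insert i A hi ih =>
    have hA : ∀ j ∈ A, SmoothOnSquare (f j) := fun j hj => h j (by simp [hj])
    simp only [Finset.sum_insert hi]
    rw [hD.coeffwise_add (h i (by simp)) (SmoothOnSquare.sum hA), ih hA]

end IsSmoothOperator

namespace IsSmoothDerivation

variable {D : (I → I → ℝ) → I → I → ℝ}

theorem coeffwise_const (hD : IsSmoothDerivation D) (u : U) (s t : I) :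
    coeffwise D (fun _ _ => u) s t = 0 := by
  have hone : D (fun _ _ => 1) s t = 0 := by
    simpa using hD.leibniz (SmoothOnSquare.const 1) (SmoothOnSquare.const 1) s t
  have := hD.coeffwise_map (SmoothOnSquare.const 1) (LinearMap.toSpanSingleton ℝ U u) s t
  simpa [hD.coeffwise_real (SmoothOnSquare.const 1), hone] using this

theorem coeffwise_fun_smul (hD : IsSmoothDerivation D) {h : I → I → ℝ} {f : I → I → U}
    (hh : SmoothOnSquare h) (hf : SmoothOnSquare f) (s t : I) :
    coeffwise D (fun s t => h s t • f s t) s t = D h s t • f s t + h s t • coeffwise D f s t := by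
  obtain ⟨N, g, w, hg, rfl⟩ := hf.exists_sum
  simp only [Finset.smul_sum, smul_smul, ← Finset.sum_add_distrib, ← add_smul,
    hD.coeffwise_sum_smul hg, hD.coeffwise_sum_smul (fun i => hh.mul (hg i)), hD.leibniz hh (hg _)]

theorem of_fderiv (v : ℝ × ℝ) (hD : ∀ {G : ℝ × ℝ → ℝ}, ContDiff ℝ ∞ G →
    D (fun s t => G (s, t)) = fun (s t : I) => fderiv ℝ G (s, t) v) : IsSmoothDerivation D where
  smooth h := by
    obtain ⟨G, hG, rfl⟩ := smoothOnSquare_real_iff.1 h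
    exact smoothOnSquare_real_iff.2 ⟨fun x => fderiv ℝ G x v,
      (hG.fderiv_right (by simp)).clm_apply contDiff_const, hD hG⟩
  map_add h₁ h₂ s t := by
    obtain ⟨G, hG, rfl⟩ := smoothOnSquare_real_iff.1 h₁
    obtain ⟨H, hH, rfl⟩ := smoothOnSquare_real_iff.1 h₂
    have := fderiv_fun_add (hG.differentiable (by simp) ((s : ℝ), (t : ℝ)))
      (hH.differentiable (by simp) _)
    rw [hD (hG.add hH), hD hG, hD hH]
    simp [this]
  map_mul_const h c s t := by
    obtain ⟨G, hG, rfl⟩ := smoothOnSquare_real_iff.1 h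
    have := fderiv_mul_const (hG.differentiable (by simp) ((s : ℝ), (t : ℝ))) c
    rw [hD (hG.mul contDiff_const), hD hG]
    simpa [mul_comm c] using congrArg (fun L => L v) this
  leibniz h₁ h₂ s t := by
    obtain ⟨G, hG, rfl⟩ := smoothOnSquare_real_iff.1 h₁
    obtain ⟨H, hH, rfl⟩ := smoothOnSquare_real_iff.1 h₂
    have := fderiv_fun_mul (hG.differentiable (by simp) ((s : ℝ), (t : ℝ)))
      (hH.differentiable (by simp) _)
    rw [hD (hG.mul hH), hD hG, hD hH]
    simp [this]
    ring

end IsSmoothDerivation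

/-! ### Partial derivatives and the primitive in the first variable -/

/-- The partial derivative in the first variable, one-sided on the boundary; `coeffwise derivS` is
then `vderiv` in the first variable. -/
def derivS (h : I → I → ℝ) (s t : I) : ℝ :=
  derivWithin (fun y => h (Set.projIcc 0 1 zero_le_one y) t) (Set.Icc 0 1) s

/-- The partial derivative in the second variable, one-sided on the boundary; `coeffwise derivT` is
then `vderiv` in the second variable. -/
def derivT (h : I → I → ℝ) (s t : I) : ℝ :=
  derivWithin (fun y => h s (Set.projIcc 0 1 zero_le_one y)) (Set.Icc 0 1) t

/-- The primitive in the first variable which vanishes at `s = 1`. -/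
def primitiveS (h : I → I → ℝ) (s t : I) : ℝ := -∫ y in Set.Icc s 1, h y t

theorem derivWithin_projIcc {g : ℝ → ℝ} {g' : ℝ} {s : I} (hg : HasDerivAt g g' s) :
    derivWithin (fun y => g (Set.projIcc (0 : ℝ) 1 zero_le_one y)) (Set.Icc 0 1) s = g' := by
  refine HasDerivWithinAt.derivWithin ?_ (uniqueDiffOn_Icc zero_lt_one _ s.2)
  refine hg.hasDerivWithinAt.congr (fun y hy => ?_) ?_
  · rw [Set.projIcc_of_mem zero_le_one hy]
  · rw [Set.projIcc_val]

theorem derivS_eq_fderiv {G : ℝ × ℝ → ℝ} (hG : ContDiff ℝ ∞ G) :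
    derivS (fun s t => G (s, t)) = fun (s t : I) => fderiv ℝ G (s, t) (1, 0) := by
  funext s t
  exact derivWithin_projIcc (g := fun y => G (y, t))
    ((hG.differentiable (by simp) ((s : ℝ), (t : ℝ))).hasFDerivAt.comp_hasDerivAt (s : ℝ)
      ((hasDerivAt_id _).prodMk (hasDerivAt_const _ _)))

theorem derivT_eq_fderiv {G : ℝ × ℝ → ℝ} (hG : ContDiff ℝ ∞ G) :
    derivT (fun s t => G (s, t)) = fun (s t : I) => fderiv ℝ G (s, t) (0, 1) := by
  funext s t
  exact derivWithin_projIcc (g := fun y => G (s, y))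
    ((hG.differentiable (by simp) ((s : ℝ), (t : ℝ))).hasFDerivAt.comp_hasDerivAt (t : ℝ)
      ((hasDerivAt_const _ _).prodMk (hasDerivAt_id _)))

theorem isSmoothDerivation_derivS : IsSmoothDerivation derivS := .of_fderiv (1, 0) derivS_eq_fderiv

theorem isSmoothDerivation_derivT : IsSmoothDerivation derivT := .of_fderiv (0, 1) derivT_eq_fderiv

theorem primitiveS_eq_intervalIntegral {G : ℝ × ℝ → ℝ} :
    primitiveS (fun s t => G (s, t)) = fun (s t : I) => ∫ y in (1 : ℝ)..s, G (y, t) := by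
  funext s t
  have hemb : MeasurableEmbedding (Subtype.val : I → ℝ) :=
    MeasurableEmbedding.subtype_coe measurableSet_Icc
  have hmap : MeasureTheory.Measure.map (Subtype.val : I → ℝ) MeasureTheory.volume =
      MeasureTheory.volume.restrict (Set.Icc 0 1) := map_comap_subtype_coe measurableSet_Icc _
  have hinter : Set.Icc (s : ℝ) 1 ∩ Set.Icc 0 1 = Set.Icc (s : ℝ) 1 :=
    Set.inter_eq_left.2 (Set.Icc_subset_Icc_left s.2.1)
  have hset := hemb.setIntegral_map (μ := MeasureTheory.volume) (fun y => G (y, t))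
    (Set.Icc (s : ℝ) 1)
  rw [hmap, MeasureTheory.Measure.restrict_restrict measurableSet_Icc, hinter,
    MeasureTheory.integral_Icc_eq_integral_Ioc, ← intervalIntegral.integral_of_le s.2.2] at hset
  rw [intervalIntegral.integral_symm, hset]
  rfl

theorem isSmoothOperator_primitiveS : IsSmoothOperator primitiveS where
  smooth h := by
    obtain ⟨G, hG, rfl⟩ := smoothOnSquare_real_iff.1 h
    exact smoothOnSquare_real_iff.2 ⟨_, contDiff_primitive hG 1, primitiveS_eq_intervalIntegral⟩
  map_add h₁ h₂ s t := by
    obtain ⟨G, hG, rfl⟩ := smoothOnSquare_real_iff.1 h₁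
    obtain ⟨H, hH, rfl⟩ := smoothOnSquare_real_iff.1 h₂
    have hslice {K : ℝ × ℝ → ℝ} (hK : ContDiff ℝ ∞ K) : Continuous fun y : ℝ => K (y, t) :=
      hK.continuous.comp (by fun_prop)
    rw [primitiveS_eq_intervalIntegral, primitiveS_eq_intervalIntegral,
      primitiveS_eq_intervalIntegral (G := fun x => G x + H x)]
    exact intervalIntegral.integral_add ((hslice hG).intervalIntegrable _ _)
      ((hslice hH).intervalIntegrable _ _)
  map_mul_const _ c s t := by simp [primitiveS, MeasureTheory.integral_mul_const]

theorem derivS_primitiveS {h : I → I → ℝ} (hh : SmoothOnSquare h) : derivS (primitiveS h) = h := by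
  obtain ⟨G, hG, rfl⟩ := smoothOnSquare_real_iff.1 hh
  funext s t
  have hslice : Continuous fun y : ℝ => G (y, t) := hG.continuous.comp (by fun_prop)
  rw [primitiveS_eq_intervalIntegral]
  exact derivWithin_projIcc (g := fun x => ∫ y in (1 : ℝ)..x, G (y, t))
    (intervalIntegral.integral_hasDerivAt_right (hslice.intervalIntegrable _ _)
      (hslice.stronglyMeasurableAtFilter _ _) hslice.continuousAt)

theorem derivS_derivT_comm {h : I → I → ℝ} (hh : SmoothOnSquare h) :
    derivS (derivT h) = derivT (derivS h) := by
  obtain ⟨G, hG, rfl⟩ := smoothOnSquare_real_iff.1 hh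
  have hG' (v : ℝ × ℝ) : ContDiff ℝ ∞ fun x => fderiv ℝ G x v :=
    (hG.fderiv_right (by simp)).clm_apply contDiff_const
  rw [derivT_eq_fderiv hG, derivS_eq_fderiv hG, derivS_eq_fderiv (hG' _), derivT_eq_fderiv (hG' _)]
  funext s t
  have hdiff : DifferentiableAt ℝ (fderiv ℝ G) ((s : ℝ), (t : ℝ)) :=
    (hG.fderiv_right (m := ∞) (by simp)).differentiable (by simp) _
  have hsymm := (hG.contDiffAt (x := ((s : ℝ), (t : ℝ)))).isSymmSndFDerivAt (by
    rw [minSmoothness_of_isRCLikeNormedField]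
    exact WithTop.coe_le_coe.2 (le_top (a := (2 : ℕ∞))))
  rw [fderiv_clm_apply hdiff (differentiableAt_const _),
    fderiv_clm_apply hdiff (differentiableAt_const _)]
  simp [hsymm.eq (1, 0) (0, 1)]

theorem eq_of_derivS_eq_zero {h : I → I → ℝ} (hh : SmoothOnSquare h)
    (hderiv : ∀ s t, derivS h s t = 0) (s s' t : I) : h s t = h s' t := by
  obtain ⟨G, hG, rfl⟩ := smoothOnSquare_real_iff.1 hh
  have hdiff : DifferentiableOn ℝ (fun y => G (Set.projIcc (0 : ℝ) 1 zero_le_one y, t))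
      (Set.Icc 0 1) := by
    have := hG.differentiable (by simp)
    refine DifferentiableOn.congr (f := fun y : ℝ => G (y, t)) (by fun_prop) fun y hy => ?_
    rw [Set.projIcc_of_mem zero_le_one hy]
  have hconst := constant_of_derivWithin_zero hdiff fun y hy =>
    hderiv ⟨y, Set.Ico_subset_Icc_self hy⟩ t
  have hval (r : I) : G (r, t) = G ((Set.projIcc (0 : ℝ) 1 zero_le_one 0 : I), t) := by
    simpa using hconst r r.2
  exact (hval s).trans (hval s').symm

namespace SmoothOnSquare

variable {f : I → I → U}

theorem coeffwise_derivS_primitiveS (hf : SmoothOnSquare f) :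
    coeffwise derivS (coeffwise primitiveS f) = f := by
  obtain ⟨N, g, w, hg, rfl⟩ := hf.exists_sum
  rw [isSmoothOperator_primitiveS.coeffwise_sum_smul hg,
    isSmoothDerivation_derivS.coeffwise_sum_smul
      fun i => isSmoothOperator_primitiveS.smooth (hg i)]
  simp only [derivS_primitiveS (hg _)]

theorem coeffwise_derivS_derivT_comm (hf : SmoothOnSquare f) :
    coeffwise derivS (coeffwise derivT f) = coeffwise derivT (coeffwise derivS f) := by
  have hS := isSmoothDerivation_derivS.toIsSmoothOperator
  have hT := isSmoothDerivation_derivT.toIsSmoothOperator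
  obtain ⟨N, g, w, hg, rfl⟩ := hf.exists_sum
  rw [hT.coeffwise_sum_smul hg, hS.coeffwise_sum_smul hg,
    hS.coeffwise_sum_smul fun i => hT.smooth (hg i),
    hT.coeffwise_sum_smul fun i => hS.smooth (hg i)]
  simp only [derivS_derivT_comm (hg _)]

theorem coeffwise_primitiveS_one (hf : SmoothOnSquare f) (t : I) :
    coeffwise primitiveS f 1 t = 0 := by
  refine separates_univ _ fun ℓ _ => ?_
  obtain ⟨G, -, hfG⟩ := smoothOnSquare_real_iff.1 (hf.map ℓ)
  simp [isSmoothOperator_primitiveS.apply_coeffwise hf, hfG, primitiveS_eq_intervalIntegral]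

theorem eq_zero_of_coeffwise_derivS (hf : SmoothOnSquare f)
    (hderiv : ∀ s t, coeffwise derivS f s t = 0) (hone : ∀ t, f 1 t = 0) (s t : I) :
    f s t = 0 := by
  refine separates_univ _ fun ℓ _ => ?_
  have h : ∀ s t, derivS (fun s t => ℓ (f s t)) s t = 0 := fun s t => by
    rw [← isSmoothDerivation_derivS.apply_coeffwise hf, hderiv, map_zero]
  rw [eq_of_derivS_eq_zero (hf.map ℓ) h s 1 t, hone, map_zero]

end SmoothOnSquare

end square

/-! ### Sums over deconcatenations of a word -/

section splitSum

variable {V X Y : Type*} [AddCommGroup X] [AddCommGroup Y]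

/-- The sum of `φ x y` over all `x ++ y = l`. -/
def splitSum (φ : List V → List V → X) (l : List V) : X :=
  ∑ j ∈ Finset.range (l.length + 1), φ (l.take j) (l.drop j)

theorem splitSum_nil (φ : List V → List V → X) : splitSum φ [] = φ [] [] := by simp [splitSum]

theorem splitSum_cons (φ : List V → List V → X) (v : V) (l : List V) :
    splitSum φ (v :: l) = φ [] (v :: l) + splitSum (fun x y => φ (v :: x) y) l := by
  simp only [splitSum, List.length_cons]
  rw [Finset.sum_range_succ']
  simp [add_comm]

theorem splitSum_congr {φ ψ : List V → List V → X} {l : List V}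
    (h : ∀ x y, x ++ y = l → φ x y = ψ x y) : splitSum φ l = splitSum ψ l :=
  Finset.sum_congr rfl fun _ _ => h _ _ (List.take_append_drop _ _)

theorem splitSum_eq_zero {φ : List V → List V → X} {l : List V}
    (h : ∀ x y, x ++ y = l → φ x y = 0) : splitSum φ l = 0 :=
  Finset.sum_eq_zero fun _ _ => h _ _ (List.take_append_drop _ _)

theorem splitSum_eq_last {φ : List V → List V → X} {l : List V}
    (h : ∀ x v z, φ x (v :: z) = 0) : splitSum φ l = φ l [] := by
  induction l generalizing φ with
  | nil => rw [splitSum_nil]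
  | cons v l ih => rw [splitSum_cons, h, zero_add, ih fun x => h (v :: x)]

theorem splitSum_add (φ ψ : List V → List V → X) (l : List V) :
    splitSum (fun x y => φ x y + ψ x y) l = splitSum φ l + splitSum ψ l :=
  Finset.sum_add_distrib

theorem splitSum_smul [Module ℝ X] (c : ℝ) (φ : List V → List V → X) (l : List V) :
    splitSum (fun x y => c • φ x y) l = c • splitSum φ l :=
  Finset.smul_sum.symm

theorem map_splitSum {T : Type*} [FunLike T X Y] [AddMonoidHomClass T X Y] (f : T)
    (φ : List V → List V → X) (l : List V) : f (splitSum φ l) = splitSum (fun x y => f (φ x y)) l :=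
  map_sum f _ _

theorem splitSum_append_cons (φ : List V → List V → X) (x : List V) (v : V) (z : List V) :
    splitSum φ (x ++ v :: z) = splitSum (fun a b => φ a (b ++ v :: z)) x +
      splitSum (fun a b => φ (x ++ v :: a) b) z := by
  induction x generalizing φ with
  | nil => simp [splitSum_cons, splitSum_nil]
  | cons u x ih => simp [splitSum_cons, ih, add_assoc]

theorem splitSum_map {V' : Type*} (f : V → V') (φ : List V' → List V' → X) (l : List V) :
    splitSum φ (l.map f) = splitSum (fun x y => φ (x.map f) (y.map f)) l := by
  simp [splitSum, List.map_take, List.map_drop]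

theorem splitSum_assoc (φ : List V → List V → List V → X) (l : List V) :
    splitSum (fun w z => splitSum (fun x y => φ x y z) w) l =
      splitSum (fun x w => splitSum (fun y z => φ x y z) w) l := by
  induction l generalizing φ with
  | nil => simp [splitSum_nil]
  | cons v l ih =>
    simp only [splitSum_cons, splitSum_nil, splitSum_add, ih]
    abel

theorem splitSum_comm {V' : Type*} (φ : List V → List V → List V' → List V' → X) (l : List V)
    (l' : List V') : splitSum (fun x y => splitSum (fun x' y' => φ x y x' y') l') l =
      splitSum (fun x' y' => splitSum (fun x y => φ x y x' y') l) l' :=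
  Finset.sum_comm

/-- The sum of `φ x y z` over all `x ++ y ++ z = l`. -/
def splitSum₃ (φ : List V → List V → List V → X) (l : List V) : X :=
  splitSum (fun x w => splitSum (fun y z => φ x y z) w) l

theorem splitSum₃_congr {φ ψ : List V → List V → List V → X} {l : List V}
    (h : ∀ x y z, x ++ y ++ z = l → φ x y z = ψ x y z) : splitSum₃ φ l = splitSum₃ ψ l :=
  splitSum_congr fun x w hw => splitSum_congr fun y z hz =>
    h x y z (by rw [← hw, ← hz, List.append_assoc])

theorem splitSum₃_eq_zero {φ : List V → List V → List V → X} {l : List V}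
    (h : ∀ x y z, x ++ y ++ z = l → φ x y z = 0) : splitSum₃ φ l = 0 :=
  splitSum_eq_zero fun x w hw => splitSum_eq_zero fun y z hz =>
    h x y z (by rw [← hw, ← hz, List.append_assoc])

theorem splitSum₃_add (φ ψ : List V → List V → List V → X) (l : List V) :
    splitSum₃ (fun x y z => φ x y z + ψ x y z) l = splitSum₃ φ l + splitSum₃ ψ l := by
  simp only [splitSum₃, splitSum_add]

theorem splitSum₃_smul [Module ℝ X] (c : ℝ) (φ : List V → List V → List V → X) (l : List V) :
    splitSum₃ (fun x y z => c • φ x y z) l = c • splitSum₃ φ l := by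
  simp only [splitSum₃, splitSum_smul]

theorem map_splitSum₃ {T : Type*} [FunLike T X Y] [AddMonoidHomClass T X Y] (f : T)
    (φ : List V → List V → List V → X) (l : List V) :
    f (splitSum₃ φ l) = splitSum₃ (fun x y z => f (φ x y z)) l := by
  simp only [splitSum₃, map_splitSum]

theorem splitSum₃_map {V' : Type*} (f : V → V') (φ : List V' → List V' → List V' → X)
    (l : List V) :
    splitSum₃ φ (l.map f) = splitSum₃ (fun x y z => φ (x.map f) (y.map f) (z.map f)) l := by
  simp only [splitSum₃, splitSum_map]

theorem splitSum₃_splitSum_splitSum (ψ : List V → List V → List V → List V → List V → X)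
    (l : List V) :
    splitSum₃ (fun x y z => splitSum (fun p q => splitSum (fun q' r => ψ p q y q' r) z) x) l =
      splitSum₃ (fun p w r => splitSum₃ (fun q y q' => ψ p q y q' r) w) l := by
  have swap : ∀ x w,
      splitSum (fun y z => splitSum (fun p q => splitSum (fun q' r => ψ p q y q' r) z) x) w =
        splitSum (fun p q => splitSum (fun y z => splitSum (fun q' r => ψ p q y q' r) z) w) x :=
    fun x w => splitSum_comm _ _ _
  simp only [splitSum₃, swap, splitSum_assoc]

theorem splitSum₃_splitSum₃_left (ψ : List V → List V → List V → List V → List V → X)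
    (l : List V) :
    splitSum₃ (fun x y z => splitSum₃ (fun p q r => ψ p q r y z) x) l =
      splitSum₃ (fun p q w => splitSum₃ (fun r y z => ψ p q r y z) w) l := by
  have swap : ∀ x w,
      splitSum (fun y z => splitSum (fun p u => splitSum (fun q r => ψ p q r y z) u) x) w =
        splitSum (fun p u => splitSum (fun q r => splitSum (fun y z => ψ p q r y z) w) u) x := by
    intro x w
    rw [splitSum_comm]
    exact splitSum_congr fun _ _ _ => splitSum_comm _ _ _
  simp only [splitSum₃, swap]
  rw [splitSum_assoc (fun p u w => splitSum (fun q r => splitSum (fun y z => ψ p q r y z) w) u)]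
  simp only [splitSum_assoc]

end splitSum

/-! ### Multilinear operators and insertions -/

section insertion

variable {V W X : Type*} [AddCommGroup W]

/-- The circle product `∑ f (ε x ++ g y :: z)`, over all `x ++ y ++ z = l`, with an arbitrary twist
`ε` in place of the Koszul sign; `circ` is the case where `ε` is the identity or `A.sg`. -/
def circWith (ε : V → V) (f : Op V W) (g : Op V V) : Op V W := fun l =>
  splitSum₃ (fun x y z => f (x.map ε ++ g y :: z)) l

theorem circWith_cons (f : Op V W) (g : Op V V) (v : V) (l : List V) :
    circWith id f g (v :: l) = splitSum (fun y z => f (g y :: z)) (v :: l) +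
      circWith id (fun l => f (v :: l)) g l := by
  simp [circWith, splitSum₃, splitSum_cons (X := W) (fun _ w => splitSum _ w)]

theorem circWith_append_cons (ε : V → V) (f : Op V W) (g : Op V V) (x : List V) (v : V)
    (z : List V) :
    circWith ε f g (x ++ v :: z) =
      splitSum₃ (fun p q r => f (p.map ε ++ g q :: (r ++ v :: z))) x +
      splitSum (fun p q => splitSum (fun q' r => f (p.map ε ++ g (q ++ v :: q') :: r)) z) x +
      splitSum₃ (fun p q r => f ((x ++ v :: p).map ε ++ g q :: r)) z := by
  simp only [circWith, splitSum₃]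
  rw [splitSum_append_cons]
  simp only [splitSum_append_cons, splitSum_add]

theorem circWith_add_left (ε : V → V) (f f' : Op V W) (g : Op V V) (l : List V) :
    circWith ε (fun l => f l + f' l) g l = circWith ε f g l + circWith ε f' g l :=
  splitSum₃_add _ _ _

theorem circWith_sub_left (ε : V → V) (f f' : Op V W) (g : Op V V) (l : List V) :
    circWith ε (fun l => f l - f' l) g l = circWith ε f g l - circWith ε f' g l := by
  rw [eq_sub_iff_add_eq, ← circWith_add_left]
  simp only [sub_add_cancel]

theorem circWith_sum_left {ι : Type*} (ε : V → V) (A : Finset ι) (f : ι → Op V W) (g : Op V V)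
    (l : List V) : circWith ε (fun l => ∑ i ∈ A, f i l) g l = ∑ i ∈ A, circWith ε (f i) g l := by
  classical
  induction A using Finset.induction_on with
  | empty => exact splitSum₃_eq_zero fun _ _ _ _ => rfl
  | insert i A hi ih =>
    simp only [Finset.sum_insert hi]
    rw [circWith_add_left, ih]

section

variable [AddCommGroup V] [Module ℝ V]

theorem circ_eq_circWith (A : GradedSpace V) (k : ℤ) (f : Op V W) (g : Op V V) :
    circ A k f g = circWith (fun v => if Even k then v else A.sg v) f g := by
  funext l
  simp only [circ, circWith, splitSum₃, splitSum, List.length_drop, List.drop_drop]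

theorem circ_zero (A : GradedSpace V) (f : Op V W) (g : Op V V) :
    circ A 0 f g = circWith id f g := by
  simp only [circ_eq_circWith, Even.zero, if_true]
  rfl

theorem circ_one (A : GradedSpace V) (f : Op V W) (g : Op V V) :
    circ A 1 f g = circWith A.sg f g := by
  rw [circ_eq_circWith]; simp

theorem circ_neg_one (A : GradedSpace V) (f : Op V W) (g : Op V V) :
    circ A (-1) f g = circWith A.sg f g := by
  rw [circ_eq_circWith]; simp

end

variable [Module ℝ W] [AddCommGroup X] [Module ℝ X]

theorem comp_circWith (ε : V → V) (f : Op V W) (g : Op V V)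
    (T : W →ₗ[ℝ] X) (l : List V) : T (circWith ε f g l) = circWith ε (fun l => T (f l)) g l :=
  map_splitSum₃ T _ _

theorem map_circWith {V' W' : Type*} [AddCommGroup W'] [Module ℝ W'] {ε : V → V} {ε' : V' → V'}
    {f : Op V W} {f' : Op V' W'} {g : Op V V} {g' : Op V' V'} (T : W →ₗ[ℝ] W') (ρ : V → V')
    (hε : ∀ v, ρ (ε v) = ε' (ρ v)) (hf : ∀ l, T (f l) = f' (l.map ρ))
    (hg : ∀ l, ρ (g l) = g' (l.map ρ)) (l : List V) :
    T (circWith ε f g l) = circWith ε' f' g' (l.map ρ) := by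
  rw [circWith, map_splitSum₃, circWith, splitSum₃_map]
  refine splitSum₃_congr fun x y z _ => ?_
  rw [hf]
  simp [hg, Function.comp_def, hε]

variable [AddCommGroup V] [Module ℝ V]

/-- Linearity in each argument, on words of arbitrary elements. -/
def IsMultilinear (f : Op V W) : Prop := ∀ (x z : List V) (c : ℝ) (a b : V),
  f (x ++ (c • a + b) :: z) = c • f (x ++ a :: z) + f (x ++ b :: z)

/-- A multilinear operator as a linear map of one of its arguments. -/
def IsMultilinear.slot {f : Op V W} (hf : IsMultilinear f) (x z : List V) : V →ₗ[ℝ] W where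
  toFun v := f (x ++ v :: z)
  map_add' a b := by simpa using hf x z 1 a b
  map_smul' c a := by
    have h0 : f (x ++ 0 :: z) = 0 := by simpa using hf x z 1 0 0
    simpa [h0] using hf x z c a 0

theorem IsMultilinear.slot_apply {f : Op V W} (hf : IsMultilinear f) (x z : List V) (v : V) :
    hf.slot x z v = f (x ++ v :: z) := rfl

theorem IsMultilinear.map_zero {f : Op V W} (hf : IsMultilinear f) (x z : List V) :
    f (x ++ 0 :: z) = 0 := _root_.map_zero (hf.slot x z)

theorem IsMultilinear.map_add {f : Op V W} (hf : IsMultilinear f) (x z : List V) (a b : V) :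
    f (x ++ (a + b) :: z) = f (x ++ a :: z) + f (x ++ b :: z) :=
  _root_.map_add (hf.slot x z) a b

theorem IsMultilinear.cons {f : Op V W} (hf : IsMultilinear f) (v : V) :
    IsMultilinear fun l => f (v :: l) :=
  fun x z => hf (v :: x) z

theorem IsMultilinear.add {f g : Op V W} (hf : IsMultilinear f) (hg : IsMultilinear g) :
    IsMultilinear fun l => f l + g l := by
  intro x z c a b
  simp only [hf x z, hg x z, smul_add]
  abel

theorem IsMultilinear.comp {f : Op V W} (hf : IsMultilinear f) (T : W →ₗ[ℝ] X) :
    IsMultilinear fun l => T (f l) := by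
  intro x z c a b
  simp only [hf x z, _root_.map_add, map_smul]

theorem circWith_add_right (ε : V → V) {f : Op V W} (hf : IsMultilinear f) (g g' : Op V V)
    (l : List V) :
    circWith ε f (fun l => g l + g' l) l = circWith ε f g l + circWith ε f g' l := by
  simp only [circWith, hf.map_add, splitSum₃_add]

theorem circWith_neg_right (ε : V → V) {f : Op V W} (hf : IsMultilinear f) (g : Op V V)
    (l : List V) :
    circWith ε f (fun l => - g l) l = - circWith ε f g l := by
  have := circWith_add_right ε hf g (fun l => - g l) l
  refine (neg_eq_of_add_eq_zero_right ?_).symm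
  rw [← this]
  refine splitSum₃_eq_zero fun x y z _ => ?_
  simpa using hf.map_zero (x.map ε) z

theorem IsMultilinear.circWith {f : Op V W} {g : Op V V} (hf : IsMultilinear f)
    (hg : IsMultilinear g) (ε : V →ₗ[ℝ] V) : IsMultilinear (circWith ε f g) := by
  intro x z c a b
  simp only [circWith_append_cons, smul_add, ← splitSum₃_smul, ← splitSum_smul]
  rw [show ∀ a b c d e f : W, a + b + c + (d + e + f) = (a + d) + (b + e) + (c + f) by
    intros; abel, ← splitSum₃_add, ← splitSum₃_add, ← splitSum_add]
  simp only [← splitSum_add]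
  congr 1
  · congr 1
    · refine splitSum₃_congr fun p q r _ => ?_
      simpa using hf (p.map ε ++ g q :: r) z c a b
    · refine splitSum_congr fun p q _ => splitSum_congr fun q' r _ => ?_
      rw [hg, hf]
  · refine splitSum₃_congr fun p q r _ => ?_
    simpa using hf (x.map ε) (p.map ε ++ g q :: r) c (ε a) (ε b)

theorem IsMultilinear.map_splitSum₃ {f : Op V W} (hf : IsMultilinear f) {V' : Type*}
    (φ : List V' → List V' → List V' → V) (x l z) :
    f (x ++ splitSum₃ φ l :: z) = splitSum₃ (fun p q r => f (x ++ φ p q r :: z)) l :=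
  AInf.map_splitSum₃ (hf.slot x z) φ l

theorem circWith_circWith_left (ε ε' : V → V) {F : Op V W} (hF : IsMultilinear F) (f g : Op V V)
    (l : List V) :
    circWith ε (circWith ε' F f) g l =
      splitSum₃ (fun p q w => splitSum₃ (fun r y z =>
        F (p.map (ε' ∘ ε) ++ f (q.map ε) :: (r.map ε ++ g y :: z))) w) l +
      circWith (ε' ∘ ε) F (circWith ε f g) l +
      splitSum₃ (fun x y w => splitSum₃ (fun p q r =>
        F (x.map (ε' ∘ ε) ++ ε' (g y) :: (p.map ε' ++ f q :: r))) w) l := by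
  have inner : circWith (ε' ∘ ε) F (circWith ε f g) l =
      splitSum₃ (fun x y z => splitSum (fun p q => splitSum (fun q' r =>
        F (p.map (ε' ∘ ε) ++ f (q.map ε ++ g y :: q') :: r)) z) x) l := by
    simp only [circWith, hF.map_splitSum₃, splitSum₃_splitSum_splitSum]
  rw [circWith, inner, ← splitSum₃_splitSum₃_left, ← splitSum₃_add, ← splitSum₃_add]
  refine splitSum₃_congr fun x y z _ => ?_
  simp only [circWith_append_cons, splitSum₃_map, splitSum_map, List.map_map, List.map_append,
    List.map_cons, List.append_assoc, List.cons_append]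

theorem circWith_preLie (ε : V → V) {F : Op V W} (hF : IsMultilinear F) {f g : Op V V}
    (hf : ∀ l, ε (f l) = f (l.map ε)) (l : List V) :
    circWith ε (circWith id F f) g l + circWith ε F (circWith id g f) l =
      circWith id (circWith ε F g) f l + circWith ε F (circWith ε f g) l := by
  simp only [circWith_circWith_left _ _ hF, Function.id_comp, Function.comp_id, List.map_id, hf,
    id_eq]
  abel

end insertion

/-! ### Compositions with a sequence of maps in all arguments -/

section blockComp

variable {V W X : Type*} [AddCommGroup X]

/-- The sum of `m [F y₁, …, F yᵣ]` over all decompositions of a word into nonempty words `yᵢ`. -/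
def blockComp (m : Op W X) (F : Op V W) : Op V X
  | [] => m []
  | v :: l => ∑ j ∈ Finset.range (l.length + 1),
      blockComp (fun w => m (F (v :: l.take j) :: w)) F (l.drop j)
termination_by l => l.length
decreasing_by simp

theorem blockComp_nil (m : Op W X) (F : Op V W) : blockComp m F [] = m [] := by rw [blockComp]

theorem blockComp_cons (m : Op W X) (F : Op V W) (v : V) (l : List V) :
    blockComp m F (v :: l) =
      splitSum (fun y z => blockComp (fun w => m (F (v :: y) :: w)) F z) l := by
  rw [blockComp]; rfl

/-- The sum of `m [F y₁, …, F' yᵢ, …, F yᵣ]` over all decompositions of a word into nonempty words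
and all positions `i`. -/
def blockCompVar (m : Op W X) (F F' : Op V W) : Op V X
  | [] => 0
  | v :: l => ∑ j ∈ Finset.range (l.length + 1),
      (blockComp (fun w => m (F' (v :: l.take j) :: w)) F (l.drop j) +
        blockCompVar (fun w => m (F (v :: l.take j) :: w)) F F' (l.drop j))
termination_by l => l.length
decreasing_by simp

theorem blockCompVar_nil (m : Op W X) (F F' : Op V W) : blockCompVar m F F' [] = 0 := by
  rw [blockCompVar]

theorem blockCompVar_cons (m : Op W X) (F F' : Op V W) (v : V) (l : List V) :
    blockCompVar m F F' (v :: l) =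
      splitSum (fun y z => blockComp (fun w => m (F' (v :: y) :: w)) F z +
        blockCompVar (fun w => m (F (v :: y) :: w)) F F' z) l := by
  rw [blockCompVar]; rfl

theorem suffix_induction {P : List V → Prop} (l : List V)
    (nil : P []) (cons : ∀ v l, (∀ y z, y ++ z = l → P z) → P (v :: l)) : P l := by
  induction hn : l.length using Nat.strong_induction_on generalizing l with
  | _ n ih =>
    cases l with
    | nil => exact nil
    | cons v l =>
      refine cons v l fun y z h => ih z.length ?_ z rfl
      rw [← hn, ← h]
      simp

theorem splitSum_circWith_blockComp (m : Op W X) (F : Op V W) (a : Op V V) (v : V) (l : List V) :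
    splitSum (fun y z => circWith id (blockComp (fun w => m (F (v :: y) :: w)) F) a z) l +
      splitSum₃ (fun p q r => splitSum (fun y z =>
        blockComp (fun w => m (F (v :: (p ++ a q :: y)) :: w)) F z) r) l =
      circWith id (fun l => blockComp m F (v :: l)) a l := by
  have comm : ∀ x w, splitSum (fun y z => splitSum (fun p q =>
      blockComp (fun w => m (F (v :: p) :: w)) F (q ++ a y :: z)) x) w =
      splitSum (fun p q => splitSum (fun y z =>
        blockComp (fun w => m (F (v :: p) :: w)) F (q ++ a y :: z)) w) x :=
    fun x w => splitSum_comm _ _ _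
  simp only [circWith, List.map_id, blockComp_cons, splitSum_append_cons, splitSum₃_add]
  congr 1
  simp only [splitSum₃, comm, splitSum_assoc]

theorem sum_composition_succ {M : Type*} [AddCommMonoid M] (n : ℕ) (Φ : List ℕ → M) :
    ∑ c : Composition (n + 1), Φ c.blocks =
      ∑ j ∈ Finset.range (n + 1), ∑ c : Composition (n - j), Φ ((j + 1) :: c.blocks) := by
  rw [Finset.sum_sigma']
  symm
  refine Finset.sum_bij (fun x hx => ⟨(x.1 + 1) :: x.2.blocks, ?_, ?_⟩) ?_ ?_ ?_ ?_
  · intro i hi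
    rcases List.mem_cons.1 hi with rfl | hi
    · omega
    · exact x.2.blocks_pos hi
  · have : x.1 < n + 1 := by simpa using hx
    rw [List.sum_cons, x.2.blocks_sum]
    omega
  · simp
  · rintro ⟨i, c⟩ _ ⟨j, c'⟩ _ h
    rw [Composition.mk.injEq, List.cons.injEq] at h
    dsimp only at h
    obtain rfl : i = j := by omega
    obtain rfl : c = c' := Composition.ext h.2
    rfl
  · rintro ⟨bs, hpos, hsum⟩ _
    cases bs with
    | nil => simp at hsum
    | cons b bs =>
      have hb : 0 < b := hpos (by simp)
      rw [List.sum_cons] at hsum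
      refine ⟨⟨b - 1, ⟨bs, fun hi => hpos (by simp [hi]), by omega⟩⟩, ?_, ?_⟩
      · simp; omega
      · simp; omega
  · intro x _
    rfl

theorem sum_composition_eq_blockComp_aux (m : Op W X) (F : Op V W) (l : List V) (n : ℕ)
    (hn : n = l.length) :
    ∑ c : Composition n, m ((l.splitWrtCompositionAux c.blocks).map F) = blockComp m F l := by
  induction l using suffix_induction generalizing m n with
  | nil =>
    subst hn
    have h0 : ∀ c : Composition ([] : List V).length, c.blocks = [] :=
      fun c => c.blocks_eq_nil.2 rfl
    rw [blockComp_nil]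
    refine (Finset.sum_eq_single_of_mem (Composition.ones 0) (Finset.mem_univ _)
      fun c _ hc => (hc (Composition.ext ((h0 c).trans (h0 _).symm))).elim).trans ?_
    rfl
  | cons v l ih =>
    subst hn
    rw [List.length_cons, sum_composition_succ _ fun bs =>
      m (((v :: l).splitWrtCompositionAux bs).map F), blockComp_cons, splitSum]
    refine Finset.sum_congr rfl fun j _ => ?_
    rw [← ih (l.take j) (l.drop j) (List.take_append_drop _ _) _ (l.length - j) (by simp)]
    simp [List.splitWrtCompositionAux_cons]

theorem sum_composition_eq_blockComp (m : Op W X) (F : Op V W) (l : List V) :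
    ∑ c : Composition l.length, m ((l.splitWrtComposition c).map F) = blockComp m F l :=
  sum_composition_eq_blockComp_aux m F l _ rfl

variable [Module ℝ X]

theorem blockComp_linear (m m' : Op W X) (F : Op V W) (c : ℝ) (l : List V) :
    blockComp (fun w => c • m w + m' w) F l = c • blockComp m F l + blockComp m' F l := by
  induction l using suffix_induction generalizing m m' with
  | nil => simp [blockComp_nil]
  | cons v l ih =>
    simp only [blockComp_cons, ← splitSum_smul, ← splitSum_add]
    exact splitSum_congr fun y z h => ih y z h _ _

theorem blockComp_add (m m' : Op W X) (F : Op V W) (l : List V) :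
    blockComp (fun w => m w + m' w) F l = blockComp m F l + blockComp m' F l := by
  simpa using blockComp_linear m m' F 1 l

theorem map_blockComp {V' W' X' : Type*} [AddCommGroup X'] [Module ℝ X']
    {m : Op W X} {m' : Op W' X'} {F : Op V W} {F' : Op V' W'} (T : X →ₗ[ℝ] X') (τ : W → W')
    (ρ : V → V') (hm : ∀ l, T (m l) = m' (l.map τ))
    (hF : ∀ l, τ (F l) = F' (l.map ρ)) (l : List V) :
    T (blockComp m F l) = blockComp m' F' (l.map ρ) := by
  induction l using suffix_induction generalizing m m' with
  | nil => simp [blockComp_nil, hm, blockComp_nil (W := W')]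
  | cons v l ih =>
    rw [blockComp_cons, map_splitSum, List.map_cons, blockComp_cons, splitSum_map]
    refine splitSum_congr fun y z h => ih y z h fun l => ?_
    rw [hm]
    simp [hF]

theorem blockComp_of_unary {m : Op W X} (hm : ∀ u v l, m (u :: v :: l) = 0)
    {F : Op V W} {l : List V} (hl : l ≠ []) : blockComp m F l = m [F l] := by
  have h0 : ∀ (u : W) (v : V) (l : List V), blockComp (fun w => m (u :: w)) F (v :: l) = 0 := by
    intro u v l
    rw [blockComp_cons]
    refine splitSum_eq_zero fun y z _ => ?_
    simp only [hm]
    simpa using blockComp_linear (fun _ => (0 : X)) (fun _ => 0) F 1 z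
  obtain ⟨v, l, rfl⟩ := List.exists_cons_of_ne_nil hl
  rw [blockComp_cons, splitSum_eq_last fun y v z => h0 _ v z, blockComp_nil]

variable [AddCommGroup W] [Module ℝ W]

/-- `blockComp` as a linear map of the first argument of `m`. -/
def blockCompSlot {m : Op W X} (hm : IsMultilinear m) (F : Op V W) (l : List V) : W →ₗ[ℝ] X where
  toFun u := blockComp (fun w => m (u :: w)) F l
  map_add' a b := by
    rw [← blockComp_add]
    exact congrArg (fun m => blockComp m F l) (funext fun w => hm.map_add [] w a b)
  map_smul' c a := by
    have := blockComp_linear (fun w => m (a :: w)) (fun _ => 0) F c l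
    have h0 := blockComp_linear (fun _ => (0 : X)) (fun _ => 0) F 1 l
    simp only [smul_zero, add_zero, one_smul, left_eq_add] at h0 this
    rw [h0, add_zero] at this
    rw [RingHom.id_apply, ← this]
    exact congrArg (fun m => blockComp m F l) (funext fun w => map_smul (hm.slot [] w) c a)

theorem blockCompSlot_apply {m : Op W X} (hm : IsMultilinear m) (F : Op V W) (l : List V) (u : W) :
    blockCompSlot hm F l u = blockComp (fun w => m (u :: w)) F l := rfl

section

variable [AddCommGroup V] [Module ℝ V]

theorem blockComp_append_zero {m : Op W X} (hm : IsMultilinear m) {F : Op V W}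
    (hF : IsMultilinear F) (x z : List V) : blockComp m F (x ++ 0 :: z) = 0 := by
  induction x using suffix_induction generalizing m with
  | nil =>
    rw [List.nil_append, blockComp_cons]
    refine splitSum_eq_zero fun y z _ => ?_
    rw [← blockCompSlot_apply hm, show F (0 :: y) = 0 from hF.map_zero [] y, map_zero]
  | cons v x ih =>
    rw [List.cons_append, blockComp_cons, splitSum_append_cons,
      splitSum_eq_zero fun y z h => ih y z h (hm.cons _), zero_add]
    refine splitSum_eq_zero fun y z _ => ?_
    rw [← blockCompSlot_apply hm, show F (v :: (x ++ 0 :: y)) = 0 from hF.map_zero (v :: x) y,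
      map_zero]

theorem IsMultilinear.circWith_cons {F : Op V W} (hF : IsMultilinear F) {a : Op V V}
    (ha : a [] = 0) (v : V) (l : List V) :
    AInf.circWith id F a (v :: l) = splitSum (fun p q => F (a (v :: p) :: q)) l +
      splitSum₃ (fun p q r => F (v :: (p ++ a q :: r))) l := by
  rw [AInf.circWith_cons, splitSum_cons, ha, show F (0 :: v :: l) = 0 from hF.map_zero [] _,
    zero_add]
  simp [AInf.circWith]

theorem splitSum_blockComp_circWith {m : Op W X} (hm : IsMultilinear m) {F : Op V W}
    (hF : IsMultilinear F) {a : Op V V} (ha : a [] = 0) (v : V) (l : List V) :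
    splitSum (fun y z => blockComp (fun w => m (circWith id F a (v :: y) :: w)) F z) l =
      splitSum (fun y z => blockComp m F (a (v :: y) :: z)) l +
      splitSum₃ (fun p q r => splitSum (fun y z =>
        blockComp (fun w => m (F (v :: (p ++ a q :: y)) :: w)) F z) r) l := by
  have expand : ∀ y z, blockComp (fun w => m (circWith id F a (v :: y) :: w)) F z =
      splitSum (fun p q => blockComp (fun w => m (F (a (v :: p) :: q) :: w)) F z) y +
      splitSum₃ (fun p q r => blockComp (fun w => m (F (v :: (p ++ a q :: r)) :: w)) F z) y := by
    intro y z
    rw [← blockCompSlot_apply hm, hF.circWith_cons ha, map_add, map_splitSum, map_splitSum₃]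
    rfl
  simp only [blockComp_cons, expand, splitSum_add, splitSum₃, splitSum_assoc]

theorem circWith_blockComp {m : Op W X} (hm : IsMultilinear m) {F : Op V W}
    (hF : IsMultilinear F) {a : Op V V} (ha : a [] = 0) (l : List V) :
    circWith id (blockComp m F) a l = blockCompVar m F (circWith id F a) l := by
  induction l using suffix_induction generalizing m with
  | nil =>
    simp only [circWith, splitSum₃, splitSum_nil, blockCompVar_nil, ha]
    exact blockComp_append_zero hm hF [] []
  | cons v l ih =>
    rw [blockCompVar_cons, splitSum_add, splitSum_blockComp_circWith hm hF ha,
      ← splitSum_congr fun y z h => ih y z h (hm.cons (F (v :: y))), circWith_cons, splitSum_cons,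
      ha, show blockComp m F (0 :: v :: l) = 0 from blockComp_append_zero hm hF [] _, zero_add,
      ← splitSum_circWith_blockComp]
    abel

theorem blockComp_of_unit {m : Op V X} (hm : IsMultilinear m) {F : Op V V} (h1 : ∀ v, F [v] = v)
    (h2 : ∀ u v l, F (u :: v :: l) = 0) (l : List V) : blockComp m F l = m l := by
  induction l generalizing m with
  | nil => rw [blockComp_nil]
  | cons v l ih =>
    rw [blockComp_cons]
    cases l with
    | nil => rw [splitSum_nil, blockComp_nil, h1]
    | cons u l =>
      rw [splitSum_cons, h1, ih (hm.cons v), splitSum_eq_zero, add_zero]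
      intro y z _
      rw [h2, ← blockCompSlot_apply hm, map_zero]

end

end blockComp

/-! ### Smooth families of operators on the square -/

section families

variable {U V W : Type*} [AddCommGroup U] [Module ℝ U] [AddCommGroup W] [Module ℝ W]

theorem vderiv_const (u : U) (t : I) : vderiv (fun _ => u) t = 0 :=
  isSmoothDerivation_derivT.coeffwise_const u 0 t

theorem SmoothOnSquare.splitSum {f : List V → List V → I → I → W}
    (h : ∀ x y, SmoothOnSquare (f x y)) (l : List V) :
    SmoothOnSquare fun s t => splitSum (fun x y => f x y s t) l :=
  SmoothOnSquare.sum fun _ _ => h _ _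

theorem SmoothOnSquare.splitSum₃ {f : List V → List V → List V → I → I → W}
    (h : ∀ x y z, SmoothOnSquare (f x y z)) (l : List V) :
    SmoothOnSquare fun s t => splitSum₃ (fun x y z => f x y z s t) l :=
  .splitSum (fun _ w => .splitSum (fun _ _ => h _ _ _) w) l

variable {D : (I → I → ℝ) → I → I → ℝ}

theorem IsSmoothOperator.coeffwise_splitSum (hD : IsSmoothOperator D)
    {f : List V → List V → I → I → W} (h : ∀ x y, SmoothOnSquare (f x y)) (l : List V) (s t : I) :
    coeffwise D (fun s t => splitSum (fun x y => f x y s t) l) s t =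
      splitSum (fun x y => coeffwise D (f x y) s t) l :=
  hD.coeffwise_sum (fun _ _ => h _ _) s t

theorem IsSmoothOperator.coeffwise_splitSum₃ (hD : IsSmoothOperator D)
    {f : List V → List V → List V → I → I → W} (h : ∀ x y z, SmoothOnSquare (f x y z))
    (l : List V) (s t : I) :
    coeffwise D (fun s t => splitSum₃ (fun x y z => f x y z s t) l) s t =
      splitSum₃ (fun x y z => coeffwise D (f x y z) s t) l := by
  unfold splitSum₃
  rw [hD.coeffwise_splitSum fun _ _ => .splitSum (fun _ _ => h _ _ _) _]
  exact splitSum_congr fun x w _ => hD.coeffwise_splitSum (fun _ _ => h _ _ _) w s t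

variable [AddCommGroup V] [Module ℝ V]

/-- A smooth family of multilinear operators, parametrized by the square. -/
structure IsSmoothMultilinear (F : I → I → Op V W) : Prop where
  multilinear : ∀ s t, IsMultilinear (F s t)
  smooth : ∀ l, SmoothOnSquare fun s t => F s t l

/-- The action of `D` on a family of operators, through the values on a fixed word. -/
def opCoeffwise (D : (I → I → ℝ) → I → I → ℝ) (F : I → I → Op V W) : I → I → Op V W :=
  fun s t l => coeffwise D (fun s t => F s t l) s t

variable {F : I → I → Op V W}

namespace IsSmoothOperator

theorem isSmoothMultilinear_opCoeffwise (hD : IsSmoothOperator D) (hF : IsSmoothMultilinear F) :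
    IsSmoothMultilinear (opCoeffwise D F) where
  multilinear s t x z c a b := by
    simp only [opCoeffwise, fun s t => hF.multilinear s t x z c a b]
    rw [hD.coeffwise_add ((hF.smooth _).smul c) (hF.smooth _), hD.coeffwise_smul (hF.smooth _)]
  smooth l := hD.smooth_coeffwise (hF.smooth l)

end IsSmoothOperator

namespace IsSmoothMultilinear

theorem sum_smul_slot (hF : IsSmoothMultilinear F) {ι : Type*} [Fintype ι] (g : ι → I → I → ℝ)
    (w : ι → V) (x z : List V) (s t : I) :
    F s t (x ++ (∑ i, g i s t • w i) :: z) = ∑ i, g i s t • F s t (x ++ w i :: z) := by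
  simp only [← (hF.multilinear s t).slot_apply, map_sum, map_smul]

theorem smooth_slot (hF : IsSmoothMultilinear F) {u : I → I → V} (hu : SmoothOnSquare u)
    (x z : List V) : SmoothOnSquare fun s t => F s t (x ++ u s t :: z) := by
  obtain ⟨N, g, w, hg, rfl⟩ := hu.exists_sum
  simp only [hF.sum_smul_slot]
  exact SmoothOnSquare.sum fun i _ => (hg i).fun_smul (hF.smooth _)

theorem cons (hF : IsSmoothMultilinear F) {u : I → I → V} (hu : SmoothOnSquare u) :
    IsSmoothMultilinear fun s t l => F s t (u s t :: l) :=
  ⟨fun s t => (hF.multilinear s t).cons _, fun l => hF.smooth_slot hu [] l⟩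

theorem comp (hF : IsSmoothMultilinear F) (T : W →ₗ[ℝ] U) :
    IsSmoothMultilinear fun s t l => T (F s t l) :=
  ⟨fun s t => (hF.multilinear s t).comp T, fun l => (hF.smooth l).map T⟩

theorem circWith (hF : IsSmoothMultilinear F) {M : I → I → Op V V} (hM : IsSmoothMultilinear M)
    (ε : V →ₗ[ℝ] V) : IsSmoothMultilinear fun s t => AInf.circWith ε (F s t) (M s t) :=
  ⟨fun s t => (hF.multilinear s t).circWith (hM.multilinear s t) ε,
    fun l => .splitSum₃ (fun _ y _ => hF.smooth_slot (hM.smooth y) _ _) l⟩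

theorem smooth_blockComp {M : I → I → Op W U} (hM : IsSmoothMultilinear M)
    (hF : IsSmoothMultilinear F) (l : List V) :
    SmoothOnSquare fun s t => blockComp (M s t) (F s t) l := by
  induction l using suffix_induction generalizing M with
  | nil => simpa only [blockComp_nil] using hM.smooth []
  | cons v l ih =>
    simp only [blockComp_cons]
    exact SmoothOnSquare.sum fun j _ =>
      ih _ _ (List.take_append_drop _ _) (hM.cons (hF.smooth _))

theorem restrict (hF : IsSmoothMultilinear F) (s₀ : I) : IsSmoothMultilinear fun _ t => F s₀ t :=
  ⟨fun _ t => hF.multilinear s₀ t, fun l => (hF.smooth l).restrict s₀⟩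

theorem smooth_apply (hF : IsSmoothMultilinear F) (L : List (I → I → V))
    (hL : ∀ u ∈ L, SmoothOnSquare u) : SmoothOnSquare fun s t => F s t (L.map fun u => u s t) := by
  induction L generalizing F with
  | nil => exact hF.smooth []
  | cons u L ih => exact ih (hF.cons (hL u (by simp))) fun v hv => hL v (by simp [hv])

end IsSmoothMultilinear

namespace IsSmoothDerivation

theorem coeffwise_slot (hD : IsSmoothDerivation D) (hF : IsSmoothMultilinear F) {u : I → I → V}
    (hu : SmoothOnSquare u) (x z : List V) (s t : I) :
    coeffwise D (fun s t => F s t (x ++ u s t :: z)) s t =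
      opCoeffwise D F s t (x ++ u s t :: z) + F s t (x ++ coeffwise D u s t :: z) := by
  obtain ⟨N, g, w, hg, rfl⟩ := hu.exists_sum
  have hDF := hD.isSmoothMultilinear_opCoeffwise hF
  simp only [hD.coeffwise_sum_smul hg, hF.sum_smul_slot, hDF.sum_smul_slot]
  rw [hD.coeffwise_sum fun i _ => (hg i).fun_smul (hF.smooth _), ← Finset.sum_add_distrib]
  refine Finset.sum_congr rfl fun i _ => ?_
  rw [hD.coeffwise_fun_smul (hg i) (hF.smooth _), add_comm]
  rfl

theorem opCoeffwise_circWith (hD : IsSmoothDerivation D) (hF : IsSmoothMultilinear F)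
    {M : I → I → Op V V} (hM : IsSmoothMultilinear M) (ε : V → V) (s t : I) (l : List V) :
    opCoeffwise D (fun s t => circWith ε (F s t) (M s t)) s t l =
      circWith ε (opCoeffwise D F s t) (M s t) l + circWith ε (F s t) (opCoeffwise D M s t) l := by
  unfold opCoeffwise circWith
  rw [hD.coeffwise_splitSum₃ fun _ y _ => hF.smooth_slot (hM.smooth y) _ _, ← splitSum₃_add]
  exact splitSum₃_congr fun x y z _ => hD.coeffwise_slot hF (hM.smooth y) _ _ s t

theorem coeffwise_blockComp (hD : IsSmoothDerivation D) {M : I → I → Op W U}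
    (hM : IsSmoothMultilinear M) (hF : IsSmoothMultilinear F) (l : List V) (s t : I) :
    coeffwise D (fun s t => blockComp (M s t) (F s t) l) s t =
      blockComp (opCoeffwise D M s t) (F s t) l +
        blockCompVar (M s t) (F s t) (opCoeffwise D F s t) l := by
  induction l using suffix_induction generalizing M with
  | nil => simp only [blockComp_nil, blockCompVar_nil, add_zero]; rfl
  | cons v l ih =>
    simp only [blockComp_cons, blockCompVar_cons]
    rw [hD.coeffwise_splitSum fun _ _ => (hM.cons (hF.smooth _)).smooth_blockComp hF _,
      ← splitSum_add]
    refine splitSum_congr fun y z h => ?_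
    rw [ih y z h (hM.cons (hF.smooth _)), ← add_assoc, ← blockComp_add]
    congr 2
    funext w
    exact hD.coeffwise_slot hM (hF.smooth _) [] w s t

end IsSmoothDerivation

/-- `coeffwise D`, as an operator with one argument. -/
def unaryCoeffwise (D : (I → I → ℝ) → I → I → ℝ) (s t : I) : Op (I → I → V) V
  | [u] => coeffwise D u s t
  | _ => 0

theorem splitSum_unaryCoeffwise_cons {f : Op V W} (hf : IsMultilinear f) (s t : I)
    (u : I → I → V) (L : List (I → I → V)) :
    splitSum (fun y z => f (unaryCoeffwise D s t y :: z.map fun u => u s t)) (u :: L) =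
      f (coeffwise D u s t :: L.map fun u => u s t) := by
  have f_zero (z : List V) : f (0 :: z) = 0 := hf.map_zero [] z
  rw [splitSum_cons, show unaryCoeffwise D s t ([] : List (I → I → V)) = 0 from rfl, f_zero,
    zero_add]
  cases L with
  | nil => rw [splitSum_nil]; rfl
  | cons v L =>
    rw [splitSum_cons, splitSum_eq_zero, add_zero]
    · rfl
    · exact fun _ _ _ => f_zero _

theorem IsSmoothDerivation.coeffwise_apply (hD : IsSmoothDerivation D)
    (hF : IsSmoothMultilinear F) (L : List (I → I → V)) (hL : ∀ u ∈ L, SmoothOnSquare u) (s t : I) :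
    coeffwise D (fun s t => F s t (L.map fun u => u s t)) s t =
      opCoeffwise D F s t (L.map fun u => u s t) +
      splitSum₃ (fun x y z => F s t (x.map (fun u => u s t) ++ unaryCoeffwise D s t y ::
        z.map fun u => u s t)) L := by
  induction L generalizing F with
  | nil =>
    simp only [splitSum₃, splitSum_nil, List.map_nil, List.nil_append, unaryCoeffwise]
    rw [show F s t [0] = 0 from (hF.multilinear s t).map_zero [] [], add_zero]
    rfl
  | cons u L ih =>
    have hu := hL u (by simp)
    have leibniz : opCoeffwise D (fun s t l => F s t (u s t :: l)) s t (L.map fun u => u s t) =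
        opCoeffwise D F s t (u s t :: L.map fun u => u s t) +
          F s t (coeffwise D u s t :: L.map fun u => u s t) := hD.coeffwise_slot hF hu [] _ s t
    refine (ih (hF.cons hu) fun v hv => hL v (by simp [hv])).trans ?_
    rw [leibniz, add_assoc, ← splitSum_unaryCoeffwise_cons (hF.multilinear s t)]
    simp only [splitSum₃]
    rw [splitSum_cons (fun x w => splitSum _ w)]
    rfl

end families

/-! ### The path construction for a nilpotent family of operators -/

section unit

variable {U : Type*} [AddCommGroup U]

/-- The identity map as a sequence of maps, the unit of the composition of sequences. -/
def unitOp : Op U U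
  | [u] => u
  | _ => 0

theorem unitOp_append_cons (x : List U) (u : U) (z : List U) (h : x ≠ [] ∨ z ≠ []) :
    unitOp (x ++ u :: z) = 0 := by
  match x, z, h with
  | [], [], h => simp at h
  | [], v :: z, _ => rfl
  | [w], z, _ => rfl
  | w :: w' :: x, z, _ => rfl

theorem isMultilinear_unitOp [Module ℝ U] : IsMultilinear (unitOp (U := U)) := by
  intro x z c a b
  by_cases h : x ≠ [] ∨ z ≠ []
  · simp [unitOp_append_cons x _ z h]
  · obtain ⟨rfl, rfl⟩ := by simpa only [ne_eq, not_or, not_not] using h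
    rfl

theorem circWith_of_unary {f : Op U U} (hf : ∀ u v l, f (u :: v :: l) = 0) (ε : U → U)
    (g : Op U U) (l : List U) : circWith ε f g l = f [g l] := by
  have hf' (x : List U) (u : U) (z : List U) (v : U) : f ((v :: x) ++ u :: z) = 0 := by
    cases x <;> exact hf _ _ _
  cases l with
  | nil => simp only [circWith, splitSum₃, splitSum_nil]; rfl
  | cons v l =>
    unfold circWith splitSum₃
    rw [splitSum_cons, splitSum_eq_zero (l := l), add_zero, splitSum_eq_last]
    · rfl
    · exact fun x v z => hf _ _ _
    · exact fun x w _ => splitSum_eq_zero fun y z _ => hf' _ _ _ _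

theorem circWith_unitOp (ε : U → U) (g : Op U U) (l : List U) : circWith ε unitOp g l = g l :=
  circWith_of_unary (fun _ _ _ => rfl) ε g l

end unit

section twisted

variable {U : Type*} [AddCommGroup U] [Module ℝ U]

/-- Linearity of `Φ` over an operator `E` of odd degree, up to the global sign `c`: moving `E` out
of an argument twists the arguments before it by `ε`. -/
def IsTwistedLinear (ε E : U →ₗ[ℝ] U) (c : ℝ) (Φ : Op U U) : Prop :=
  ∀ (x : List U) (u : U) (z : List U), Φ (x ++ E u :: z) = c • E (Φ (x.map ε ++ u :: z))

theorem isTwistedLinear_unitOp (ε E : U →ₗ[ℝ] U) : IsTwistedLinear ε E 1 unitOp := by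
  intro x u z
  by_cases h : x ≠ [] ∨ z ≠ []
  · have h' : x.map ε ≠ [] ∨ z ≠ [] := by simpa using h
    simp [unitOp_append_cons x _ z h, unitOp_append_cons _ _ z h']
  · obtain ⟨rfl, rfl⟩ := by simpa only [ne_eq, not_or, not_not] using h
    exact (one_smul ℝ _).symm

namespace IsTwistedLinear

variable {ε E τ : U →ₗ[ℝ] U} {c c' : ℝ} {Φ Ψ : Op U U}

theorem circWith (hΦ : IsTwistedLinear ε E c Φ) (hΨ : IsTwistedLinear ε E c' Ψ)
    (mΦ : IsMultilinear Φ) (hε : ∀ l, ε (Ψ l) = c' • Ψ (l.map ε))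
    (hτ : ∀ u, τ (E u) = c' • E (τ u)) (hτε : ∀ u, ε (τ u) = τ (ε u)) :
    IsTwistedLinear ε E (c * c') (circWith τ Φ Ψ) := by
  have map_smul_slot (x : List U) (c : ℝ) (u : U) (z : List U) :
      Φ (x ++ (c • u) :: z) = c • Φ (x ++ u :: z) := map_smul (mΦ.slot x z) c u
  have map_comm (p : List U) : (p.map τ).map ε = (p.map ε).map τ := by simp [hτε]
  intro x u z
  rw [circWith_append_cons, circWith_append_cons, map_add, map_add, smul_add, smul_add]
  congr 1
  · congr 1
    · rw [splitSum₃_map, map_splitSum₃, ← splitSum₃_smul]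
      refine splitSum₃_congr fun p q r _ => ?_
      have := hΦ (p.map τ ++ Ψ q :: r) u z
      simp only [List.append_assoc, List.cons_append, List.map_append, List.map_cons] at this
      rw [this, hε, map_smul_slot, map_comm, map_smul, smul_smul]
    · rw [splitSum_map, map_splitSum, ← splitSum_smul]
      refine splitSum_congr fun p q _ => ?_
      rw [map_splitSum, ← splitSum_smul]
      refine splitSum_congr fun q' r _ => ?_
      rw [hΨ, map_smul_slot, hΦ, smul_smul, map_comm, mul_comm]
  · rw [map_splitSum₃, ← splitSum₃_smul]
    refine splitSum₃_congr fun p q r _ => ?_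
    simp only [List.map_append, List.map_cons, List.append_assoc, List.cons_append]
    rw [hτ, map_smul_slot, hΦ, smul_smul, map_comm, mul_comm]

theorem map_eq_zero (h : IsTwistedLinear ε E c Φ) (hE : ∀ u, E (E u) = 0) (x : List U) (u : U)
    (z : List U) : E (Φ (x ++ E u :: z)) = 0 := by
  rw [h, map_smul, hE, smul_zero]

end IsTwistedLinear

/-- A smooth family of operators of degree zero, commuting with the sign `ε`, linear over an
operator `E` of square zero, and whose unary part has values in the range of `E`.  Iterated
insertions of such a family vanish after finitely many steps. -/
structure IsNilpotentFamily (ε E : U →ₗ[ℝ] U) (a : I → I → Op U U) : Prop where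
  sq : ∀ u, ε (ε u) = u
  E_sq : ∀ u, E (E u) = 0
  smooth : IsSmoothMultilinear a
  comm : ∀ s t l, ε (a s t l) = a s t (l.map ε)
  twistedLinear : ∀ s t, IsTwistedLinear ε E 1 (a s t)
  nil : ∀ s t, a s t [] = 0
  unary : ∀ s t u, ∃ v, a s t [u] = E v

end twisted

section path

variable {U : Type*} [AddCommGroup U]

theorem circWith_eq_sum (f g : Op U U) (l : List U) : circWith id f g l =
    ∑ p ∈ (Finset.range (l.length + 1)).sigma fun j => Finset.range ((l.drop j).length + 1),
      f (l.take p.1 ++ g ((l.drop p.1).take p.2) :: (l.drop p.1).drop p.2) := by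
  rw [Finset.sum_sigma]
  simp [circWith, splitSum₃, splitSum]

/-- The sum over trees with levels labelled by a list of times; this is `trees`, which does not
depend on the grading as the operators have degree zero. -/
def treeSum (a : I → Op U U) : List I → Op U U
  | [] => unitOp
  | t :: ts => circWith id (treeSum a ts) (a t)

variable [Module ℝ U]

/-- The `i`-th term of the path construction from `s` to `1`: the simplex integral of `treeSum`, in
the form of an iterated primitive. -/
def pathTerm (a : I → I → Op U U) : ℕ → I → I → Op U U
  | 0 => fun _ _ => unitOp
  | i + 1 => opCoeffwise primitiveS fun s t => circWith id (pathTerm a i s t) (a s t)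

/-- The path construction from `s` to `1`. -/
def pathOp (a : I → I → Op U U) (s t : I) : Op U U :=
  fun l => ∑ i ∈ Finset.range (l.length + 1), pathTerm a i s t l

namespace IsSmoothMultilinear

variable {a : I → I → Op U U} (ha : IsSmoothMultilinear a)
include ha

theorem pathTerm (i : ℕ) : IsSmoothMultilinear (pathTerm a i) := by
  induction i with
  | zero => exact ⟨fun _ _ => isMultilinear_unitOp, fun l => SmoothOnSquare.const _⟩
  | succ i ih =>
    exact isSmoothOperator_primitiveS.isSmoothMultilinear_opCoeffwise
      (ih.circWith ha LinearMap.id)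

theorem circWith_pathTerm (i : ℕ) :
    IsSmoothMultilinear fun s t => AInf.circWith id (AInf.pathTerm a i s t) (a s t) :=
  (ha.pathTerm i).circWith ha LinearMap.id

theorem pathOp : IsSmoothMultilinear (pathOp a) where
  multilinear s t x z c u v := by
    simp only [AInf.pathOp, List.length_append, List.length_cons, Finset.smul_sum,
      ← Finset.sum_add_distrib]
    exact Finset.sum_congr rfl fun i _ => (ha.pathTerm i).multilinear s t x z c u v
  smooth l := SmoothOnSquare.sum fun i _ => (ha.pathTerm i).smooth l

theorem opCoeffwise_derivS_pathTerm_succ (i : ℕ) (s t : I) (l : List U) :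
    opCoeffwise derivS (AInf.pathTerm a (i + 1)) s t l =
      AInf.circWith id (AInf.pathTerm a i s t) (a s t) l :=
  congrFun₂ ((ha.circWith_pathTerm i).smooth l).coeffwise_derivS_primitiveS s t

theorem pathTerm_succ_one (i : ℕ) (t : I) (l : List U) : AInf.pathTerm a (i + 1) 1 t l = 0 :=
  ((ha.circWith_pathTerm i).smooth l).coeffwise_primitiveS_one t

theorem pathOp_one (t : I) : AInf.pathOp a 1 t = unitOp := by
  funext l
  rw [AInf.pathOp, Finset.sum_range_succ',
    Finset.sum_eq_zero fun i _ => ha.pathTerm_succ_one i t l, zero_add]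
  rfl

theorem pathTerm_succ_apply (ℓ : Module.Dual ℝ U) (i : ℕ) (s t : I) {ι : Type} (A : Finset ι)
    (L : ι → List U) :
    ∑ k ∈ A, ℓ (AInf.pathTerm a (i + 1) s t (L k)) = -∫ y in Set.Icc s 1,
      ∑ k ∈ A, ℓ (AInf.circWith id (AInf.pathTerm a i y t) (a y t) (L k)) := by
  have hs (k : ι) := (ha.circWith_pathTerm i).smooth (L k)
  have h := isSmoothOperator_primitiveS.apply_coeffwise
    (SmoothOnSquare.sum (A := A) fun k _ => hs k) ℓ s t
  rw [isSmoothOperator_primitiveS.coeffwise_sum fun k _ => hs k] at h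
  simp only [map_sum] at h
  exact h

theorem simplexIntegral_treeSum (ℓ : Module.Dual ℝ U) (t : I) (i : ℕ) (s : I) {ι : Type}
    (A : Finset ι) (L : ι → List U) :
    (-1) ^ i * simplexIntegral i s 1 (fun ts => ∑ k ∈ A, ℓ (treeSum (fun s => a s t) ts (L k))) =
      ∑ k ∈ A, ℓ (AInf.pathTerm a i s t (L k)) := by
  induction i generalizing s ι with
  | zero => simp [simplexIntegral, treeSum, AInf.pathTerm]
  | succ i ih =>
    have inner (y : I) : (-1) ^ i * simplexIntegral i y 1 (fun ts => ∑ k ∈ A,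
        ℓ (treeSum (fun s => a s t) (y :: ts) (L k))) =
        ∑ k ∈ A, ℓ (AInf.circWith id (AInf.pathTerm a i y t) (a y t) (L k)) := by
      simp only [treeSum, circWith_eq_sum, map_sum]
      simpa only [Finset.sum_sigma] using ih y (A.sigma fun k =>
        (Finset.range ((L k).length + 1)).sigma fun j =>
          Finset.range (((L k).drop j).length + 1)) fun p =>
            (L p.1).take p.2.1 ++ a y t (((L p.1).drop p.2.1).take p.2.2) ::
              ((L p.1).drop p.2.1).drop p.2.2
    rw [ha.pathTerm_succ_apply, pow_succ, mul_neg_one, neg_mul, simplexIntegral,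
      ← MeasureTheory.integral_const_mul]
    simp only [inner]

end IsSmoothMultilinear

theorem circWith_id_eq_zero {W : Type*} [AddCommGroup W] [Module ℝ W] {f : Op U W}
    (hf : IsMultilinear f) {a : Op U U} (hnil : a [] = 0) {l : List U}
    (hunary : ∀ x u z, x ++ u :: z = l → f (x ++ a [u] :: z) = 0)
    (hshort : ∀ w : List U, w.length < l.length → f w = 0) : circWith id f a l = 0 := by
  refine splitSum₃_eq_zero fun x y z h => ?_
  rw [List.map_id]
  match y with
  | [] => rw [hnil, hf.map_zero]
  | [u] => exact hunary x u z (by simpa using h)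
  | u :: v :: y => exact hshort _ (by simp [← h])

namespace IsNilpotentFamily

variable {ε E : U →ₗ[ℝ] U} {a : I → I → Op U U} (ha : IsNilpotentFamily ε E a)
include ha

theorem twistedLinear_pathTerm (i : ℕ) (s t : I) : IsTwistedLinear ε E 1 (pathTerm a i s t) := by
  induction i generalizing s t with
  | zero => exact isTwistedLinear_unitOp ε E
  | succ i ih =>
    intro x u z
    have h (s t) : circWith id (pathTerm a i s t) (a s t) (x ++ E u :: z) =
        E (circWith id (pathTerm a i s t) (a s t) (x.map ε ++ u :: z)) := by
      simpa using (ih s t).circWith (τ := LinearMap.id) (ha.twistedLinear s t)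
        ((ha.smooth.pathTerm i).multilinear s t) (by simpa using ha.comm s t) (by simp)
        (by simp) x u z
    simp only [pathTerm, opCoeffwise, h, one_smul]
    exact isSmoothOperator_primitiveS.coeffwise_map ((ha.smooth.circWith_pathTerm i).smooth _) E s t

theorem twistedLinear_pathOp (s t : I) : IsTwistedLinear ε E 1 (pathOp a s t) := by
  intro x u z
  simp only [pathOp, one_smul, map_sum, List.length_append, List.length_cons, List.length_map]
  exact Finset.sum_congr rfl fun i _ => by rw [ha.twistedLinear_pathTerm, one_smul]

theorem E_pathTerm_eq_zero (i : ℕ) (s t : I) (l : List U) (hi : l.length ≤ i) :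
    E (pathTerm a i s t l) = 0 := by
  induction i generalizing s t l with
  | zero =>
    obtain rfl : l = [] := List.length_eq_zero_iff.1 (by omega)
    exact map_zero E
  | succ i ih =>
    have hm (s t) := (ha.smooth.pathTerm i).multilinear s t
    have h (s t) : E (circWith id (pathTerm a i s t) (a s t) l) = 0 := by
      rw [comp_circWith]
      refine circWith_id_eq_zero ((hm s t).comp E) (ha.nil s t) (fun x u z _ => ?_)
        fun w hw => ih s t w (by omega)
      obtain ⟨v, hv⟩ := ha.unary s t u
      rw [hv, (ha.twistedLinear_pathTerm i s t).map_eq_zero ha.E_sq]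
    rw [pathTerm, opCoeffwise, ← isSmoothOperator_primitiveS.coeffwise_map
      ((ha.smooth.circWith_pathTerm i).smooth l)]
    simp only [h, isSmoothOperator_primitiveS.coeffwise_zero]

theorem pathTerm_eq_zero (i : ℕ) (s t : I) (l : List U) (hi : l.length < i) :
    pathTerm a i s t l = 0 := by
  induction i generalizing s t l with
  | zero => omega
  | succ i ih =>
    have h (s t) : circWith id (pathTerm a i s t) (a s t) l = 0 := by
      refine circWith_id_eq_zero ((ha.smooth.pathTerm i).multilinear s t) (ha.nil s t)
        (fun x u z hl => ?_) fun w hw => ih s t w (by omega)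
      obtain ⟨v, hv⟩ := ha.unary s t u
      rw [hv, ha.twistedLinear_pathTerm, one_smul]
      refine ha.E_pathTerm_eq_zero i s t _ ?_
      rw [← hl] at hi
      simp only [List.length_append, List.length_cons, List.length_map] at hi ⊢
      omega
    simp only [pathTerm, opCoeffwise, h, isSmoothOperator_primitiveS.coeffwise_zero]

theorem pathOp_eq_sum (s t : I) (l : List U) {N : ℕ} (hN : l.length < N) :
    pathOp a s t l = ∑ i ∈ Finset.range N, pathTerm a i s t l :=
  Finset.sum_subset (Finset.range_mono hN) fun i _ hi =>
    ha.pathTerm_eq_zero i s t l (by simpa [Nat.succ_le_iff] using hi)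

theorem opCoeffwise_derivS_pathOp (s t : I) :
    opCoeffwise derivS (pathOp a) s t = circWith id (pathOp a s t) (a s t) := by
  funext l
  have hS := isSmoothDerivation_derivS
  have insertion : circWith id (pathOp a s t) (a s t) l =
      ∑ i ∈ Finset.range (l.length + 2), circWith id (pathTerm a i s t) (a s t) l := by
    rw [← circWith_sum_left]
    refine splitSum₃_congr fun x y z h => ha.pathOp_eq_sum s t _ ?_
    simp only [← h, List.map_id, List.length_append, List.length_cons]
    omega
  have derivative : opCoeffwise derivS (pathOp a) s t l =
      ∑ i ∈ Finset.range (l.length + 3), opCoeffwise derivS (pathTerm a i) s t l := by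
    simp only [opCoeffwise, fun s t => ha.pathOp_eq_sum s t l (N := l.length + 3) (by omega)]
    exact hS.coeffwise_sum (fun i _ => (ha.smooth.pathTerm i).smooth l) s t
  have initial : opCoeffwise derivS (pathTerm a 0) s t l = 0 := hS.coeffwise_const _ s t
  rw [derivative, Finset.sum_range_succ', initial, add_zero, insertion]
  exact Finset.sum_congr rfl fun i _ => ha.smooth.opCoeffwise_derivS_pathTerm_succ i s t l

end IsNilpotentFamily

/-- Inserting any value of `a` into a word without zeros lowers its total weight. -/
def LowersWeight (wt : U → ℕ) (a : Op U U) : Prop :=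
  ∀ y, 0 ∉ y → a y = 0 ∨ wt (a y) < (y.map wt).sum

theorem eq_zero_of_opCoeffwise_derivS {X a : I → I → Op U U}
    (hX : ∀ l, SmoothOnSquare fun s t => X s t l)
    (hX0 : ∀ s t x z, X s t (x ++ 0 :: z) = 0)
    (hderiv : ∀ s t, opCoeffwise derivS X s t = circWith id (X s t) (a s t))
    (hone : ∀ t l, X 1 t l = 0) {wt : U → ℕ} (hwt : ∀ s t, LowersWeight wt (a s t)) (s t : I)
    (l : List U) : X s t l = 0 := by
  induction hn : (l.map wt).sum using Nat.strong_induction_on generalizing l s t with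
  | _ n ih =>
    by_cases h0 : 0 ∈ l
    · obtain ⟨x, z, rfl⟩ := List.append_of_mem h0
      exact hX0 s t x z
    · refine (hX l).eq_zero_of_coeffwise_derivS (fun s t => ?_) (fun t => hone t l) s t
      refine (congrFun (hderiv s t) l).trans (splitSum₃_eq_zero fun x y z h => ?_)
      rcases hwt s t y (fun hy => h0 (by simp [← h, hy])) with hy | hy
      · rw [hy, hX0]
      · refine ih _ ?_ s t _ rfl
        simp only [← hn, ← h, List.map_id, List.map_append, List.map_cons, List.sum_append,
          List.sum_cons]
        omega

/-- The failure of `G s t` to intertwine the structures `M s t` and `M 1 t`, when both carry the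
additional differential `E ∂ₜ`. -/
def morphismDefect (ε E : U →ₗ[ℝ] U) (M G : I → I → Op U U) (s t : I) : Op U U := fun l =>
  blockComp (M 1 t) (G s t) l + E (opCoeffwise derivT G s t l) - circWith ε (G s t) (M s t) l

namespace IsNilpotentFamily

variable {ε E : U →ₗ[ℝ] U} {a M : I → I → Op U U} (ha : IsNilpotentFamily ε E a)
include ha

theorem derivS_blockComp_pathOp {N : I → Op U U} (hN : IsSmoothMultilinear fun _ => N) (s t : I)
    (l : List U) : coeffwise derivS (fun s t => blockComp (N t) (pathOp a s t) l) s t =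
      circWith id (blockComp (N t) (pathOp a s t)) (a s t) l := by
  have hS := isSmoothDerivation_derivS
  have hG := ha.smooth.pathOp
  have constant : opCoeffwise derivS (fun _ t => N t) s t = fun _ => (0 : U) :=
    funext fun l => hS.coeffwise_const _ s t
  have zero_left : blockComp (fun _ => (0 : U)) (pathOp a s t) l = 0 := by
    simpa using blockComp_linear (fun _ => (0 : U)) (fun _ => 0) (pathOp a s t) 1 l
  rw [hS.coeffwise_blockComp hN hG, constant, zero_left, zero_add, ha.opCoeffwise_derivS_pathOp,
    circWith_blockComp (hN.multilinear s t) (hG.multilinear s t) (ha.nil s t)]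

theorem derivS_derivT_pathOp (s t : I) (l : List U) :
    coeffwise derivS (fun s t => E (opCoeffwise derivT (pathOp a) s t l)) s t =
      circWith id (fun l => E (opCoeffwise derivT (pathOp a) s t l)) (a s t) l +
        circWith ε (pathOp a s t) (fun l => E (opCoeffwise derivT a s t l)) l := by
  have hT := isSmoothDerivation_derivT
  have hG := ha.smooth.pathOp
  have hTG := hT.isSmoothMultilinear_opCoeffwise hG
  have swap : coeffwise derivS (fun s t => opCoeffwise derivT (pathOp a) s t l) s t =
      opCoeffwise derivT (fun s t => circWith id (pathOp a s t) (a s t)) s t l := by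
    refine (congrFun₂ (hG.smooth l).coeffwise_derivS_derivT_comm s t).trans ?_
    simp only [← ha.opCoeffwise_derivS_pathOp]
    rfl
  rw [isSmoothDerivation_derivS.coeffwise_map (hTG.smooth l), swap,
    hT.opCoeffwise_circWith hG ha.smooth, map_add, comp_circWith, comp_circWith]
  congr 1
  refine splitSum₃_congr fun x y z _ => ?_
  rw [ha.twistedLinear_pathOp, one_smul]
  simp [ha.sq, Function.comp_def]

theorem derivS_circWith_pathOp (hM : IsSmoothMultilinear M)
    (hMC : ∀ s t l, opCoeffwise derivS M s t l = circWith id (M s t) (a s t) l +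
      (-circWith ε (a s t) (M s t) l + E (opCoeffwise derivT a s t l)))
    (s t : I) (l : List U) :
    coeffwise derivS (fun s t => circWith ε (pathOp a s t) (M s t) l) s t =
      circWith id (circWith ε (pathOp a s t) (M s t)) (a s t) l +
        circWith ε (pathOp a s t) (fun l => E (opCoeffwise derivT a s t l)) l := by
  have hG := ha.smooth.pathOp
  refine (isSmoothDerivation_derivS.opCoeffwise_circWith hG hM ε s t l).trans ?_
  rw [ha.opCoeffwise_derivS_pathOp, show opCoeffwise derivS M s t = _ from funext (hMC s t),
    circWith_add_right _ (hG.multilinear s t), circWith_add_right _ (hG.multilinear s t),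
    circWith_neg_right _ (hG.multilinear s t), ← add_assoc, ← add_assoc,
    circWith_preLie ε (hG.multilinear s t) (ha.comm s t)]
  abel

theorem opCoeffwise_derivS_morphismDefect (hM : IsSmoothMultilinear M)
    (hMC : ∀ s t l, opCoeffwise derivS M s t l = circWith id (M s t) (a s t) l +
      (-circWith ε (a s t) (M s t) l + E (opCoeffwise derivT a s t l)))
    (s t : I) : opCoeffwise derivS (morphismDefect ε E M (pathOp a)) s t =
      circWith id (morphismDefect ε E M (pathOp a) s t) (a s t) := by
  funext l
  have hS := isSmoothDerivation_derivS
  have hG := ha.smooth.pathOp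
  have hM1 := (hM.restrict 1).smooth_blockComp hG l
  have hTG := ((isSmoothDerivation_derivT.isSmoothMultilinear_opCoeffwise hG).comp E).smooth l
  have hGM := (hG.circWith hM ε).smooth l
  unfold opCoeffwise morphismDefect
  rw [hS.coeffwise_sub (hM1.add hTG) hGM, hS.coeffwise_add hM1 hTG,
    ha.derivS_blockComp_pathOp (hM.restrict 1), ha.derivS_derivT_pathOp,
    ha.derivS_circWith_pathOp hM hMC, circWith_sub_left, circWith_add_left]
  abel

theorem morphismDefect_one {t : I} (hM : IsMultilinear (M 1 t)) (l : List U) :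
    morphismDefect ε E M (pathOp a) 1 t l = 0 := by
  have derivT_one : opCoeffwise derivT (pathOp a) 1 t l = 0 := by
    have : (fun t' => pathOp a 1 t' l) = fun _ => unitOp l :=
      funext fun t' => by rw [ha.smooth.pathOp_one]
    exact (congrArg (vderiv · t) this).trans (vderiv_const _ _)
  rw [morphismDefect, derivT_one, ha.smooth.pathOp_one, circWith_unitOp,
    blockComp_of_unit hM (fun _ => rfl) fun _ _ _ => rfl, map_zero, add_zero, sub_self]

theorem blockComp_pathOp (hM : IsSmoothMultilinear M)
    (hMC : ∀ s t l, opCoeffwise derivS M s t l = circWith id (M s t) (a s t) l +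
      (-circWith ε (a s t) (M s t) l + E (opCoeffwise derivT a s t l)))
    {wt : U → ℕ} (hwt : ∀ s t, LowersWeight wt (a s t)) (s t : I) (l : List U) :
    blockComp (M 1 t) (pathOp a s t) l + E (opCoeffwise derivT (pathOp a) s t l) =
      circWith ε (pathOp a s t) (M s t) l := by
  have hG := ha.smooth.pathOp
  have hM1 := hM.restrict 1
  have hTG := isSmoothDerivation_derivT.isSmoothMultilinear_opCoeffwise hG
  have hGM := hG.circWith hM ε
  refine sub_eq_zero.1 (eq_zero_of_opCoeffwise_derivS (X := morphismDefect ε E M (pathOp a))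
    (fun l => ?_) (fun s t x z => ?_) (ha.opCoeffwise_derivS_morphismDefect hM hMC)
    (fun t l => ha.morphismDefect_one (hM.multilinear 1 t) l) hwt s t l)
  · exact ((hM1.smooth_blockComp hG l).add ((hTG.comp E).smooth l)).sub (hGM.smooth l)
  · rw [morphismDefect, blockComp_append_zero (hM1.multilinear s t) (hG.multilinear s t),
      (hTG.multilinear s t).map_zero, (hGM.multilinear s t).map_zero, map_zero, add_zero, sub_zero]

end IsNilpotentFamily

end path

/-! ### Degrees -/

section degrees

variable {V W : Type*} [AddCommGroup V] [Module ℝ V] [AddCommGroup W] [Module ℝ W]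

/-- A word of homogeneous elements with total shifted degree `d`. -/
def WordDeg (A : GradedSpace V) : List V → ℤ → Prop
  | [], d => d = 0
  | v :: l, d => ∃ k, v ∈ A.part k ∧ WordDeg A l (d - (k - 1))

theorem wordDeg_iff {A : GradedSpace V} {l : List V} {d : ℤ} : WordDeg A l d ↔
    ∃ ks, List.Forall₂ (fun i v => v ∈ A.part i) ks l ∧ d = ks.sum - l.length := by
  induction l generalizing d with
  | nil => simp [WordDeg]
  | cons v l ih =>
    simp only [WordDeg, ih, List.forall₂_cons_right_iff]
    constructor
    · rintro ⟨k, hk, ks, hks, h⟩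
      refine ⟨k :: ks, ⟨k, ks, hk, hks, rfl⟩, ?_⟩
      simp
      omega
    · rintro ⟨_, ⟨k, ks, hk, hks, rfl⟩, h⟩
      refine ⟨k, hk, ks, hks, ?_⟩
      simp at h
      omega

theorem hasDegree_iff {A : GradedSpace V} {B : GradedSpace W} {k : ℤ} {f : Op V W} :
    HasDegree A B k f ↔ ∀ l d, WordDeg A l d → f l ∈ B.part (d + k + 1) := by
  constructor
  · intro h l d hd
    obtain ⟨ks, hks, rfl⟩ := wordDeg_iff.1 hd
    have := h ks l hks
    rwa [show ks.sum - (l.length : ℤ) + k + 1 = ks.sum + k + 1 - l.length by ring]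
  · intro h ks l hks
    have := h l _ (wordDeg_iff.2 ⟨ks, hks, rfl⟩)
    rwa [show ks.sum - (l.length : ℤ) + k + 1 = ks.sum + k + 1 - l.length by ring] at this

theorem wordDeg_append {A : GradedSpace V} {x y : List V} {d : ℤ} :
    WordDeg A (x ++ y) d ↔ ∃ e, WordDeg A x e ∧ WordDeg A y (d - e) := by
  induction x generalizing d with
  | nil => simp [WordDeg]
  | cons v x ih =>
    simp only [List.cons_append, WordDeg, ih]
    constructor
    · rintro ⟨k, hk, e, he, h⟩
      exact ⟨e + (k - 1), ⟨k, hk, by simpa using he⟩, by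
        rwa [show d - (e + (k - 1)) = d - (k - 1) - e by ring]⟩
    · rintro ⟨e, ⟨k, hk, he⟩, h⟩
      exact ⟨k, hk, _, he, by rwa [show d - (k - 1) - (e - (k - 1)) = d - e by ring]⟩

theorem IsHomog.exists_wordDeg {A : GradedSpace V} {l : List V} (h : IsHomog A l) :
    ∃ d, WordDeg A l d := by
  induction l with
  | nil => exact ⟨0, rfl⟩
  | cons v l ih =>
    obtain ⟨d, hd⟩ := ih fun u hu => h u (by simp [hu])
    obtain ⟨k, hk⟩ := h v (by simp)
    exact ⟨d + (k - 1), k, hk, by simpa using hd⟩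

theorem WordDeg.map {A : GradedSpace V} {B : GradedSpace W} {τ : V → W}
    (hτ : ∀ k v, v ∈ A.part k → τ v ∈ B.part k) {l : List V} {d : ℤ} (h : WordDeg A l d) :
    WordDeg B (l.map τ) d := by
  induction l generalizing d with
  | nil => exact h
  | cons v l ih =>
    obtain ⟨k, hk, h⟩ := h
    exact ⟨k, hτ k v hk, ih h⟩

theorem HasDegree.circWith {A : GradedSpace V} {B : GradedSpace W} {k k' : ℤ} {f : Op V W}
    {g : Op V V} (hf : HasDegree A B k f) (hg : HasDegree A A k' g) {τ : V → V}
    (hτ : ∀ k v, v ∈ A.part k → τ v ∈ A.part k) : HasDegree A B (k + k') (circWith τ f g) := by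
  rw [hasDegree_iff] at *
  intro l d hd
  unfold AInf.circWith splitSum₃ splitSum
  refine Submodule.sum_mem (B.part _) fun j _ => Submodule.sum_mem (B.part _) fun r _ => ?_
  rw [← List.take_append_drop j l, wordDeg_append] at hd
  obtain ⟨e, he, hd⟩ := hd
  rw [← List.take_append_drop r (l.drop j), wordDeg_append] at hd
  obtain ⟨e', he', hd⟩ := hd
  have := hf (((l.take j).map τ) ++ g ((l.drop j).take r) :: (l.drop j).drop r) (d + k') ?_
  · rwa [show d + (k + k') + 1 = d + k' + k + 1 by ring]
  · refine wordDeg_append.2 ⟨e, he.map hτ, _, hg _ _ he', ?_⟩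
    rwa [show d + k' - e - (e' + k' + 1 - 1) = d - e - e' by ring]

theorem iSup_part_gradedSpace (𝒱 : ℤ → Submodule ℝ V) [DirectSum.Decomposition 𝒱] :
    ⨆ k, (gradedSpace 𝒱).part k = ⊤ :=
  (DirectSum.Decomposition.isInternal 𝒱).submodule_iSup_eq_top

theorem GradedSpace.hom_ext {A : GradedSpace V} (hA : ⨆ k, A.part k = ⊤) {f g : V →ₗ[ℝ] W}
    (h : ∀ k, ∀ v ∈ A.part k, f v = g v) : f = g := by
  have hle : ⨆ k, A.part k ≤ LinearMap.eqLocus f g := iSup_le h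
  exact LinearMap.ext fun v => hle (hA ▸ Submodule.mem_top)

theorem IsMultilinear.ext_homog {A : GradedSpace V} (hA : ⨆ k, A.part k = ⊤) {f g : Op V W}
    (hf : IsMultilinear f) (hg : IsMultilinear g) (h : ∀ l, IsHomog A l → f l = g l) : f = g := by
  have append (z x : List V) (hx : IsHomog A x) : f (x ++ z) = g (x ++ z) := by
    induction z generalizing x with
    | nil => simpa using h x hx
    | cons v z ih =>
      suffices hf.slot x z = hg.slot x z from congr($this v)
      refine A.hom_ext hA fun k v hv => ?_
      simpa [IsMultilinear.slot_apply] using ih (x ++ [v]) fun u hu =>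
        (List.mem_append.1 hu).elim (hx u) fun hu => ⟨k, List.mem_singleton.1 hu ▸ hv⟩
  exact funext fun l => append l [] (by simp [IsHomog])

theorem IsMultilinear.map_sg {A : GradedSpace V} {f : Op V W} (hf : IsMultilinear f)
    {l : List V} {d : ℤ} (hl : WordDeg A l d) : f (l.map A.sg) = (d.negOnePow : ℤ) • f l := by
  induction l generalizing f d with
  | nil => rw [show d = 0 from hl]; simp
  | cons v l ih =>
    obtain ⟨k, hk, hl⟩ := hl
    rw [List.map_cons]
    refine (ih (hf.cons (A.sg v)) hl).trans ?_
    have : f (A.sg v :: l) = ((k - 1).negOnePow : ℤ) • f (v :: l) := by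
      rw [A.sg_apply k v hk]
      exact map_zsmul (hf.slot [] l) _ v
    rw [this, smul_smul, ← Units.val_mul, ← Int.negOnePow_add, sub_add_cancel]

theorem GradedSpace.sg_sg {A : GradedSpace V} (hA : ⨆ k, A.part k = ⊤) (v : V) :
    A.sg (A.sg v) = v := by
  suffices A.sg ∘ₗ A.sg = LinearMap.id from congr($this v)
  refine A.hom_ext hA fun k v hv => ?_
  rw [LinearMap.comp_apply, A.sg_apply k v hv, map_zsmul, A.sg_apply k v hv, smul_smul,
    ← Units.val_mul, Int.units_mul_self, Units.val_one, one_zsmul, LinearMap.id_apply]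

theorem GradedSpace.sg_mem (A : GradedSpace V) {k : ℤ} {v : V} (hv : v ∈ A.part k) :
    A.sg v ∈ A.part k := by
  rw [A.sg_apply k v hv]
  exact zsmul_mem hv _

theorem HasDegree.sg_apply {A : GradedSpace V} (hA : ⨆ k, A.part k = ⊤) {f : Op V V}
    (hf : IsMultilinear f) {k : ℤ} (hk : HasDegree A A k f) (l : List V) :
    A.sg (f l) = (k.negOnePow : ℤ) • f (l.map A.sg) := by
  have h1 : IsMultilinear fun l => A.sg (f l) := hf.comp A.sg
  have h2 : IsMultilinear fun l => (k.negOnePow : ℤ) • f (l.map A.sg) := by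
    intro x z c a b
    simp only [List.map_append, List.map_cons, _root_.map_add, map_smul]
    rw [hf, smul_add, smul_comm]
  refine congrFun (IsMultilinear.ext_homog hA h1 h2 fun l hl => ?_) l
  obtain ⟨d, hd⟩ := hl.exists_wordDeg
  rw [hf.map_sg hd, A.sg_apply _ _ (hasDegree_iff.1 hk l d hd), smul_smul, ← Units.val_mul,
    ← Int.negOnePow_add]
  congr 3
  ring

theorem HasDegree.sg_apply_one {A : GradedSpace V} (hA : ⨆ k, A.part k = ⊤) {f : Op V V}
    (hf : IsMultilinear f) (h1 : HasDegree A A 1 f) (l : List V) :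
    A.sg (f l) = (-1 : ℝ) • f (l.map A.sg) := by
  have h := h1.sg_apply hA hf l
  rw [Int.negOnePow_one, Units.val_neg, Units.val_one, neg_one_smul] at h
  rwa [neg_one_smul]

theorem exists_linearMap_projection (S : Submodule ℝ V) :
    ∃ π : V →ₗ[ℝ] V, (∀ v, π v ∈ S) ∧ ∀ v ∈ S, π v = v := by
  obtain ⟨g, hg⟩ := S.subtype.exists_leftInverse_of_injective S.ker_subtype
  exact ⟨S.subtype ∘ₗ g, fun v => (g v).2, fun v hv => congr((($hg ⟨v, hv⟩ : S) : V))⟩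

theorem IsSmoothOperator.coeffwise_mem {D : (I → I → ℝ) → I → I → ℝ} (hD : IsSmoothOperator D)
    {f : I → I → V} (hf : SmoothOnSquare f) {S : Submodule ℝ V} (h : ∀ s t, f s t ∈ S) (s t : I) :
    coeffwise D f s t ∈ S := by
  obtain ⟨π, hπ, hπS⟩ := exists_linearMap_projection S
  have := hD.coeffwise_map hf π s t
  simp only [hπS _ (h _ _)] at this
  exact this ▸ hπ _

theorem SmoothOnSquare.isSmooth {f : I → I → V} (hf : SmoothOnSquare f) {S : Submodule ℝ V} (s : I)
    (h : ∀ t, f s t ∈ S) : IsSmooth (fun x : I => (x : ℝ)) S (f s) := by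
  obtain ⟨π, hπ, hπS⟩ := exists_linearMap_projection S
  obtain ⟨N, g, w, hg, -, hf⟩ := hf
  refine ⟨N, fun i x => g i (s, x), fun i => π (w i), fun i => (hg i).comp (by fun_prop),
    fun i => hπ _, fun t => ?_⟩
  rw [← hπS _ (h t)]
  simpa using congrArg π (hf (s, t))

theorem HasDegree.pathTerm {A : GradedSpace V} {a : I → I → Op V V} (ha : IsSmoothMultilinear a)
    (hd : ∀ s t, HasDegree A A 0 (a s t)) (i : ℕ) (s t : I) :
    HasDegree A A 0 (pathTerm a i s t) := by
  induction i generalizing s t with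
  | zero =>
    rw [hasDegree_iff]
    intro l d hl
    match l, hl with
    | [], _ => exact Submodule.zero_mem _
    | [u], ⟨k, hk, h⟩ =>
      have h : d - (k - 1) = 0 := h
      rw [show d + 0 + 1 = k by omega]
      exact hk
    | _ :: _ :: _, _ => exact Submodule.zero_mem _
  | succ i ih =>
    rw [hasDegree_iff]
    intro l d hl
    refine isSmoothOperator_primitiveS.coeffwise_mem ((ha.circWith_pathTerm i).smooth l)
      (fun s t => ?_) s t
    exact hasDegree_iff.1 ((ih s t).circWith (hd s t) (τ := id) fun _ _ h => h) l d hl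

theorem HasDegree.pathOp {A : GradedSpace V} {a : I → I → Op V V} (ha : IsSmoothMultilinear a)
    (hd : ∀ s t, HasDegree A A 0 (a s t)) (s t : I) :
    HasDegree A A 0 (pathOp a s t) := fun ks l h =>
  Submodule.sum_mem _ fun i _ => HasDegree.pathTerm ha hd i s t ks l h

theorem isMultilinear_of_multilinearMap {f : Op V W} (h : ∀ n, ∃ M : MultilinearMap ℝ
    (fun _ : Fin n => V) W, ∀ v : Fin n → V, f (List.ofFn v) = M v) : IsMultilinear f := by
  intro x z c a b
  obtain ⟨M, hM⟩ := h (x ++ 0 :: z).length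
  let i : Fin (x ++ 0 :: z).length := ⟨x.length, by simp⟩
  have key : ∀ v, f (x ++ v :: z) = M (Function.update (x ++ 0 :: z).get i v) := by
    intro v
    rw [← hM]
    congr 1
    refine List.ext_getElem (by simp; omega) fun n h1 h2 => ?_
    rw [List.getElem_ofFn, Function.update_apply]
    by_cases hn : n = x.length
    · subst hn
      simp [i]
    · rw [if_neg (by simpa [i, Fin.ext_iff] using hn)]
      rcases lt_or_gt_of_ne hn with hn | hn
      · simp [List.getElem_append_left, hn]
      · simp [List.getElem_append_right, hn.le, List.getElem_cons, Nat.sub_ne_zero_of_lt hn]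
  simp [key]

theorem IsSmoothFamily.isSmoothMultilinear {A : GradedSpace V} {k : ℤ}
    {f : I → I → Op V V} (hf : IsSmoothFamily A k f) : IsSmoothMultilinear f where
  multilinear s t := isMultilinear_of_multilinearMap (hf.multilinear s t)
  smooth l := hf.smooth l

end degrees

/-! ### The values at a point of forms on the interval

A pair `(u, v) : V × V` stands for `u + dt ⊗ v`. -/

section markedSum

variable {α β V W : Type*} [AddCommGroup W]

/-- The sum of `P (p x, q u, r z)` over all `x ++ u :: z = L`, with `p` and `r` applied to the
letters of `x` and `z`. -/
def markedSum (p q r : α → V) (P : Op V W) : List α → W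
  | [] => 0
  | u :: L => P (q u :: L.map r) + markedSum p q r (fun l => P (p u :: l)) L

theorem sum_fin_eq_markedSum (p q r : α → V) (P : Op V W) (L : List α) :
    ∑ i : Fin L.length, P ((L.take i).map p ++ q (L.get i) :: (L.drop (i + 1)).map r) =
      markedSum p q r P L := by
  induction L generalizing P with
  | nil => rfl
  | cons u L ih =>
    rw [markedSum, ← ih]
    exact (Fin.sum_univ_succ _).trans (by simp)

theorem markedSum_map (f : β → α) (p q r : α → V) (P : Op V W) (L : List β) :
    markedSum p q r P (L.map f) = markedSum (p ∘ f) (q ∘ f) (r ∘ f) P L := by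
  induction L generalizing P with
  | nil => rfl
  | cons u L ih => simp [markedSum, ih]

theorem markedSum_linear [Module ℝ W] (p q r : α → V) (c : ℝ) (P P' : Op V W) (L : List α) :
    markedSum p q r (fun l => c • P l + P' l) L =
      c • markedSum p q r P L + markedSum p q r P' L := by
  induction L generalizing P P' with
  | nil => simp [markedSum]
  | cons u L ih =>
    simp only [markedSum, ih, smul_add]
    abel

theorem markedSum_zero (p q r : α → V) (L : List α) :
    markedSum p q r (fun _ => (0 : W)) L = 0 := by
  induction L with
  | nil => rfl
  | cons u L ih => rw [markedSum, ih, zero_add]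

end markedSum

section pairs

variable {V W : Type*} [AddCommGroup V] [Module ℝ V] [AddCommGroup W] [Module ℝ W]

theorem markedSum_eq_zero {α : Type*} (p q r : α → V) {P : Op V W} (hP : IsMultilinear P)
    {L : List α} (h : ∀ u ∈ L, q u = 0) : markedSum p q r P L = 0 := by
  induction L generalizing P with
  | nil => rfl
  | cons u L ih =>
    rw [markedSum, h u (by simp), show P (0 :: L.map r) = 0 from hP.map_zero [] _, zero_add]
    exact ih (hP.cons _) fun v hv => h v (by simp [hv])

/-- The terms of the extension of `P` to forms in which `dt` comes from an argument. -/
def dtTerms (ε : V →ₗ[ℝ] V) (P : Op V W) : Op (V × V) W :=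
  markedSum (fun η => ε η.1) Prod.snd Prod.fst P

variable {ε : V →ₗ[ℝ] V}

theorem IsMultilinear.dtTerms {P : Op V W} (hP : IsMultilinear P) :
    IsMultilinear (dtTerms ε P) := by
  intro x z c a b
  induction x generalizing P with
  | nil =>
    simp only [List.nil_append, AInf.dtTerms, markedSum, Prod.snd_add, Prod.smul_snd, Prod.fst_add,
      Prod.smul_fst, _root_.map_add, map_smul]
    rw [show P ((c • a.2 + b.2) :: z.map Prod.fst) = _ from hP [] _ c _ _,
      show (fun l => P ((c • ε a.1 + ε b.1) :: l)) = fun l => c • P (ε a.1 :: l) + P (ε b.1 :: l)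
        from funext fun l => hP [] l c _ _, markedSum_linear, smul_add]
    simp only [List.nil_append]
    abel
  | cons u x ih =>
    have h1 := ih (hP.cons (ε u.1))
    have h2 := hP (u.2 :: x.map Prod.fst) (z.map Prod.fst) c a.1 b.1
    simp only [AInf.dtTerms, List.cons_append, markedSum, List.map_append, List.map_cons,
      Prod.fst_add, Prod.smul_fst] at h1 h2 ⊢
    rw [h1, h2, smul_add]
    abel

theorem dtTerms_append_dt {P : Op V W} (hP : IsMultilinear P) (x z : List (V × V)) (u : V) :
    dtTerms ε P (x ++ (0, u) :: z) =
      P (x.map (fun η => ε η.1) ++ u :: z.map Prod.fst) := by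
  induction x generalizing P with
  | nil =>
    simp only [List.nil_append, dtTerms, markedSum, map_zero]
    rw [show (fun l => P (0 :: l)) = fun _ => 0 from funext fun l => hP.map_zero [] l,
      markedSum_zero, add_zero]
    rfl
  | cons v x ih =>
    have h1 := ih (hP.cons (ε v.1))
    have h2 := hP.map_zero (v.2 :: x.map Prod.fst) (z.map Prod.fst)
    simp only [dtTerms, List.cons_append, markedSum, List.map_append, List.map_cons] at h1 h2 ⊢
    rw [h1, h2, zero_add]

theorem dtTerms_inl {P : Op V W} (hP : IsMultilinear P) (l : List V) :
    dtTerms ε P (l.map fun v => (v, 0)) = 0 := by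
  refine markedSum_eq_zero _ _ _ hP fun u hu => ?_
  obtain ⟨v, -, rfl⟩ := List.mem_map.1 hu
  rfl

theorem IsSmoothMultilinear.smooth_dtTerms {P : I → I → Op V W} (hP : IsSmoothMultilinear P)
    (L : List (V × V)) : SmoothOnSquare fun s t => dtTerms ε (P s t) L := by
  induction L generalizing P with
  | nil => exact SmoothOnSquare.const 0
  | cons u L ih => exact (hP.smooth _).add (ih (hP.cons (SmoothOnSquare.const (ε u.1))))

/-- The form-linear extension of `P + dt ⊗ Q`, of total degree `k`, to values of forms. -/
def extendPt (A : GradedSpace V) (k : ℤ) (P Q : Op V V) : Op (V × V) (V × V) := fun L =>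
  (P (L.map Prod.fst), Q (L.map Prod.fst) + (k.negOnePow : ℤ) • dtTerms A.sg P L)

/-- Multiplication by `dt` from the left. -/
def dtMul : V × V →ₗ[ℝ] V × V := LinearMap.inr ℝ V V ∘ₗ LinearMap.fst ℝ V V

@[simp] theorem dtMul_apply (u : V × V) : dtMul u = (0, u.1) := rfl

/-- The sign of the shifted degree. -/
def sgPair (ε : V →ₗ[ℝ] V) : V × V →ₗ[ℝ] V × V := LinearMap.prodMap ε (-ε)

@[simp] theorem sgPair_apply (u : V × V) : sgPair ε u = (ε u.1, - ε u.2) := rfl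

/-- The graded space of values of forms. -/
def pairs (A : GradedSpace V) : GradedSpace (V × V) where
  part k := (A.part k).prod (A.part (k - 1))
  sg := sgPair A.sg
  sg_apply := by
    rintro k ⟨u, v⟩ ⟨hu, hv⟩
    have h2 := A.sg_apply (k - 1) v hv
    rw [Int.negOnePow_sub _ 1] at h2
    simp [A.sg_apply k u hu, h2]
  test := Set.univ
  test_separates := separates_univ

theorem iSup_part_pairs {A : GradedSpace V} (hA : ⨆ k, A.part k = ⊤) :
    ⨆ k, (pairs A).part k = ⊤ := by
  rw [eq_top_iff, ← LinearMap.sup_range_inl_inr, LinearMap.range_eq_map, LinearMap.range_eq_map,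
    ← hA, Submodule.map_iSup, Submodule.map_iSup]
  refine sup_le (iSup_le fun k => ?_) (iSup_le fun k => ?_)
  · refine le_iSup_of_le k (Submodule.map_le_iff_le_comap.2 fun v hv => ?_)
    exact ⟨hv, Submodule.zero_mem _⟩
  · refine le_iSup_of_le (k + 1) (Submodule.map_le_iff_le_comap.2 fun v hv => ?_)
    exact ⟨Submodule.zero_mem _, by simpa using hv⟩

section extendPt

variable {A : GradedSpace V} {k : ℤ} {P Q : Op V V}

theorem IsMultilinear.map_fst {P : Op V W} (hP : IsMultilinear P) :
    IsMultilinear fun L : List (V × V) => P (L.map Prod.fst) := by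
  intro x z c a b
  simpa using hP (x.map Prod.fst) (z.map Prod.fst) c a.1 b.1

theorem isMultilinear_extendPt (hP : IsMultilinear P) (hQ : IsMultilinear Q) :
    IsMultilinear (extendPt A k P Q) := by
  intro x z c a b
  have h1 := hP.map_fst x z c a b
  have h2 := hQ.map_fst x z c a b
  have h3 := hP.dtTerms (ε := A.sg) x z c a b
  simp only at h1 h2
  refine Prod.ext ?_ ?_
  · exact h1
  · simp only [extendPt, h2, h3, Prod.snd_add, Prod.smul_snd, smul_add]
    rw [smul_comm c]
    abel

theorem isTwistedLinear_extendPt (hP : IsMultilinear P) (hQ : IsMultilinear Q) :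
    IsTwistedLinear (sgPair A.sg) dtMul ((k.negOnePow : ℤ) : ℝ) (extendPt A k P Q) := by
  intro x u z
  have h1 := hP.map_zero (x.map Prod.fst) (z.map Prod.fst)
  have h2 := hQ.map_zero (x.map Prod.fst) (z.map Prod.fst)
  refine Prod.ext ?_ ?_
  · simp [extendPt, h1]
  · simp only [extendPt, dtMul_apply, List.map_append, List.map_cons, h2, zero_add,
      dtTerms_append_dt hP, Prod.smul_snd, Int.cast_smul_eq_zsmul]
    simp [Function.comp_def]

theorem extendPt_inl (hP : IsMultilinear P) (l : List V) :
    extendPt A k P Q (l.map fun v => (v, 0)) = (P l, Q l) := by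
  simp [extendPt, dtTerms_inl hP, Function.comp_def]

theorem isSmoothMultilinear_extendPt {P Q : I → I → Op V V} (hP : IsSmoothMultilinear P)
    (hQ : IsSmoothMultilinear Q) : IsSmoothMultilinear fun s t => extendPt A k (P s t) (Q s t) where
  multilinear s t := isMultilinear_extendPt (hP.multilinear s t) (hQ.multilinear s t)
  smooth L := by
    refine (hP.smooth _).prodMk ((hQ.smooth _).add ?_)
    simp only [← Int.cast_smul_eq_zsmul ℝ]
    exact (hP.smooth_dtTerms L).smul _

theorem dtTerms_mem {A : GradedSpace V} {k : ℤ} {P : Op V V} (hP : HasDegree A A k P)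
    {L : List (V × V)} {d : ℤ} (h : WordDeg (pairs A) L d) :
    dtTerms A.sg P L ∈ A.part (d + k) := by
  induction L generalizing P k d with
  | nil => exact Submodule.zero_mem _
  | cons u L ih =>
    obtain ⟨i, hi, h⟩ := h
    refine Submodule.add_mem _ ?_ ?_
    · have := hasDegree_iff.1 hP (u.2 :: L.map Prod.fst) (d - 1)
        ⟨i - 1, hi.2, by
          have := WordDeg.map (A := pairs A) (B := A) (τ := Prod.fst) (fun k v hv => hv.1) h
          rwa [show d - 1 - (i - 1 - 1) = d - (i - 1) by ring]⟩
      rwa [show d - 1 + k + 1 = d + k by ring] at this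
    · have hP' : HasDegree A A (k + (i - 1)) fun l => P (A.sg u.1 :: l) := by
        rw [hasDegree_iff] at hP ⊢
        intro l e he
        have := hP (A.sg u.1 :: l) (e + (i - 1)) ⟨i, A.sg_mem hi.1, by simpa using he⟩
        rwa [show e + (i - 1) + k + 1 = e + (k + (i - 1)) + 1 by ring] at this
      have := ih hP' h
      rwa [show d - (i - 1) + (k + (i - 1)) = d + k by ring] at this

theorem hasDegree_extendPt (hP : HasDegree A A k P) (hQ : HasDegree A A (k - 1) Q) :
    HasDegree (pairs A) (pairs A) k (extendPt A k P Q) := by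
  rw [hasDegree_iff]
  intro L d h
  have h' := WordDeg.map (A := pairs A) (B := A) (τ := Prod.fst) (fun k v hv => hv.1) h
  refine ⟨hasDegree_iff.1 hP _ d h', Submodule.add_mem _ ?_ (zsmul_mem ?_ _)⟩
  · have := hasDegree_iff.1 hQ _ d h'
    rwa [show d + (k - 1) + 1 = d + k + 1 - 1 by ring] at this
  · have := dtTerms_mem hP h
    rwa [show d + k = d + k + 1 - 1 by ring] at this

end extendPt

theorem IsTwistedLinear.ext_dtMul {τ : V × V →ₗ[ℝ] V × V} (hτ : ∀ v, τ (v, 0) = (ε v, 0)) {c : ℝ}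
    {Φ Ψ : Op (V × V) (V × V)} (mΦ : IsMultilinear Φ) (mΨ : IsMultilinear Ψ)
    (hΦ : IsTwistedLinear τ dtMul c Φ) (hΨ : IsTwistedLinear τ dtMul c Ψ)
    (h : ∀ l : List V, Φ (l.map fun v => (v, 0)) = Ψ (l.map fun v => (v, 0))) : Φ = Ψ := by
  have append (L : List (V × V)) (x : List V) :
      Φ (x.map (fun v => (v, 0)) ++ L) = Ψ (x.map (fun v => (v, 0)) ++ L) := by
    induction L generalizing x with
    | nil => simpa using h x
    | cons u L ih =>
      have hu : u = (u.1, 0) + dtMul (u.2, 0) := by simp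
      have hfst := ih (x ++ [u.1])
      have hsnd := ih (x.map ε ++ [u.2])
      rw [hu, mΦ.map_add, mΨ.map_add, hΦ, hΨ]
      simp only [List.map_append, List.map_cons, List.map_nil, List.append_assoc,
        List.cons_append, List.nil_append, List.map_map] at hfst hsnd ⊢
      rw [hfst, show (⇑τ ∘ fun v : V => (v, (0 : V))) = (fun v => (v, 0)) ∘ ⇑ε from
        funext hτ, hsnd]
  exact funext fun L => append L []

section composition

variable {A : GradedSpace V} {k k' : ℤ} {P Q P' Q' : Op V V} {τ : V × V → V × V} {τ' : V → V}

theorem extendPt_insert_extendPt_inl (hP : IsMultilinear P) (hQ : IsMultilinear Q)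
    (hP' : IsMultilinear P') (hτ : ∀ v, τ (v, 0) = (τ' v, 0)) (x y z : List V) :
    extendPt A k P Q ((x.map fun v => (v, (0 : V))).map τ ++
      extendPt A k' P' Q' (y.map fun v => (v, 0)) :: z.map fun v => (v, 0)) =
      (P (x.map τ' ++ P' y :: z), Q (x.map τ' ++ P' y :: z) + (k.negOnePow : ℤ) •
        P (x.map (fun v => A.sg (τ' v)) ++ Q' y :: z)) := by
  have hinner : extendPt A k' P' Q' (y.map fun v => (v, 0)) = (P' y, 0) + dtMul (Q' y, 0) := by
    rw [extendPt_inl hP']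
    simp
  have hmap : (x.map fun v => (v, (0 : V))).map τ = (x.map τ').map fun v => (v, 0) := by simp [hτ]
  have hsign : ((x.map τ').map fun v => (v, (0 : V))).map (sgPair A.sg) =
      (x.map fun v => A.sg (τ' v)).map fun v => (v, 0) := by simp
  have hfst := extendPt_inl (A := A) (k := k) (Q := Q) hP (x.map τ' ++ P' y :: z)
  have hsnd := extendPt_inl (A := A) (k := k) (Q := Q) hP
    (x.map (fun v => A.sg (τ' v)) ++ Q' y :: z)
  rw [List.map_append, List.map_cons] at hfst hsnd
  rw [hinner, hmap, (isMultilinear_extendPt hP hQ).map_add, isTwistedLinear_extendPt hP hQ, hsign,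
    hfst, hsnd, Int.cast_smul_eq_zsmul]
  simp

theorem circWith_extendPt_inl (hP : IsMultilinear P) (hQ : IsMultilinear Q)
    (hP' : IsMultilinear P') (hτ : ∀ v, τ (v, 0) = (τ' v, 0)) (l : List V) :
    circWith τ (extendPt A k P Q) (extendPt A k' P' Q') (l.map fun v => (v, 0)) =
      (circWith τ' P P' l,
        circWith τ' Q P' l + (k.negOnePow : ℤ) • circWith (fun v => A.sg (τ' v)) P Q' l) := by
  rw [circWith, splitSum₃_map]
  simp only [extendPt_insert_extendPt_inl hP hQ hP' hτ]
  refine Prod.ext (map_splitSum₃ (LinearMap.fst ℝ V V) _ l)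
    ((map_splitSum₃ (LinearMap.snd ℝ V V) _ l).trans ?_)
  simp only [LinearMap.snd_apply, splitSum₃_add, ← Int.cast_smul_eq_zsmul ℝ, splitSum₃_smul]
  rfl

end composition

end pairs

/-! ### The Maurer–Cartan equation at a point -/

section linearity

variable {V W : Type*} [AddCommGroup V] [Module ℝ V] [AddCommGroup W] [Module ℝ W]

theorem IsMultilinear.neg {f : Op V W} (hf : IsMultilinear f) : IsMultilinear fun l => -f l :=
  hf.comp (-LinearMap.id)

namespace IsTwistedLinear

variable {ε E : V →ₗ[ℝ] V} {c : ℝ} {Φ Ψ : Op V V}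

theorem add (hΦ : IsTwistedLinear ε E c Φ) (hΨ : IsTwistedLinear ε E c Ψ) :
    IsTwistedLinear ε E c fun l => Φ l + Ψ l := by
  intro x u z
  simp only [hΦ x u z, hΨ x u z, map_add, smul_add]

theorem neg (hΦ : IsTwistedLinear ε E c Φ) : IsTwistedLinear ε E c fun l => -Φ l := by
  intro x u z
  simp only [hΦ x u z, map_neg, smul_neg]

theorem comp_left (hΦ : IsTwistedLinear ε E c Φ) (hE : ∀ u, E (E u) = 0) (c' : ℝ) :
    IsTwistedLinear ε E c' fun l => E (Φ l) := by
  intro x u z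
  simp only [hΦ.map_eq_zero hE, hE, smul_zero]

theorem opCoeffwise {D : (I → I → ℝ) → I → I → ℝ} (hD : IsSmoothOperator D)
    {Φ : I → I → Op V V} (hs : IsSmoothMultilinear Φ) (hΦ : ∀ s t, IsTwistedLinear ε E c (Φ s t))
    (s t : I) : IsTwistedLinear ε E c (opCoeffwise D Φ s t) := by
  intro x u z
  simp only [AInf.opCoeffwise, fun s t => hΦ s t x u z]
  exact hD.coeffwise_map (hs.smooth _) (c • E) s t

end IsTwistedLinear

end linearity

namespace SqForm

variable {V : Type*} [AddCommGroup V] [Module ℝ V] {A : GradedSpace V} {α : SqForm V}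

/-- The value at `(s, t)` of `α̂⁰ - d`, acting on values of forms. -/
def collapse0Pt (A : GradedSpace V) (α : SqForm V) (s t : I) : Op (V × V) (V × V) :=
  extendPt A 1 (α.c0 s t) (α.ct s t)

/-- The value at `(s, t)` of the coefficient of `ds` in `α̂¹`, acting on values of forms. -/
def collapse1Pt (A : GradedSpace V) (α : SqForm V) (s t : I) : Op (V × V) (V × V) :=
  extendPt A 0 (α.cs s t) (α.cst s t)

namespace IsForm

theorem isSmoothMultilinear_collapse0Pt (hα : α.IsForm A 1) :
    IsSmoothMultilinear (collapse0Pt A α) :=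
  isSmoothMultilinear_extendPt hα.h0.isSmoothMultilinear hα.ht.isSmoothMultilinear

theorem isSmoothMultilinear_collapse1Pt (hα : α.IsForm A 1) :
    IsSmoothMultilinear (collapse1Pt A α) :=
  isSmoothMultilinear_extendPt hα.hs.isSmoothMultilinear hα.hst.isSmoothMultilinear

theorem hasDegree_collapse0Pt (hα : α.IsForm A 1) (s t : I) :
    HasDegree (pairs A) (pairs A) 1 (collapse0Pt A α s t) :=
  hasDegree_extendPt (hα.h0.degree s t) (hα.ht.degree s t)

theorem hasDegree_collapse1Pt (hα : α.IsForm A 1) (s t : I) :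
    HasDegree (pairs A) (pairs A) 0 (collapse1Pt A α s t) :=
  hasDegree_extendPt (hα.hs.degree s t) (hα.hst.degree s t)

theorem isTwistedLinear_collapse0Pt (hα : α.IsForm A 1) (s t : I) :
    IsTwistedLinear (sgPair A.sg) dtMul (-1) (collapse0Pt A α s t) := by
  simpa [collapse0Pt] using isTwistedLinear_extendPt (A := A) (k := 1)
    (hα.h0.isSmoothMultilinear.multilinear s t) (hα.ht.isSmoothMultilinear.multilinear s t)

theorem isTwistedLinear_collapse1Pt (hα : α.IsForm A 1) (s t : I) :
    IsTwistedLinear (sgPair A.sg) dtMul 1 (collapse1Pt A α s t) := by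
  simpa [collapse1Pt] using isTwistedLinear_extendPt (A := A) (k := 0)
    (hα.hs.isSmoothMultilinear.multilinear s t) (hα.hst.isSmoothMultilinear.multilinear s t)

theorem sgPair_collapse0Pt (hA : ⨆ k, A.part k = ⊤) (hα : α.IsForm A 1) (s t : I)
    (l : List (V × V)) : sgPair A.sg (collapse0Pt A α s t l) =
      (-1 : ℝ) • collapse0Pt A α s t (l.map (sgPair A.sg)) :=
  (hα.hasDegree_collapse0Pt s t).sg_apply_one (iSup_part_pairs hA)
    (hα.isSmoothMultilinear_collapse0Pt.multilinear s t) l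

theorem sgPair_collapse1Pt (hA : ⨆ k, A.part k = ⊤) (hα : α.IsForm A 1) (s t : I)
    (l : List (V × V)) :
    sgPair A.sg (collapse1Pt A α s t l) = collapse1Pt A α s t (l.map (sgPair A.sg)) := by
  have h := (hα.hasDegree_collapse1Pt s t).sg_apply (iSup_part_pairs hA)
    (hα.isSmoothMultilinear_collapse1Pt.multilinear s t) l
  rwa [Int.negOnePow_zero, Units.val_one, one_smul] at h

theorem isNilpotentFamily_collapse1Pt (hA : ⨆ k, A.part k = ⊤) (hα : α.IsForm A 1)
    (h0 : α.Uncurved) (h1 : ∀ s t v, α.cs s t [v] = 0) :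
    IsNilpotentFamily (sgPair A.sg) dtMul (collapse1Pt A α) where
  sq u := by simp [A.sg_sg hA]
  E_sq _ := by simp
  smooth := hα.isSmoothMultilinear_collapse1Pt
  comm := hα.sgPair_collapse1Pt hA
  twistedLinear := hα.isTwistedLinear_collapse1Pt
  nil s t := by simp [collapse1Pt, extendPt, dtTerms, markedSum, (h0 s t).2.1, (h0 s t).2.2.2]
  unary s t u := ⟨(α.cst s t [u.1], 0), by
    simp [collapse1Pt, extendPt, dtTerms, markedSum, h1 s t _]⟩

theorem isTwistedLinear_circWith_collapse0Pt_collapse1Pt (hA : ⨆ k, A.part k = ⊤)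
    (hα : α.IsForm A 1) (s t : I) : IsTwistedLinear (sgPair A.sg) dtMul (-1)
      (circWith id (collapse0Pt A α s t) (collapse1Pt A α s t)) := by
  have h := (hα.isTwistedLinear_collapse0Pt s t).circWith (hα.isTwistedLinear_collapse1Pt s t)
    (τ := LinearMap.id) (hα.isSmoothMultilinear_collapse0Pt.multilinear s t)
    (by simpa using hα.sgPair_collapse1Pt hA s t) (by simp) (by simp)
  rwa [mul_one] at h

theorem isTwistedLinear_circWith_collapse1Pt_collapse0Pt (hA : ⨆ k, A.part k = ⊤)
    (hα : α.IsForm A 1) (s t : I) : IsTwistedLinear (sgPair A.sg) dtMul (-1)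
      (circWith (sgPair A.sg) (collapse1Pt A α s t) (collapse0Pt A α s t)) := by
  have h := (hα.isTwistedLinear_collapse1Pt s t).circWith (hα.isTwistedLinear_collapse0Pt s t)
    (τ := sgPair A.sg) (hα.isSmoothMultilinear_collapse1Pt.multilinear s t)
    (hα.sgPair_collapse0Pt hA s t) (by simp) (by simp)
  rwa [one_mul] at h

variable {D : (I → I → ℝ) → I → I → ℝ}

theorem opCoeffwise_collapse0Pt_inl (hD : IsSmoothOperator D) (hα : α.IsForm A 1) (s t : I)
    (l : List V) : opCoeffwise D (collapse0Pt A α) s t (l.map fun v => (v, 0)) =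
      (opCoeffwise D α.c0 s t l, opCoeffwise D α.ct s t l) := by
  have h (s t : I) : collapse0Pt A α s t (l.map fun v => (v, 0)) = (α.c0 s t l, α.ct s t l) :=
    extendPt_inl (hα.h0.isSmoothMultilinear.multilinear s t) l
  simp only [opCoeffwise, h]
  exact hD.coeffwise_prodMk (hα.h0.isSmoothMultilinear.smooth l)
    (hα.ht.isSmoothMultilinear.smooth l) s t

theorem opCoeffwise_collapse1Pt_inl (hD : IsSmoothOperator D) (hα : α.IsForm A 1) (s t : I)
    (l : List V) : opCoeffwise D (collapse1Pt A α) s t (l.map fun v => (v, 0)) =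
      (opCoeffwise D α.cs s t l, opCoeffwise D α.cst s t l) := by
  have h (s t : I) : collapse1Pt A α s t (l.map fun v => (v, 0)) = (α.cs s t l, α.cst s t l) :=
    extendPt_inl (hα.hs.isSmoothMultilinear.multilinear s t) l
  simp only [opCoeffwise, h]
  exact hD.coeffwise_prodMk (hα.hs.isSmoothMultilinear.smooth l)
    (hα.hst.isSmoothMultilinear.smooth l) s t

end IsForm

namespace IsMC

theorem circWith_c0_c0 (hα : α.IsMC A) (s t : I) (l : List V) :
    circWith A.sg (α.c0 s t) (α.c0 s t) l = 0 := by
  have h := hα.eq0 s t l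
  simp only [SqForm.d, SqForm.bracket, gerst, circ_one] at h
  rw [zero_add, mul_one, Int.negOnePow_one, Units.val_neg, Units.val_one, neg_one_smul,
    sub_neg_eq_add, ← two_smul ℝ, smul_smul] at h
  simpa using h

theorem opCoeffwise_derivS_c0 (hα : α.IsMC A) (s t : I) (l : List V) :
    opCoeffwise derivS α.c0 s t l =
      circWith id (α.c0 s t) (α.cs s t) l - circWith A.sg (α.cs s t) (α.c0 s t) l := by
  have h := hα.eqs s t l
  simp only [SqForm.d, SqForm.bracket, gerst, circ_one, sub_self, circ_zero, mul_one, mul_zero,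
    Int.negOnePow_zero, Int.negOnePow_one, Units.val_one, Units.val_neg, one_smul, neg_smul] at h
  rw [← sub_eq_zero, ← h,
    show opCoeffwise derivS α.c0 s t l = vderiv (fun s' => α.c0 s' t l) s from rfl]
  module

theorem opCoeffwise_derivS_ct (hα : α.IsMC A) (s t : I) (l : List V) :
    opCoeffwise derivS α.ct s t l = opCoeffwise derivT α.cs s t l +
      circWith id (α.ct s t) (α.cs s t) l - circWith id (α.cs s t) (α.ct s t) l -
      circWith A.sg (α.cst s t) (α.c0 s t) l - circWith A.sg (α.c0 s t) (α.cst s t) l := by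
  have h := hα.eqst s t l
  simp only [SqForm.d, SqForm.bracket, gerst, circ_one, sub_self, circ_zero, mul_one,
    mul_zero, Int.negOnePow_zero, Int.negOnePow_one, Units.val_one, Units.val_neg, one_smul,
    neg_smul, show (1 : ℤ) - 2 = -1 by norm_num, circ_neg_one, one_mul, Int.negOnePow_neg] at h
  rw [← sub_eq_zero, ← h,
    show opCoeffwise derivS α.ct s t l = vderiv (fun s' => α.ct s' t l) s from rfl,
    show opCoeffwise derivT α.cs s t l = vderiv (fun t' => α.cs s t' l) t from rfl]
  module

theorem opCoeffwise_derivS_collapse0Pt_inl (hA : ⨆ k, A.part k = ⊤) (hα : α.IsMC A) (s t : I)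
    (l : List V) : opCoeffwise derivS (collapse0Pt A α) s t (l.map fun v => (v, 0)) =
      circWith id (collapse0Pt A α s t) (collapse1Pt A α s t) (l.map fun v => (v, 0)) +
        (-circWith (sgPair A.sg) (collapse1Pt A α s t) (collapse0Pt A α s t)
            (l.map fun v => (v, 0)) +
          dtMul (opCoeffwise derivT (collapse1Pt A α) s t (l.map fun v => (v, 0)))) := by
  have hf := hα.isForm
  have h0 := hf.h0.isSmoothMultilinear.multilinear s t
  have hs := hf.hs.isSmoothMultilinear.multilinear s t
  have ht := hf.ht.isSmoothMultilinear.multilinear s t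
  have hst := hf.hst.isSmoothMultilinear.multilinear s t
  have compMA : circWith id (collapse0Pt A α s t) (collapse1Pt A α s t) _ = _ :=
    circWith_extendPt_inl (τ' := id) h0 ht hs (fun _ => rfl) l
  have compAM : circWith (sgPair A.sg) (collapse1Pt A α s t) (collapse0Pt A α s t) _ = _ :=
    circWith_extendPt_inl (τ' := A.sg) hs hst h0 (by simp) l
  rw [hf.opCoeffwise_collapse0Pt_inl isSmoothDerivation_derivS.toIsSmoothOperator,
    hf.opCoeffwise_collapse1Pt_inl isSmoothDerivation_derivT.toIsSmoothOperator,
    compMA, compAM, hα.opCoeffwise_derivS_c0, hα.opCoeffwise_derivS_ct,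
    show (fun v => A.sg (A.sg v)) = id from funext (A.sg_sg hA)]
  ext <;> simp <;> abel

theorem opCoeffwise_derivS_collapse0Pt (hA : ⨆ k, A.part k = ⊤) (hα : α.IsMC A) (s t : I) :
    opCoeffwise derivS (collapse0Pt A α) s t = fun l =>
      circWith id (collapse0Pt A α s t) (collapse1Pt A α s t) l +
        (-circWith (sgPair A.sg) (collapse1Pt A α s t) (collapse0Pt A α s t) l +
          dtMul (opCoeffwise derivT (collapse1Pt A α) s t l)) := by
  have hS := isSmoothDerivation_derivS.toIsSmoothOperator
  have hT := isSmoothDerivation_derivT.toIsSmoothOperator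
  have hf := hα.isForm
  have hM := hf.isSmoothMultilinear_collapse0Pt
  have hB := hf.isSmoothMultilinear_collapse1Pt
  have hMB : IsMultilinear (circWith id (collapse0Pt A α s t) (collapse1Pt A α s t)) :=
    (hM.multilinear s t).circWith (hB.multilinear s t) LinearMap.id
  have hBM := (hB.multilinear s t).circWith (hM.multilinear s t) (sgPair A.sg)
  have hTB := hT.isSmoothMultilinear_opCoeffwise hB
  have linTB := IsTwistedLinear.opCoeffwise hT hB hf.isTwistedLinear_collapse1Pt s t
  exact IsTwistedLinear.ext_dtMul (τ := sgPair A.sg) (ε := A.sg) (by simp)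
    ((hS.isSmoothMultilinear_opCoeffwise hM).multilinear s t)
    (hMB.add (hBM.neg.add ((hTB.multilinear s t).comp dtMul)))
    (IsTwistedLinear.opCoeffwise hS hM hf.isTwistedLinear_collapse0Pt s t)
    ((hf.isTwistedLinear_circWith_collapse0Pt_collapse1Pt hA s t).add
      ((hf.isTwistedLinear_circWith_collapse1Pt_collapse0Pt hA s t).neg.add
        (linTB.comp_left (by simp) _)))
    (hα.opCoeffwise_derivS_collapse0Pt_inl hA s t)

end IsMC

end SqForm

/-! ### The morphism equation at a point -/

section weight

variable {V : Type*} [AddCommGroup V]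

/-- The filtration by powers of `dt`: it is `0` on zero, `1` on nonzero multiples of `dt`, and `2`
elsewhere. -/
def dtWeight (u : V × V) : ℕ := by
  classical exact if u = 0 then 0 else if u.1 = 0 then 1 else 2

theorem dtWeight_le_two (u : V × V) : dtWeight u ≤ 2 := by
  unfold dtWeight
  split_ifs <;> omega

theorem dtWeight_pos {u : V × V} (h : u ≠ 0) : 1 ≤ dtWeight u := by
  unfold dtWeight
  split_ifs <;> simp_all

variable [Module ℝ V]

theorem dtWeight_dtMul_le_one (u : V × V) : dtWeight (dtMul u) ≤ 1 := by
  unfold dtWeight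
  split_ifs <;> simp_all

theorem exists_eq_dtMul_of_dtWeight {u : V × V} (h : dtWeight u ≤ 1) : ∃ v, u = dtMul v := by
  refine ⟨(u.2, 0), Prod.ext ?_ rfl⟩
  unfold dtWeight at h
  split_ifs at h with h0 h1
  · simp [h0]
  · exact h1
  · omega

theorem IsNilpotentFamily.lowersWeight_dtWeight {a : I → I → Op (V × V) (V × V)}
    {ε : V × V →ₗ[ℝ] V × V} (ha : IsNilpotentFamily ε dtMul a) (s t : I) :
    LowersWeight dtWeight (a s t) := by
  intro y hy
  have apply_dtMul (u : V × V) (l : List (V × V)) :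
      a s t (dtMul u :: l) = dtMul (a s t (u :: l)) := by
    simpa using ha.twistedLinear s t [] u l
  match y, hy with
  | [], _ => exact Or.inl (ha.nil s t)
  | [u], hy =>
    obtain ⟨w, hw⟩ := ha.unary s t u
    by_cases hu : dtWeight u ≤ 1
    · obtain ⟨v, rfl⟩ := exists_eq_dtMul_of_dtWeight hu
      obtain ⟨w, hw⟩ := ha.unary s t v
      exact Or.inl (by rw [apply_dtMul, hw, ha.E_sq])
    · right
      have := dtWeight_dtMul_le_one w
      simp only [hw, List.map_cons, List.map_nil, List.sum_cons, List.sum_nil]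
      omega
  | u :: v :: y, hy =>
    have hu : 1 ≤ dtWeight u := dtWeight_pos (by rintro rfl; simp at hy)
    have hv : 1 ≤ dtWeight v := dtWeight_pos (by rintro rfl; simp at hy)
    by_cases huv : dtWeight u ≤ 1 ∧ dtWeight v ≤ 1
    · obtain ⟨u, rfl⟩ := exists_eq_dtMul_of_dtWeight huv.1
      obtain ⟨v, rfl⟩ := exists_eq_dtMul_of_dtWeight huv.2
      left
      rw [apply_dtMul]
      exact (ha.twistedLinear s t).map_eq_zero ha.E_sq [u] v y
    · right
      have := dtWeight_le_two (a s t (u :: v :: y))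
      simp only [List.map_cons, List.sum_cons]
      omega

end weight

theorem SqForm.IsMC.blockComp_pathOp {V : Type*} [AddCommGroup V] [Module ℝ V] {A : GradedSpace V}
    {α : SqForm V} (hA : ⨆ k, A.part k = ⊤) (hα : α.IsMC A) (h0 : α.Uncurved)
    (h1 : ∀ s t v, α.cs s t [v] = 0) (s t : I) (l : List (V × V)) :
    blockComp (α.collapse0Pt A 1 t) (pathOp (α.collapse1Pt A) s t) l +
        dtMul (opCoeffwise derivT (pathOp (α.collapse1Pt A)) s t l) =
      circWith (sgPair A.sg) (pathOp (α.collapse1Pt A) s t) (α.collapse0Pt A s t) l := by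
  have ha := hα.isForm.isNilpotentFamily_collapse1Pt hA h0 h1
  exact ha.blockComp_pathOp hα.isForm.isSmoothMultilinear_collapse0Pt
    (fun s t l => congrFun (hα.opCoeffwise_derivS_collapse0Pt hA s t) l)
    ha.lowersWeight_dtWeight s t l

/-! ### Operators on forms and their values at points -/

section forms

variable {V : Type*} [AddCommGroup V] [Module ℝ V]

/-- The value at `t` of a form on the interval. -/
def evalAt (t : I) : Pre V →ₗ[ℝ] V × V where
  toFun η := (η.1 t, η.2 t)
  map_add' _ _ := rfl
  map_smul' _ _ := rfl

theorem evalAt_apply (t : I) (η : Pre V) : evalAt t η = (η.1 t, η.2 t) := rfl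

theorem evalAt_ext {η θ : Pre V} (h : ∀ t, evalAt t η = evalAt t θ) : η = θ :=
  Prod.ext (funext fun t => congrArg Prod.fst (h t)) (funext fun t => congrArg Prod.snd (h t))

/-- The values of `Φ` at `t` depend only on the values at `t` of its arguments, through `F t`: this
is linearity over functions, as opposed to the de Rham differential. -/
def IsPointwise (Φ : Op (Pre V) (Pre V)) (F : I → Op (V × V) (V × V)) : Prop :=
  ∀ t L, evalAt t (Φ L) = F t (L.map (evalAt t))

variable {A : GradedSpace V}

theorem evalAt_mem {k : ℤ} {η : Pre V} (h : η ∈ (forms A).part k) (t : I) :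
    evalAt t η ∈ (pairs A).part k := by
  have mem {S : Submodule ℝ V} {f : I → V} (hf : IsSmooth (fun x : I => (x : ℝ)) S f) :
      f t ∈ S := by
    obtain ⟨N, g, w, -, hw, hf⟩ := hf
    exact hf t ▸ Submodule.sum_mem _ fun i _ => Submodule.smul_mem _ _ (hw i)
  exact ⟨mem h.1, mem h.2⟩

theorem smoothOnSquare_evalAt {k : ℤ} {η : Pre V} (h : η ∈ (forms A).part k) :
    SmoothOnSquare fun _ t => evalAt t η := by
  have smooth {S : Submodule ℝ V} {f : I → V} (hf : IsSmooth (fun x : I => (x : ℝ)) S f) :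
      SmoothOnSquare fun _ t => f t := by
    obtain ⟨N, g, w, hg, -, hf⟩ := hf
    exact ⟨N, fun i x => g i x.2, w, fun i => (hg i).comp contDiff_snd, fun _ => trivial,
      fun x => hf x.2⟩
  exact (smooth h.1).prodMk (smooth h.2)

theorem IsHomog.smoothOnSquare_evalAt {L : List (Pre V)} (hL : IsHomog (forms A) L) :
    ∀ u ∈ L.map fun η (_ : I) t => evalAt t η, SmoothOnSquare u := by
  intro u hu
  obtain ⟨η, hη, rfl⟩ := List.mem_map.1 hu
  obtain ⟨k, hk⟩ := hL η hη
  exact AInf.smoothOnSquare_evalAt hk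

theorem IsSmoothMultilinear.smooth_evalAt {F : I → I → Op (V × V) (V × V)}
    (hF : IsSmoothMultilinear F) {L : List (Pre V)} (hL : IsHomog (forms A) L) :
    SmoothOnSquare fun s t => F s t (L.map (evalAt t)) := by
  simpa [Function.comp_def] using hF.smooth_apply _ hL.smoothOnSquare_evalAt

theorem WordDeg.isHomog {l : List V} {d : ℤ} (h : WordDeg A l d) : IsHomog A l := by
  induction l generalizing d with
  | nil => simp [IsHomog]
  | cons v l ih =>
    obtain ⟨k, hk, h⟩ := h
    exact List.forall_mem_cons.2 ⟨⟨k, hk⟩, ih h⟩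

theorem isPointwise_extend (k : ℤ) (P Q : I → Op V V) :
    IsPointwise (extend A k P Q) fun t => extendPt A k (P t) (Q t) := by
  intro t L
  have h := sum_fin_eq_markedSum (fun η : Pre V => A.sg (η.1 t)) (fun η => η.2 t)
    (fun η => η.1 t) (P t) L
  simp only [evalAt_apply, extend, extendPt, dtTerms, markedSum_map, h, List.map_map]
  rfl

namespace IsPointwise

variable {Φ Ψ : Op (Pre V) (Pre V)} {F G : I → Op (V × V) (V × V)}

theorem isMultilinear (hΦ : IsPointwise Φ F) (hF : ∀ t, IsMultilinear (F t)) :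
    IsMultilinear Φ := by
  intro x z c a b
  refine evalAt_ext fun t => ?_
  simpa [hΦ t] using hF t (x.map (evalAt t)) (z.map (evalAt t)) c (evalAt t a) (evalAt t b)

theorem hasDegree {F : I → I → Op (V × V) (V × V)} {s : I} (hΦ : IsPointwise Φ (F s))
    (hF : IsSmoothMultilinear F) {k : ℤ} (hd : ∀ t, HasDegree (pairs A) (pairs A) k (F s t)) :
    HasDegree (forms A) (forms A) k Φ := by
  rw [hasDegree_iff]
  intro L d hL
  have smooth : SmoothOnSquare fun s t => F s t (L.map (evalAt t)) := hF.smooth_evalAt hL.isHomog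
  have mem (t : I) : F s t (L.map (evalAt t)) ∈ (pairs A).part (d + k + 1) :=
    hasDegree_iff.1 (hd t) _ d (hL.map fun k η hη => evalAt_mem hη t)
  rw [show Φ L = (fun t => (F s t (L.map (evalAt t))).1, fun t => (F s t (L.map (evalAt t))).2)
    from evalAt_ext fun t => hΦ t L]
  exact ⟨(smooth.map (LinearMap.fst ℝ V V)).isSmooth s fun t => (mem t).1,
    (smooth.map (LinearMap.snd ℝ V V)).isSmooth s fun t => (mem t).2⟩

theorem circWith (hΦ : IsPointwise Φ F) (hΨ : IsPointwise Ψ G) :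
    IsPointwise (AInf.circWith (forms A).sg Φ Ψ)
      fun t => AInf.circWith (sgPair A.sg) (F t) (G t) :=
  fun t L => map_circWith (f' := F t) (g' := G t) (evalAt t) (evalAt t) (fun _ => rfl) (hΦ t)
    (hΨ t) L

theorem blockComp (hΦ : IsPointwise Φ F) (hΨ : IsPointwise Ψ G) :
    IsPointwise (AInf.blockComp Φ Ψ) fun t => AInf.blockComp (F t) (G t) :=
  fun t L => map_blockComp (m' := F t) (F' := G t) (evalAt t) (evalAt t) (evalAt t) (hΦ t) (hΨ t) L

end IsPointwise

/-! ### The de Rham differential -/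

theorem deRham_cons_cons (u v : Pre V) (l : List (Pre V)) : deRham (u :: v :: l) = 0 := rfl

theorem deRham_fst (L : List (Pre V)) : (deRham L).1 = 0 := by
  match L with
  | [] => rfl
  | [_] => rfl
  | _ :: _ :: _ => rfl

theorem deRham_deRham_add (L : List (Pre V)) (η : Pre V) :
    deRham [deRham L + η] = deRham [η] := by
  change (0, vderiv ((deRham L).1 + η.1)) = ((0, vderiv η.1) : Pre V)
  rw [deRham_fst, zero_add]

theorem evalAt_deRham_singleton {η : Pre V} (h : SmoothOnSquare fun _ t => evalAt t η) (s t : I) :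
    evalAt t (deRham [η]) = dtMul (coeffwise derivT (fun _ t => evalAt t η) s t) :=
  Prod.ext rfl (isSmoothDerivation_derivT.toIsSmoothOperator.coeffwise_map h
    (LinearMap.fst ℝ V V) s t)

theorem evalAt_deRham {L : List (Pre V)} (hL : IsHomog (forms A) L) (s t : I) :
    evalAt t (deRham L) =
      dtMul (unaryCoeffwise derivT s t (L.map fun η (_ : I) t => evalAt t η)) := by
  match L with
  | [] => exact (map_zero dtMul).symm
  | [η] => exact evalAt_deRham_singleton (hL.smoothOnSquare_evalAt _ (by simp)) s t
  | _ :: _ :: _ => exact (map_zero dtMul).symm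

theorem deRham_append_smul_add {x z : List (Pre V)} {k : ℤ} {a b : Pre V} (c : ℝ)
    (ha : a ∈ (forms A).part k) (hb : b ∈ (forms A).part k) :
    deRham (x ++ (c • a + b) :: z) = c • deRham (x ++ a :: z) + deRham (x ++ b :: z) := by
  match x, z with
  | [], [] =>
    have hD := isSmoothDerivation_derivT.toIsSmoothOperator
    have ha := smoothOnSquare_evalAt ha
    have hb := smoothOnSquare_evalAt hb
    refine evalAt_ext fun t => ?_
    simp only [List.nil_append, map_add, map_smul]
    rw [evalAt_deRham_singleton (by simpa using (ha.smul c).add hb) t t,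
      evalAt_deRham_singleton ha t t, evalAt_deRham_singleton hb t t, ← map_smul, ← map_add,
      ← hD.coeffwise_smul ha, ← hD.coeffwise_add (ha.smul c) hb]
    simp only [map_add, map_smul]
  | [], _ :: _ => simp [deRham_cons_cons]
  | [_], _ => simp [deRham_cons_cons]
  | _ :: _ :: _, _ => simp [deRham_cons_cons]

theorem hasDegree_deRham : HasDegree (forms A) (forms A) 1 deRham := by
  rw [hasDegree_iff]
  intro l d hl
  match l, hl with
  | [], _ => exact Submodule.zero_mem _
  | [η], ⟨k, hk, h⟩ =>
    obtain rfl : d = k - 1 := sub_eq_zero.1 h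
    have hD := isSmoothDerivation_derivT.toIsSmoothOperator
    have hη : SmoothOnSquare fun (_ : I) t => η.1 t :=
      (smoothOnSquare_evalAt hk).map (LinearMap.fst ℝ V V)
    refine ⟨(Submodule.zero_mem ((forms A).part (k - 1 + 1 + 1))).1, ?_⟩
    rw [show k - 1 + 1 + 1 - 1 = k by ring]
    exact (hD.smooth_coeffwise hη).isSmooth 0 fun t =>
      hD.coeffwise_mem hη (fun _ t => (evalAt_mem hk t).1) 0 t
  | _ :: _ :: _, _ => exact Submodule.zero_mem _

namespace IsPointwise

variable {Φ : Op (Pre V) (Pre V)}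

theorem smul_evalAt_circWith_deRham (hA : ⨆ k, A.part k = ⊤) {F : I → Op (V × V) (V × V)}
    (hΦ : IsPointwise Φ F) {t : I} {c : ℝ} (hc : c * c = 1)
    (hF : IsTwistedLinear (sgPair A.sg) dtMul c (F t)) {L : List (Pre V)}
    (hL : IsHomog (forms A) L) (s : I) :
    c • evalAt t (AInf.circWith (forms A).sg Φ deRham L) =
      dtMul (splitSum₃ (fun x y z => F t (x.map (evalAt t) ++
        unaryCoeffwise derivT s t (y.map fun η (_ : I) t => evalAt t η) ::
          z.map (evalAt t))) L) := by
  rw [AInf.circWith, map_splitSum₃, map_splitSum₃, ← splitSum₃_smul]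
  refine splitSum₃_congr fun x y z hxyz => ?_
  have hy : IsHomog (forms A) y := fun η hη => hL η (by simp [← hxyz, hη])
  rw [hΦ, List.map_append, List.map_cons, evalAt_deRham hy s, hF, smul_smul, hc, one_smul]
  congr 3
  simp [evalAt_apply, A.sg_sg hA, forms]

theorem evalAt_deRham_apply (hA : ⨆ k, A.part k = ⊤) {F : I → I → Op (V × V) (V × V)} {s : I}
    (hΦ : IsPointwise Φ (F s)) (hF : IsSmoothMultilinear F) {t : I} {c : ℝ} (hc : c * c = 1)
    (hFt : IsTwistedLinear (sgPair A.sg) dtMul c (F s t)) {L : List (Pre V)}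
    (hL : IsHomog (forms A) L) :
    evalAt t (deRham [Φ L]) = dtMul (opCoeffwise derivT F s t (L.map (evalAt t))) +
      c • evalAt t (AInf.circWith (forms A).sg Φ deRham L) := by
  have leibniz := isSmoothDerivation_derivT.coeffwise_apply hF _ hL.smoothOnSquare_evalAt s t
  simp only [List.map_map, Function.comp_def, splitSum₃_map] at leibniz
  have smooth : SmoothOnSquare fun _ t => evalAt t (Φ L) := by
    simpa only [hΦ _ L] using (hF.smooth_evalAt hL).restrict s
  rw [evalAt_deRham_singleton smooth s, hΦ.smul_evalAt_circWith_deRham hA hc hFt hL s, ← map_add,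
    ← leibniz]
  simp only [hΦ _ L]
  rfl

end IsPointwise

/-! ### Forms with values in an `A_∞` algebra -/

theorem isMultilinear_zero : IsMultilinear fun _ : List V => (0 : V) := by
  intro x z c a b
  simp

theorem IsAInf.circWith_eq_zero (hA : ⨆ k, A.part k = ⊤) {μ : Op V V} (hμ : IsAInf A μ)
    (mμ : IsMultilinear μ) : circWith A.sg μ μ = fun _ => 0 :=
  (mμ.circWith mμ A.sg).ext_homog hA isMultilinear_zero fun l hl => by
    rw [← circ_one, hμ.rel l hl]

theorem hasDegree_zero (k : ℤ) : HasDegree A A k fun _ => 0 := fun _ _ _ => Submodule.zero_mem _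

theorem IsAInf.circWith_extendPt (hA : ⨆ k, A.part k = ⊤) {μ : Op V V} (hμ : IsAInf A μ)
    (mμ : IsMultilinear μ) : circWith (sgPair A.sg) (extendPt A 1 μ fun _ => 0)
      (extendPt A 1 μ fun _ => 0) = fun _ => 0 := by
  have mF : IsMultilinear (extendPt A 1 μ fun _ => 0) :=
    isMultilinear_extendPt mμ isMultilinear_zero
  have tF : IsTwistedLinear (sgPair A.sg) dtMul (-1) (extendPt A 1 μ fun _ => 0) := by
    simpa using isTwistedLinear_extendPt (A := A) (k := 1) mμ isMultilinear_zero
  have dF := hasDegree_extendPt hμ.cochain.degree (hasDegree_zero (A := A) (1 - 1))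
  refine IsTwistedLinear.ext_dtMul (ε := A.sg) (τ := sgPair A.sg) (by simp) (mF.circWith mF _)
    isMultilinear_zero (tF.circWith tF mF (dF.sg_apply_one (iSup_part_pairs hA) mF)
      (by simp) (by simp)) (fun _ _ _ => by simp only [map_zero, smul_zero]) fun l => ?_
  have zero_left : circWith A.sg (fun _ => (0 : V)) μ l = 0 := splitSum₃_eq_zero fun _ _ _ _ => rfl
  have zero_right : circWith (fun v => A.sg (A.sg v)) μ (fun _ => 0) l = 0 :=
    splitSum₃_eq_zero fun _ _ _ _ => mμ.map_zero _ _
  rw [circWith_extendPt_inl (τ' := A.sg) mμ isMultilinear_zero mμ (by simp),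
    congrFun (hμ.circWith_eq_zero hA mμ) l, zero_left, zero_right]
  simp

theorem isPointwise_extend_const (μ : Op V V) :
    IsPointwise (extend A 1 (fun _ => μ) fun _ _ => 0) fun _ => extendPt A 1 μ fun _ => 0 :=
  isPointwise_extend 1 _ _

theorem IsAInf.circWith_formsStructure (hA : ⨆ k, A.part k = ⊤) {μ : Op V V} (hμ : IsAInf A μ)
    (mμ : IsMultilinear μ) {L : List (Pre V)} (hL : IsHomog (forms A) L) :
    circWith (forms A).sg (formsStructure A μ) (formsStructure A μ) L = 0 := by
  set Φ : Op (Pre V) (Pre V) := extend A 1 (fun _ => μ) fun _ _ => 0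
  have hΦ : IsPointwise Φ fun _ => extendPt A 1 μ fun _ => 0 := isPointwise_extend_const μ
  have mF : IsMultilinear (extendPt A 1 μ fun _ => 0) :=
    isMultilinear_extendPt mμ isMultilinear_zero
  have tF : IsTwistedLinear (sgPair A.sg) dtMul (-1) (extendPt A 1 μ fun _ => 0) := by
    simpa using isTwistedLinear_extendPt (A := A) (k := 1) mμ isMultilinear_zero
  have unary : deRham [Φ L] = circWith (forms A).sg deRham (AInf.formsStructure A μ) L :=
    (deRham_deRham_add L _).symm.trans
      (circWith_of_unary deRham_cons_cons _ (AInf.formsStructure A μ) L).symm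
  have expand : circWith (forms A).sg (formsStructure A μ) (formsStructure A μ) L =
      deRham [Φ L] + (circWith (forms A).sg Φ deRham L + circWith (forms A).sg Φ Φ L) := by
    rw [← circWith_add_right _ (hΦ.isMultilinear fun _ => mF), unary]
    exact circWith_add_left _ _ _ _ _
  refine evalAt_ext fun t => ?_
  have leibniz := hΦ.evalAt_deRham_apply (F := fun _ _ => extendPt A 1 μ fun _ => 0) (s := 0)
    (t := t) hA ⟨fun _ _ => mF, fun _ => SmoothOnSquare.const _⟩ (by norm_num) tF hL
  have constant : opCoeffwise derivT (fun _ _ => extendPt A 1 μ fun _ => 0) 0 t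
      (L.map (evalAt t)) = 0 := vderiv_const _ _
  rw [expand, map_add, map_add, leibniz, constant, hΦ.circWith hΦ, hμ.circWith_extendPt hA mμ]
  simp

theorem IsAInf.formsStructure (hA : ⨆ k, A.part k = ⊤) {μ : Op V V} (hμ : IsAInf A μ)
    (mμ : IsMultilinear μ) : IsAInf (forms A) (formsStructure A μ) where
  uncurved := by
    refine evalAt_ext fun t => ?_
    rw [AInf.formsStructure, map_add, isPointwise_extend_const]
    simp [deRham, extendPt, dtTerms, markedSum, hμ.uncurved]
  cochain := by
    have hΦ := isPointwise_extend_const (A := A) μ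
    have mF : IsMultilinear (extendPt A 1 μ fun _ => 0) :=
      isMultilinear_extendPt mμ isMultilinear_zero
    refine ⟨fun x z _ a b c _ _ ha hb => ?_, fun ks L h => ?_⟩
    · simp only [AInf.formsStructure]
      rw [deRham_append_smul_add c ha hb, hΦ.isMultilinear fun _ => mF, smul_add]
      abel
    · exact Submodule.add_mem _ (hasDegree_deRham ks L h)
        (hΦ.hasDegree (F := fun _ _ => extendPt A 1 μ fun _ => 0) (s := 0)
          ⟨fun _ _ => mF, fun _ => SmoothOnSquare.const _⟩
          (fun _ => hasDegree_extendPt hμ.cochain.degree (hasDegree_zero _)) ks L h)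
  rel L hL := by rw [circ_one, hμ.circWith_formsStructure hA mμ hL]

end forms

/-! ### The path construction -/

section pathMap

variable {V W : Type*} [AddCommGroup V] [Module ℝ V] [AddCommGroup W] [Module ℝ W]

theorem trees_eq_treeSum (A : GradedSpace V) (a : I → Op V V) (ts : List I) :
    trees A a ts = treeSum a ts := by
  induction ts with
  | nil =>
    funext l
    match l with
    | [] => rfl
    | [_] => rfl
    | _ :: _ :: _ => rfl
  | cons t ts ih => rw [trees, circ_zero, ih, treeSum]

theorem map_treeSum (T : V →ₗ[ℝ] W) {a : I → Op V V} {a' : I → Op W W}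
    (h : ∀ s l, T (a s l) = a' s (l.map T)) (ts : List I) (l : List V) :
    T (treeSum a ts l) = treeSum a' ts (l.map T) := by
  induction ts generalizing l with
  | nil =>
    match l with
    | [] => exact map_zero T
    | [_] => rfl
    | _ :: _ :: _ => exact map_zero T
  | cons t ts ih => exact map_circWith (ε := id) (ε' := id) T T (fun _ => rfl) ih (h t) l

theorem IsSmoothMultilinear.smul_simplexIntegral_dual_treeSum {a : I → I → Op V V}
    (ha : IsSmoothMultilinear a) (ℓ : Module.Dual ℝ V) (i : ℕ) (s t : I) (l : List V) :
    (-1) ^ i * simplexIntegral i s 1 (fun ts => ℓ (treeSum (fun s => a s t) ts l)) =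
      ℓ (AInf.pathTerm a i s t l) := by
  simpa using ha.simplexIntegral_treeSum ℓ t i s (ι := Unit) Finset.univ fun _ => l

theorem pathMap_eq_sum (A : GradedSpace V) (d : ℕ) (a : I → Op V V) (p q : I) {l : List V}
    {w : ℕ → V} (h : ∀ i, ∀ ψ ∈ A.test, (-1) ^ i * simplexIntegral i p q
      (fun ts => ψ (trees A a ts l)) = ψ (w i)) :
    pathMap A d a p q l = ∑ i ∈ Finset.range (l.length + d), w i := by
  refine Finset.sum_congr rfl fun i _ => ?_
  have sign : (-1 : ℝ) ^ i * (-1) ^ i = 1 := by rw [← mul_pow]; simp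
  rw [represented_eq A.test_separates (w := (-1 : ℝ) ^ i • w i), smul_smul, sign, one_smul]
  intro ψ hψ
  rw [map_smul, ← h i ψ hψ, smul_eq_mul, ← mul_assoc, sign, one_mul]

namespace SqForm

variable {A : GradedSpace V} {α : SqForm V}

theorem isPointwise_collapse1 (s : I) :
    IsPointwise (α.collapse1 A s) (α.collapse1Pt A s) :=
  isPointwise_extend 0 _ _

theorem IsForm.isPointwise_Ghat (hα : α.IsForm A 1) :
    IsPointwise (α.Ghat A) fun t => pathOp (α.collapse1Pt A) 0 t := by
  intro t L
  change evalAt t (α.Ghat A L) = pathOp (α.collapse1Pt A) 0 t (L.map (evalAt t))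
  have ha := hα.isSmoothMultilinear_collapse1Pt
  have evalAt_trees (ts : List I) (t : I) : evalAt t (trees (forms A) (α.collapse1 A) ts L) =
      treeSum (fun s => α.collapse1Pt A s t) ts (L.map (evalAt t)) := by
    rw [trees_eq_treeSum]
    exact map_treeSum _ (fun s => isPointwise_collapse1 s t) ts L
  rw [Ghat, pathMap_eq_sum (w := fun i =>
    (fun t => (pathTerm (α.collapse1Pt A) i 0 t (L.map (evalAt t))).1,
      fun t => (pathTerm (α.collapse1Pt A) i 0 t (L.map (evalAt t))).2)), map_sum, pathOp,
    List.length_map]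
  · rfl
  · rintro i ψ ⟨ℓ, -, t, rfl | rfl⟩
    · refine Eq.trans ?_
        (ha.smul_simplexIntegral_dual_treeSum (ℓ ∘ₗ LinearMap.fst ℝ V V) i 0 t (L.map (evalAt t)))
      simp only [← evalAt_trees]
      rfl
    · refine Eq.trans ?_
        (ha.smul_simplexIntegral_dual_treeSum (ℓ ∘ₗ LinearMap.snd ℝ V V) i 0 t (L.map (evalAt t)))
      simp only [← evalAt_trees]
      rfl

theorem IsForm.F_eq_fst_pathOp (hA : ⨆ k, A.part k = ⊤) (hα : α.IsForm A 1) (h0 : α.Uncurved)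
    (h1 : ∀ s t v, α.cs s t [v] = 0) (t : I) (l : List V) :
    α.F A t l = (pathOp (α.collapse1Pt A) 0 t (l.map fun v => (v, 0))).1 := by
  set L : List (V × V) := l.map fun v => (v, 0)
  have ha := hα.isNilpotentFamily_collapse1Pt hA h0 h1
  have fst_treeSum (ts : List I) : trees A (fun s => α.cs s t) ts l =
      LinearMap.fst ℝ V V (treeSum (fun s => α.collapse1Pt A s t) ts L) := by
    rw [trees_eq_treeSum, map_treeSum (LinearMap.fst ℝ V V) (a' := fun s => α.cs s t)
      fun s l => rfl]
    simp [L, Function.comp_def]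
  have last_eq_zero : (pathTerm (α.collapse1Pt A) l.length 0 t L).1 = 0 :=
    congrArg Prod.snd (ha.E_pathTerm_eq_zero l.length 0 t L (by simp [L]))
  rw [F, pathMap_eq_sum (w := fun i => (pathTerm (α.collapse1Pt A) i 0 t L).1), add_zero, pathOp,
    Prod.fst_sum, show L.length = l.length from List.length_map .., Finset.sum_range_succ,
    last_eq_zero, add_zero]
  intro i ℓ _
  simp only [fst_treeSum]
  exact ha.smooth.smul_simplexIntegral_dual_treeSum (ℓ ∘ₗ LinearMap.fst ℝ V V) i 0 t L

end SqForm

end pathMap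

/-! ### The morphism of forms and its restriction to constants -/

section morphisms

variable {V W : Type*} [AddCommGroup V] [Module ℝ V] [AddCommGroup W] [Module ℝ W]
  {A : GradedSpace V} {α : SqForm V}

namespace SqForm

theorem ConstantOnEdge.collapse0_eq_formsStructure {s₀ : I} (h : α.ConstantOnEdge s₀) :
    α.collapse0 A s₀ = formsStructure A (α.c0 s₀ 0) := by
  have c0_const : α.c0 s₀ = fun _ => α.c0 s₀ 0 := funext fun t => funext fun l => (h t l).1
  have ct_zero : α.ct s₀ = fun _ _ => 0 := funext fun t => funext fun l => (h t l).2
  funext L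
  rw [collapse0, c0_const, ct_zero, formsStructure]

theorem IsMC.isAInf_c0 (hα : α.IsMC A) (h0 : α.Uncurved) (s t : I) : IsAInf A (α.c0 s t) where
  uncurved := (h0 s t).1
  cochain := ⟨fun x z _ a b c _ _ _ _ => hα.isForm.h0.isSmoothMultilinear.multilinear s t x z c a b,
    hα.isForm.h0.degree s t⟩
  rel l _ := by rw [circ_one, hα.circWith_c0_c0]

theorem IsForm.isMultilinear_Ghat (hα : α.IsForm A 1) : IsMultilinear (α.Ghat A) :=
  hα.isPointwise_Ghat.isMultilinear fun t =>
    hα.isSmoothMultilinear_collapse1Pt.pathOp.multilinear 0 t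

theorem IsForm.hasDegree_Ghat (hα : α.IsForm A 1) :
    HasDegree (forms A) (forms A) 0 (α.Ghat A) :=
  have ha := hα.isSmoothMultilinear_collapse1Pt
  hα.isPointwise_Ghat.hasDegree (F := pathOp (α.collapse1Pt A)) ha.pathOp
    fun t => HasDegree.pathOp ha hα.hasDegree_collapse1Pt 0 t

theorem IsMC.blockComp_Ghat (hA : ⨆ k, A.part k = ⊤) (hα : α.IsMC A) (h0 : α.Uncurved)
    (h1 : ∀ s t v, α.cs s t [v] = 0) {L : List (Pre V)} (hL : IsHomog (forms A) L) (hne : L ≠ []) :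
    blockComp (α.collapse0 A 1) (α.Ghat A) L =
      circWith (forms A).sg (α.Ghat A) (α.collapse0 A 0) L := by
  have ha := hα.isForm.isNilpotentFamily_collapse1Pt hA h0 h1
  have hG := hα.isForm.isPointwise_Ghat
  have h (s : I) : IsPointwise (extend A 1 (α.c0 s) (α.ct s)) (α.collapse0Pt A s) :=
    isPointwise_extend 1 _ _
  have left : blockComp (α.collapse0 A 1) (α.Ghat A) L =
      deRham [α.Ghat A L] + blockComp (extend A 1 (α.c0 1) (α.ct 1)) (α.Ghat A) L := by
    rw [← blockComp_of_unary (m := deRham) (F := α.Ghat A) deRham_cons_cons hne]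
    exact blockComp_add _ _ _ _
  have right : circWith (forms A).sg (α.Ghat A) (α.collapse0 A 0) L =
      circWith (forms A).sg (α.Ghat A) deRham L +
        circWith (forms A).sg (α.Ghat A) (extend A 1 (α.c0 0) (α.ct 0)) L :=
    circWith_add_right _ hα.isForm.isMultilinear_Ghat _ _ _
  refine evalAt_ext fun t => ?_
  have leibniz := hG.evalAt_deRham_apply hA ha.smooth.pathOp (c := 1) (by norm_num)
    (ha.twistedLinear_pathOp 0 t) hL
  rw [left, right, map_add, map_add, leibniz, (h 1).blockComp hG, hG.circWith (h 0), one_smul]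
  beta_reduce
  rw [← hα.blockComp_pathOp hA h0 h1]
  abel

theorem IsMC.isAInfMorphism_Ghat (hA : ⨆ k, A.part k = ⊤) (hα : α.IsMC A) (h0 : α.Uncurved)
    (h1 : ∀ s t v, α.cs s t [v] = 0) (he0 : α.ConstantOnEdge 0) (he1 : α.ConstantOnEdge 1) :
    IsAInfMorphism (forms A) (formsStructure A (α.c0 0 0)) (forms A)
      (formsStructure A (α.c0 1 0)) (α.Ghat A) where
  source := (hα.isAInf_c0 h0 0 0).formsStructure hA
    (hα.isForm.h0.isSmoothMultilinear.multilinear 0 0)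
  target := (hα.isAInf_c0 h0 1 0).formsStructure hA
    (hα.isForm.h0.isSmoothMultilinear.multilinear 1 0)
  cochain := ⟨fun x z _ a b c _ _ _ _ => hα.isForm.isMultilinear_Ghat x z c a b,
    hα.isForm.hasDegree_Ghat⟩
  rel L hne hL := by
    rw [sum_composition_eq_blockComp, circ_one, ← he0.collapse0_eq_formsStructure,
      ← he1.collapse0_eq_formsStructure, hα.blockComp_Ghat hA h0 h1 hL hne]

end SqForm

theorem const_mem {k : ℤ} {v : V} (hv : v ∈ A.part k) : const v ∈ (forms A).part k :=
  ⟨⟨1, fun _ _ => 1, fun _ => v, fun _ => contDiff_const, fun _ => hv, fun x => by simp [const]⟩,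
    ⟨0, Fin.elim0, Fin.elim0, fun i => i.elim0, fun i => i.elim0, fun x => by simp [const]⟩⟩

theorem IsHomog.map_const {l : List V} (hl : IsHomog A l) : IsHomog (forms A) (l.map const) :=
  List.forall_mem_map.2 fun v hv => (hl v hv).imp fun _ => const_mem

theorem const_smul_add (c : ℝ) (a b : V) : const (c • a + b) = c • const a + const b :=
  Prod.ext rfl (funext fun _ => by simp [const])

theorem deRham_map_const (l : List V) : deRham (l.map const) = 0 := by
  match l with
  | [] => rfl
  | [v] => exact Prod.ext rfl (funext fun t => vderiv_const v t)
  | u :: v :: l => rfl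

theorem formsStructure_map_const {μ : Op V V} (mμ : IsMultilinear μ) (l : List V) :
    formsStructure A μ (l.map const) = const (μ l) := by
  refine evalAt_ext fun t => ?_
  rw [formsStructure, deRham_map_const, zero_add, isPointwise_extend_const, List.map_map]
  exact extendPt_inl (A := A) (k := 1) (Q := fun _ => 0) mμ l

theorem formsStructure_fst (μ : Op V V) (t : I) (L : List (Pre V)) :
    (formsStructure A μ L).1 t = μ (L.map fun η => η.1 t) := by
  change (deRham L).1 t + μ _ = _
  rw [deRham_fst, Pi.zero_apply, zero_add]

namespace IsAInfMorphism

theorem comp_const {W : Type*} [AddCommGroup W] [Module ℝ W] {B : GradedSpace W} {μ : Op V V}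
    {m : Op W W} {G : Op (Pre V) W} (hμ : IsAInf A μ) (mμ : IsMultilinear μ)
    (mG : IsMultilinear G) (hG : IsAInfMorphism (forms A) (formsStructure A μ) B m G) :
    IsAInfMorphism A μ B m fun l => G (l.map const) where
  source := hμ
  target := hG.target
  cochain := by
    refine ⟨fun x z _ a b c _ _ _ _ => ?_, hasDegree_iff.2 fun l d hl => ?_⟩
    · simpa [const_smul_add] using mG (x.map const) (z.map const) c (const a) (const b)
    · exact hasDegree_iff.1 hG.cochain.degree _ d (hl.map fun _ _ => const_mem)
  rel l hne hl := by
    have h := hG.rel (l.map const) (by simpa using hne) hl.map_const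
    rw [sum_composition_eq_blockComp, circ_one] at h ⊢
    have source : circWith A.sg (fun l => G (l.map const)) μ l =
        circWith (forms A).sg G (formsStructure A μ) (l.map const) :=
      map_circWith (f := fun l => G (l.map const)) LinearMap.id const
        (fun v => Prod.ext rfl (funext fun _ => by simp [const, forms])) (fun _ => rfl)
        (fun l => (formsStructure_map_const mμ l).symm) l
    have target : blockComp m (fun l => G (l.map const)) l = blockComp m G (l.map const) :=
      map_blockComp (m' := m) (F' := G) LinearMap.id id const (fun l => by simp) (fun _ => rfl) l
    rw [source, target, h]

theorem comp_eval {B : GradedSpace W} {μ : Op V V} {ν : Op W W} {φ : Op V (Pre W)}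
    (hν : IsAInf B ν) (hφ : IsAInfMorphism A μ (forms B) (formsStructure B ν) φ) (t : I) :
    IsAInfMorphism A μ B ν fun l => (φ l).1 t where
  source := hφ.source
  target := hν
  cochain := by
    refine ⟨fun x z i a b c hx hz ha hb => ?_, fun ks l h => ?_⟩
    · rw [hφ.cochain.linear x z i a b c hx hz ha hb]
      rfl
    · exact (evalAt_mem (hφ.cochain.degree ks l h) t).1
  rel l hne hl := by
    have h := hφ.rel l hne hl
    rw [sum_composition_eq_blockComp, circ_one] at h ⊢
    let T : Pre W →ₗ[ℝ] W := LinearMap.fst ℝ W W ∘ₗ evalAt t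
    have h := congrArg T h
    rwa [comp_circWith, map_blockComp (m' := ν) (F' := fun l => (φ l).1 t) T T id
      (fun L => formsStructure_fst ν t L) (fun l => by rw [List.map_id]; rfl), List.map_id] at h

end IsAInfMorphism

theorem SqForm.IsForm.Ghat_map_const_fst (hA : ⨆ k, A.part k = ⊤) (hα : α.IsForm A 1)
    (h0 : α.Uncurved) (h1 : ∀ s t v, α.cs s t [v] = 0) (t : I) (l : List V) :
    (α.Ghat A (l.map const)).1 t = α.F A t l := by
  have h := congrArg Prod.fst (hα.isPointwise_Ghat t (l.map const))
  rw [List.map_map] at h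
  rw [hα.F_eq_fst_pathOp hA h0 h1]
  exact h

end morphisms

end AInf

end

theorem mainTheorem3_general {V : Type*} [AddCommGroup V] [Module ℝ V] {A : AInf.GradedSpace V}
    (hA : ⨆ k, A.part k = ⊤) {α : AInf.SqForm V} (hα : α.IsMC A) (hα0 : α.Uncurved)
    (hs1 : ∀ s t v, α.cs s t [v] = 0) (hedge0 : α.ConstantOnEdge 0)
    (hedge1 : α.ConstantOnEdge 1) :
    α.collapse0 A 0 = AInf.formsStructure A (α.c0 0 0) ∧
    α.collapse0 A 1 = AInf.formsStructure A (α.c0 1 0) ∧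
    AInf.IsAInfMorphism (AInf.forms A) (AInf.formsStructure A (α.c0 0 0))
      (AInf.forms A) (AInf.formsStructure A (α.c0 1 0)) (α.Ghat A) ∧
    (∀ l t, (α.Ghat A (l.map AInf.const)).1 t = α.F A t l) ∧
    AInf.IsDifferentialHomotopy A (α.c0 0 0) A (α.c0 1 0) (fun t => α.F A t)
      (fun t l => (α.Ghat A (l.map AInf.const)).2 t) := by
  have hG := hα.isAInfMorphism_Ghat hA hα0 hs1 hedge0 hedge1
  have hφ := hG.comp_const (hα.isAInf_c0 hα0 0 0)
    (hα.isForm.h0.isSmoothMultilinear.multilinear 0 0) hα.isForm.isMultilinear_Ghat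
  have hF (l : List V) (t : unitInterval) : (α.Ghat A (l.map AInf.const)).1 t = α.F A t l :=
    hα.isForm.Ghat_map_const_fst hA hα0 hs1 t l
  refine ⟨hedge0.collapse0_eq_formsStructure, hedge1.collapse0_eq_formsStructure, hG, hF,
    fun t => ?_, _, hφ, fun l _ _ => Prod.ext (funext (hF l)) rfl⟩
  simpa only [hF] using hφ.comp_eval (hα.isAInf_c0 hα0 1 0) t

theorem mainTheorem3 {V : Type*} [AddCommGroup V] [Module ℝ V] (𝒱 : ℤ → Submodule ℝ V)
    [DirectSum.Decomposition 𝒱] (α : AInf.SqForm V)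
    (hα : α.IsMC (AInf.gradedSpace 𝒱))
    (hα0 : α.Uncurved)
    (hα11 : α.OneOneZero)
    (hedge0 : α.ConstantOnEdge 0) (hedge1 : α.ConstantOnEdge 1) :
    α.collapse0 (AInf.gradedSpace 𝒱) 0 =
      AInf.formsStructure (AInf.gradedSpace 𝒱) (α.c0 0 0) ∧
    α.collapse0 (AInf.gradedSpace 𝒱) 1 =
      AInf.formsStructure (AInf.gradedSpace 𝒱) (α.c0 1 0) ∧
    AInf.IsAInfMorphism
      (AInf.forms (AInf.gradedSpace 𝒱)) (AInf.formsStructure (AInf.gradedSpace 𝒱) (α.c0 0 0))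
      (AInf.forms (AInf.gradedSpace 𝒱)) (AInf.formsStructure (AInf.gradedSpace 𝒱) (α.c0 1 0))
      (α.Ghat (AInf.gradedSpace 𝒱)) ∧
    (∀ l : List V, l ≠ [] → AInf.IsHomog (AInf.gradedSpace 𝒱) l → ∀ t : unitInterval,
      (α.Ghat (AInf.gradedSpace 𝒱) (l.map AInf.const)).1 t = α.F (AInf.gradedSpace 𝒱) t l) ∧
    AInf.IsDifferentialHomotopy
      (AInf.gradedSpace 𝒱) (α.c0 0 0) (AInf.gradedSpace 𝒱) (α.c0 1 0)
      (fun t => α.F (AInf.gradedSpace 𝒱) t)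
      (fun t l => (α.Ghat (AInf.gradedSpace 𝒱) (l.map AInf.const)).2 t) := by
  obtain ⟨h0, h1, hG, hF, hΘ⟩ := mainTheorem3_general (AInf.iSup_part_gradedSpace 𝒱) hα hα0
    (fun s t v => (hα11 s t v).1) hedge0 hedge1
  exact ⟨h0, h1, hG, fun l _ _ t => hF l t, hΘ⟩
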